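/- **Problem.** An instance $\mathcal I=(G,s,t,L,w)$ of the weighted Label $s$-$t$ Cut problem consists of a (directed or undirected) graph $G=(V,E)$ without parallel edges, with $n=|V|$ vertices, two distinct vertices $s,t\in V$, a non-empty finite label set $L$ with $q=|L|$, a label $\ell(e)\in L$ for every edge $e$, and weights $w_\ell\ge 0$ ($\ell\in L$). A *label $s$-$t$ cut* is a set $L'\subseteq L$ such that $t$ is not reachable from $s$ once all edges with labels in $L'$ are removed. Its weight is $w(L')=\sum_{\ell\in L'}w_\ell$, and $\mathrm{OPT}(\mathcal I)$ is the minimum weight of a label $s$-$t$ cut. **Two-stage algorithm for multigraphs with forbidden labels.** The input is a multigraph on $n$ vertices with vertices $s,t$, each edge having one label, and a set $A$ of admissible labels; all other labels are forbidden. Edges with an admissible label have length $1$, edges with a forbidden label have length $0$, and $\mathrm{dist}$ is the resulting distance in the current graph. If $\mathrm{dist}(s,t)=0$, return "failure". Otherwise let $\mu$ be the maximum edge multiplicity, carry out the following for every guess $g\in\{1,\dots,\max(1,|A|)\}$ of the optimum, and return a smallest one of the sets found. 1. Start with $A_1=\emptyset$. While $\mathrm{dist}(s,t)\le n^{2/3}\mu^{1/3}/g^{1/3}$: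 take a shortest $s$-$t$ path, add all its admissible labels to $A_1$, and remove all edges with these labels. 2. If $t$ is still reachable from $s$, let $V_i$ be the set of vertices at distance $i$ from $s$ and $\tau=\mathrm{dist}(s,t)$. Let $E'$ be a smallest one among the sets of edges from $V_i$ to $V_{i+1}$, $0\le i<\tau$, and let $A_2$ be the set of labels on $E'$. If $t$ is not reachable from $s$, let $A_2=\emptyset$. The set found is $A_1\cup A_2$. **Algorithm for weighted Label $s$-$t$ Cut.** For every $k\in\{1,\dots,q\}$ and every $W\in\{w_\ell\mid\ell\in L\}$ (guesses of the number of labels and of the maximum label weight of an optimal solution), do the following. For each label $\ell$ with $w_\ell\le W$ let $\bar w_\ell=\lceil w_\ell k/W\rceil$ (with $\bar w_\ell=0$ if $w_\ell=0$), and introduce copies $\ell^{(1)},\dots,\ell^{(\bar w_\ell)}$ of it as admissible labels; labels with $w_\ell>W$ are forbidden. Replace each edge whose label $\ell$ satisfies $w_\ell\le W$ by $\bar w_\ell$ parallel edges labelled $\ell^{(1)},\dots,\ell^{(\bar w_\ell)}$, and keep each edge with a forbidden label. Run the two-stage algorithm on this multigraph; unless it fails, it yields a set $\tilde A'$ of copies,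 and the candidate is the set of those $\ell$ with $w_\ell\le W$ all of whose copies lie in $\tilde A'$. Return a candidate of minimum weight. **Theorem.** This algorithm approximates the weighted Label $s$-$t$ Cut problem within a factor $O(n^{2/3})$ in polynomial time. That is: * There is an absolute constant $C$ such that on every instance $\mathcal I$ the algorithm returns a solution, and, however ties are broken (choice of shortest paths and of minima), every set $L'$ that it can return is a label $s$-$t$ cut with $w(L')\le C\,n^{2/3}\,\mathrm{OPT}(\mathcal I)$. * There are a program and a polynomial $p$ such that on every instance whose weights are rational and given as fractions of natural numbers, the program computes a set that the algorithm can return, within at most $p(N)$ steps, where $N$ is the sum of the numbers of vertices, edges and labels and of the bit lengths of all numerators and denominators. Steps are counted in a first-order language over natural numbers, pairs and lists (addition, truncated subtraction, multiplication, comparison, pairing, list operations, bounded loops), in which every elementary operation takes one step and a multiplication costs in addition the bit lengths of its factors. -/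

import Mathlib

namespace LabelCut

/-! ## The weighted Label s-t Cut problem -/

/-- An instance of weighted Label `s`-`t` Cut. The vertices are `Fin n` and the labels `Fin q`;
`adj u v = some ℓ` says that `(u, v)` is an edge with label `ℓ`, and `adj u v = none` that `(u, v)`
is not an edge, so there are no parallel edges. The graph is directed; an undirected graph is the
case in which `adj` is symmetric (an undirected edge is a pair of opposite arcs with one label). -/
structure Instance where
  n : ℕ
  q : ℕ
  adj : Fin n → Fin n → Option (Fin q)
  s : Fin n
  t : Fin n
  w : Fin q → ℝ
  s_ne_t : s ≠ t
  q_pos : 0 < q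
  w_nonneg : ∀ l, 0 ≤ w l

/-- `S` is a label `s`-`t` cut: once the edges with labels in `S` are removed, `t` cannot be
reached from `s`. -/
def Instance.IsLabelCut (I : Instance) (S : Finset (Fin I.q)) : Prop :=
  ¬ Relation.ReflTransGen (fun u v => ∃ l, I.adj u v = some l ∧ l ∉ S) I.s I.t

/-- The weight of a set of labels. -/
noncomputable def Instance.weight (I : Instance) (S : Finset (Fin I.q)) : ℝ := ∑ l ∈ S, I.w l

/-! ## Label s-t Cut on multigraphs with forbidden labels -/

/-- A multigraph on `V` with labelled edges, a source, a sink and a set `A` of admissible labels.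
The labels outside `A` are the forbidden ones. As above, an undirected edge is a pair of opposite
arcs. -/
structure MultiInstance (V E Λ : Type) where
  edges : Finset E
  src : E → V
  tgt : E → V
  lab : E → Λ
  s : V
  t : V
  A : Finset Λ

namespace MultiInstance

variable {V E Λ : Type} [Fintype V] [DecidableEq V] [DecidableEq E] [DecidableEq Λ]

/-- `p` is the list of edges of a walk from the first to the second vertex in the subgraph with
edge set `R`. -/
def IsWalk (M : MultiInstance V E Λ) (R : Finset E) : V → List E → V → Prop
  | u, [], v => u = v
  | u, e :: p, v => e ∈ R ∧ M.src e = u ∧ IsWalk M R (M.tgt e) p v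

/-- The length of a walk: an edge with an admissible label has length one, an edge with a
forbidden label has length zero. -/
def len (M : MultiInstance V E Λ) (p : List E) : ℕ :=
  (p.map fun e => if M.lab e ∈ M.A then 1 else 0).sum

/-- The distance between two vertices in the subgraph with edge set `R`; it is `⊤` if the second
vertex is not reachable from the first. -/
noncomputable def dist (M : MultiInstance V E Λ) (R : Finset E) (u v : V) : ℕ∞ :=
  ⨅ (p : List E) (_ : M.IsWalk R u p v), (M.len p : ℕ∞)

/-- `p` is a shortest `s`-`t` path in the subgraph with edge set `R`. (A shortest walk can differ
from a shortest path only by closed walks of length zero, which hold no admissible label.) -/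
def IsShortest (M : MultiInstance V E Λ) (R : Finset E) (p : List E) : Prop :=
  M.IsWalk R M.s p M.t ∧ (M.len p : ℕ∞) = M.dist R M.s M.t

/-- The admissible labels that appear on the walk `p`. -/
def admLabels (M : MultiInstance V E Λ) (p : List E) : Finset Λ :=
  (p.map M.lab).toFinset ∩ M.A

/-- The maximum multiplicity of an edge. -/
def mu (M : MultiInstance V E Λ) : ℕ :=
  M.edges.sup fun e => (M.edges.filter fun f => M.src f = M.src e ∧ M.tgt f = M.tgt e).card

/-- The threshold `n^(2/3) μ^(1/3) / g^(1/3)` of the first stage, for the guess `g` of the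
optimum. -/
noncomputable def threshold (M : MultiInstance V E Λ) (g : ℕ) : ℝ :=
  (Fintype.card V : ℝ) ^ (2 / 3 : ℝ) * (M.mu : ℝ) ^ (1 / 3 : ℝ) / (g : ℝ) ^ (1 / 3 : ℝ)

/-- The while-loop of the first stage: `M.StageOne θ R A₁ R' A₁'` says that the loop, entered with
remaining edges `R` and chosen labels `A₁`, can end with remaining edges `R'` and chosen
labels `A₁'`. -/
inductive StageOne (M : MultiInstance V E Λ) (θ : ℝ) :
    Finset E → Finset Λ → Finset E → Finset Λ → Prop
  | done (R : Finset E) (A₁ : Finset Λ)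
      (h : ¬ ∃ d : ℕ, M.dist R M.s M.t = (d : ℕ∞) ∧ (d : ℝ) ≤ θ) :
      StageOne M θ R A₁ R A₁
  | step (R : Finset E) (A₁ : Finset Λ) (p : List E) (R' : Finset E) (A₁' : Finset Λ)
      (h : ∃ d : ℕ, M.dist R M.s M.t = (d : ℕ∞) ∧ (d : ℝ) ≤ θ)
      (hp : M.IsShortest R p)
      (hrest : StageOne M θ (R.filter fun e => M.lab e ∉ M.admLabels p) (A₁ ∪ M.admLabels p)
        R' A₁') :
      StageOne M θ R A₁ R' A₁'

open Classical in
/-- The edges of `R` that lead from the layer at distance `i` from `s` to the layer at distance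
`i + 1`. -/
noncomputable def layerCut (M : MultiInstance V E Λ) (R : Finset E) (i : ℕ) : Finset E :=
  R.filter fun e =>
    M.dist R M.s (M.src e) = (i : ℕ∞) ∧ M.dist R M.s (M.tgt e) = ((i + 1 : ℕ) : ℕ∞)

/-- The second stage: the labels of a smallest one among the cuts between consecutive layers up to
the layer of `t`. If `t` is no longer reachable from `s`, nothing is chosen. -/
def StageTwo (M : MultiInstance V E Λ) (R : Finset E) (A₂ : Finset Λ) : Prop :=
  (M.dist R M.s M.t = ⊤ ∧ A₂ = ∅) ∨
  ∃ τ i : ℕ, M.dist R M.s M.t = (τ : ℕ∞) ∧ i < τ ∧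
    (∀ j < τ, (M.layerCut R i).card ≤ (M.layerCut R j).card) ∧
    A₂ = (M.layerCut R i).image M.lab

/-- Both stages, for the guess `g` of the optimum, can choose the labels `A'`. -/
def TwoStage (M : MultiInstance V E Λ) (g : ℕ) (A' : Finset Λ) : Prop :=
  ∃ (R : Finset E) (A₁ A₂ : Finset Λ),
    M.StageOne (M.threshold g) M.edges ∅ R A₁ ∧ M.StageTwo R A₂ ∧ A' = A₁ ∪ A₂

/-- The values tried for the optimum: `1, …, |A|` (and `1` if `A` is empty). -/
def guesses (M : MultiInstance V E Λ) : Finset ℕ := Finset.Icc 1 (max 1 M.A.card)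

/-- The possible results of the two-stage algorithm for multigraphs with forbidden labels.
`none` stands for "failure". Guessing the optimum means to run the two stages for every possible
value and to return a solution of minimum size. -/
inductive Output (M : MultiInstance V E Λ) : Option (Finset Λ) → Prop
  | failure (h : M.dist M.edges M.s M.t = 0) : Output M none
  | success (h : M.dist M.edges M.s M.t ≠ 0) (sol : ℕ → Finset Λ)
      (hsol : ∀ g ∈ M.guesses, M.TwoStage g (sol g))
      (g : ℕ) (hg : g ∈ M.guesses)
      (hmin : ∀ g' ∈ M.guesses, (sol g).card ≤ (sol g').card) :
      Output M (some (sol g))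

end MultiInstance

/-! ## The algorithm for weighted Label s-t Cut -/

namespace Instance

/-- The rounded weight `⌈w_ℓ k / W⌉` of a label `ℓ` with `w_ℓ ≤ W`, where `k` is the guess of the
number of labels of an optimal solution and `W` the guess of their maximum weight. For `w_ℓ = 0`
it is zero (also if `W = 0`). -/
noncomputable def wbar (I : Instance) (k : ℕ) (W : ℝ) (l : Fin I.q) : ℕ :=
  if I.w l = 0 then 0 else ⌈I.w l * k / W⌉₊

/-- The copies of the label `ℓ`. -/
noncomputable def group (I : Instance) (k : ℕ) (W : ℝ) (l : Fin I.q) : Finset (Fin I.q × ℕ) :=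
  (Finset.range (I.wbar k W l)).image fun i => (l, i)

open Classical in
/-- The multigraph instance for the guesses `k` and `W`. An edge `(u, v)` of label `ℓ` with
`w_ℓ ≤ W` becomes `wbar ℓ` parallel edges `(u, v, ℓ, i)`, the `i`-th one with the label `(ℓ, i)`,
and these labels are admissible. An edge with a heavier label is kept as one edge `(u, v, ℓ, 0)`,
whose label `(ℓ, 0)` is forbidden. -/
noncomputable def reduce (I : Instance) (k : ℕ) (W : ℝ) :
    MultiInstance (Fin I.n) (Fin I.n × Fin I.n × Fin I.q × ℕ) (Fin I.q × ℕ) where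
  edges := (Finset.univ : Finset (Fin I.n × Fin I.n)).biUnion fun uv =>
    (I.adj uv.1 uv.2).elim ∅ fun l =>
      (Finset.range (if I.w l ≤ W then I.wbar k W l else 1)).image fun i => (uv.1, uv.2, l, i)
  src := fun e => e.1
  tgt := fun e => e.2.1
  lab := fun e => e.2.2
  s := I.s
  t := I.t
  A := (Finset.univ.filter fun l => I.w l ≤ W).biUnion fun l => I.group k W l

open Classical in
/-- The labels of weight at most `W` all of whose copies lie in `A'`. -/
noncomputable def convert (I : Instance) (k : ℕ) (W : ℝ) (A' : Finset (Fin I.q × ℕ)) :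
    Finset (Fin I.q) :=
  Finset.univ.filter fun l => I.w l ≤ W ∧ I.group k W l ⊆ A'

/-- The algorithm with the guesses `k` and `W` can return `L'` (`none` is "failure"). -/
def GuessOutput (I : Instance) (k : ℕ) (W : ℝ) (L' : Option (Finset (Fin I.q))) : Prop :=
  ∃ A' : Option (Finset (Fin I.q × ℕ)),
    (I.reduce k W).Output A' ∧ L' = A'.map (I.convert k W)

/-- The algorithm can return `L'`: it tries every `k` in `1, …, q` and every label weight `W`, and
returns a solution of minimum weight among those found. -/
def Output (I : Instance) (L' : Finset (Fin I.q)) : Prop :=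
  ∃ out : ℕ → ℝ → Option (Finset (Fin I.q)),
    (∀ k ∈ Finset.Icc 1 I.q, ∀ W ∈ Set.range I.w, I.GuessOutput k W (out k W)) ∧
    (∃ k ∈ Finset.Icc 1 I.q, ∃ W ∈ Set.range I.w, out k W = some L') ∧
    ∀ k ∈ Finset.Icc 1 I.q, ∀ W ∈ Set.range I.w, ∀ S, out k W = some S →
      I.weight L' ≤ I.weight S

end Instance

/-! ## A programming language with a step count

A first-order language over natural numbers, pairs and lists. Every elementary operation takes one
step, except that a product also costs the bit lengths of its factors. Lists and pairs are
shared, not copied. Every number that comes up within `T` steps has at most `T` bits more than the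
numbers of the input and of the program, so the step count is polynomially related to the running
time of a Turing machine. -/

/-- The data types. -/
inductive Ty where
  | nat : Ty
  | prod : Ty → Ty → Ty
  | list : Ty → Ty

/-- The values of a data type. -/
def Ty.Val : Ty → Type
  | .nat => ℕ
  | .prod a b => a.Val × b.Val
  | .list a => List a.Val

/-- The variables of type `a` in a context: de Bruijn indices. -/
inductive Var : List Ty → Ty → Type where
  | zero {Γ : List Ty} {a : Ty} : Var (a :: Γ) a
  | succ {Γ : List Ty} {a b : Ty} : Var Γ a → Var (b :: Γ) a

/-- The values of the variables of a context. -/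
def Env : List Ty → Type
  | [] => Unit
  | a :: Γ => a.Val × Env Γ

/-- The value of a variable. -/
def Var.get {Γ : List Ty} {a : Ty} : Var Γ a → Env Γ → a.Val
  | .zero, ρ => ρ.1
  | .succ x, ρ => x.get ρ.2

/-- Programs with free variables in `Γ` and a result of type `a`. -/
inductive Prog : List Ty → Ty → Type where
  | var {Γ : List Ty} {a : Ty} (x : Var Γ a) : Prog Γ a
  | const {Γ : List Ty} (c : ℕ) : Prog Γ .nat
  | plus {Γ : List Ty} (e f : Prog Γ .nat) : Prog Γ .nat
  | minus {Γ : List Ty} (e f : Prog Γ .nat) : Prog Γ .nat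
  | times {Γ : List Ty} (e f : Prog Γ .nat) : Prog Γ .nat
  /-- if `e ≤ f` then `x` else `y` -/
  | ifLe {Γ : List Ty} {a : Ty} (e f : Prog Γ .nat) (x y : Prog Γ a) : Prog Γ a
  | pair {Γ : List Ty} {a b : Ty} (e : Prog Γ a) (f : Prog Γ b) : Prog Γ (.prod a b)
  | fst {Γ : List Ty} {a b : Ty} (e : Prog Γ (.prod a b)) : Prog Γ a
  | snd {Γ : List Ty} {a b : Ty} (e : Prog Γ (.prod a b)) : Prog Γ b
  | nil {Γ : List Ty} {a : Ty} : Prog Γ (.list a)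
  | cons {Γ : List Ty} {a : Ty} (e : Prog Γ a) (f : Prog Γ (.list a)) : Prog Γ (.list a)
  /-- case distinction on a list: `x` if it is empty, else `y` applied to its head and tail -/
  | caseList {Γ : List Ty} {a b : Ty} (e : Prog Γ (.list a)) (x : Prog Γ b)
      (y : Prog (a :: .list a :: Γ) b) : Prog Γ b
  | letIn {Γ : List Ty} {a b : Ty} (e : Prog Γ a) (body : Prog (a :: Γ) b) : Prog Γ b
  /-- a loop over the members of a list; the body maps the member and the current state to the
  next state -/
  | forEach {Γ : List Ty} {a b : Ty} (e : Prog Γ (.list a)) (init : Prog Γ b)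
      (body : Prog (a :: b :: Γ) b) : Prog Γ b
  /-- a loop over `0, …, e - 1`; the body maps the counter and the current state to the next
  state -/
  | loop {Γ : List Ty} {b : Ty} (e : Prog Γ .nat) (init : Prog Γ b)
      (body : Prog (.nat :: b :: Γ) b) : Prog Γ b

namespace Prog

/-- The value of a program. -/
def val {Γ : List Ty} {a : Ty} : Prog Γ a → Env Γ → a.Val
  | .var x, ρ => x.get ρ
  | .const c, _ => c
  | .plus e f, ρ => Nat.add (e.val ρ) (f.val ρ)
  | .minus e f, ρ => Nat.sub (e.val ρ) (f.val ρ)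
  | .times e f, ρ => Nat.mul (e.val ρ) (f.val ρ)
  | .ifLe e f x y, ρ => if Nat.ble (e.val ρ) (f.val ρ) then x.val ρ else y.val ρ
  | .pair e f, ρ => (e.val ρ, f.val ρ)
  | .fst e, ρ => (e.val ρ).1
  | .snd e, ρ => (e.val ρ).2
  | .nil, _ => []
  | .cons e f, ρ => List.cons (e.val ρ) (f.val ρ)
  | .caseList e x y, ρ => List.casesOn (e.val ρ) (x.val ρ) fun h tl => y.val (h, tl, ρ)
  | .letIn e body, ρ => body.val (e.val ρ, ρ)
  | .forEach e init body, ρ => List.foldl (fun st x => body.val (x, st, ρ)) (init.val ρ) (e.val ρ)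
  | .loop e init body, ρ =>
      List.foldl (fun st i => body.val (i, st, ρ)) (init.val ρ) (List.range (e.val ρ))

/-- The number of steps in which a program is evaluated. In the loops, the second component of the
folded pair adds up the steps of the rounds. -/
def cost {Γ : List Ty} {a : Ty} : Prog Γ a → Env Γ → ℕ
  | .var _, _ => 1
  | .const _, _ => 1
  | .plus e f, ρ => 1 + e.cost ρ + f.cost ρ
  | .minus e f, ρ => 1 + e.cost ρ + f.cost ρ
  | .times e f, ρ => 1 + Nat.size (e.val ρ) + Nat.size (f.val ρ) + e.cost ρ + f.cost ρ
  | .ifLe e f x y, ρ =>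
      1 + e.cost ρ + f.cost ρ +
        (if Nat.ble (e.val ρ) (f.val ρ) then x.cost ρ else y.cost ρ)
  | .pair e f, ρ => 1 + e.cost ρ + f.cost ρ
  | .fst e, ρ => 1 + e.cost ρ
  | .snd e, ρ => 1 + e.cost ρ
  | .nil, _ => 1
  | .cons e f, ρ => 1 + e.cost ρ + f.cost ρ
  | .caseList e x y, ρ =>
      1 + e.cost ρ + List.casesOn (e.val ρ) (x.cost ρ) fun h tl => y.cost (h, tl, ρ)
  | .letIn e body, ρ => 1 + e.cost ρ + body.cost (e.val ρ, ρ)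
  | .forEach e init body, ρ =>
      1 + e.cost ρ + init.cost ρ +
        (List.foldl (fun st x => (body.val (x, st.1, ρ), st.2 + 1 + body.cost (x, st.1, ρ)))
          (init.val ρ, 0) (e.val ρ)).2
  | .loop e init body, ρ =>
      1 + e.cost ρ + init.cost ρ +
        (List.foldl (fun st i => (body.val (i, st.1, ρ), st.2 + 1 + body.cost (i, st.1, ρ)))
          (init.val ρ, 0) (List.range (e.val ρ))).2

end Prog

/-! ## Instances as inputs of programs -/

/-- An input: the number of vertices, the source, the sink, the list of the edges `(u, v, ℓ)`, and
for each label its weight as a fraction (numerator, denominator). -/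
structure Input where
  n : ℕ
  s : ℕ
  t : ℕ
  edges : List (ℕ × ℕ × ℕ)
  weights : List (ℕ × ℕ)

/-- The data type of inputs. -/
def inputTy : Ty :=
  .prod .nat (.prod .nat (.prod .nat
    (.prod (.list (.prod .nat (.prod .nat .nat))) (.list (.prod .nat .nat)))))

/-- An input as a value of the programming language. -/
def Input.toVal (x : Input) : inputTy.Val :=
  ((x.n, x.s, x.t, x.edges, x.weights) :
    ℕ × ℕ × ℕ × List (ℕ × ℕ × ℕ) × List (ℕ × ℕ))

/-- The list of numbers that the program `P` computes from the input `x`. -/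
def Prog.resultOn (P : Prog [inputTy] (.list .nat)) (x : Input) : List ℕ := P.val (x.toVal, ())

/-- The number of steps of the program `P` on the input `x`. -/
def Prog.stepsOn (P : Prog [inputTy] (.list .nat)) (x : Input) : ℕ := P.cost (x.toVal, ())

/-- The size of an input: the number of vertices, edges and labels, plus the bit lengths of the
numerators and denominators of the label weights. -/
def Input.size (x : Input) : ℕ :=
  x.n + x.edges.length + x.weights.length +
    (x.weights.map fun c => Nat.size c.1 + Nat.size c.2).sum

/-- The input `x` describes the instance `I` (whose weights then are rational). -/
structure Input.Describes (x : Input) (I : Instance) : Prop where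
  n_eq : x.n = I.n
  s_eq : x.s = I.s
  t_eq : x.t = I.t
  edges_nodup : x.edges.Nodup
  mem_edges : ∀ e, e ∈ x.edges ↔
    ∃ (u v : Fin I.n) (l : Fin I.q), I.adj u v = some l ∧ e = ((u : ℕ), (v : ℕ), (l : ℕ))
  weights_length : x.weights.length = I.q
  weights_eq : ∀ l : Fin I.q, ∃ a b : ℕ,
    x.weights[(l : ℕ)]? = some (a, b) ∧ 0 < b ∧ I.w l = (a : ℝ) / b

end LabelCut

namespace LabelCut

/-! ## Polynomial-time functions -/

/-! Approximation. Fix a label cut `S`, let `k` be its number of labels and `W > 0` its largest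
weight, and consider the candidate for these two guesses. Let `g` be the number of copies of the
labels of `S`. Rounding gives `w k ≤ wbar W ≤ w k + W`, whence `g W ≤ 2 k w(S)`. Light labels have
at most `k` copies, so the multiplicity satisfies `μ ≤ k`, and the heaviest label of `S` has exactly
`k` copies, so `μ ≤ k ≤ g`. The copies of `S` meet every walk of the multigraph, and for the guess
`g` both stages are cheap. In stage one every path taken contains a new member of this cut, so at
most `g` rounds occur and at most `g θ` labels are chosen (`StageOne.card_le`), where `θ` is the
threshold. In stage two more than `θ` disjoint layers share `n` vertices, so two consecutive ones
are small and at most `μ n² / τ²` edges run between them (`StageTwo.card_mul_sq_le`). The threshold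
balances the two bounds: each is at most `n^(2/3) μ^(1/3) g^(2/3) ≤ n^(2/3) g` (`TwoStage.card_le`).
A label is returned only if all its copies are chosen, so the candidate has weight at most `2
n^(2/3) g W / k ≤ 4 n^(2/3) w(S)` (`Output.weight_le`). If all weights in `S` vanish, its labels
have no copies, the multigraph is already disconnected, and a candidate of weight zero is found.

Running time. `PT f` says that a program computes `f` in polynomial time with values of polynomial
size. This class is closed under the constructs of the language and under folds whose states stay
small (`PT.foldl`), so the polynomial bound for the algorithm on lists is mostly a matter of
`fun_prop`. Distances come from a Bellman-Ford table. Real arithmetic is avoided: weights are scaled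
by the product of all denominators, the threshold test is cubed, and the ceiling becomes a
comparison of products. At most `q` copies per label are needed because `wbar ≤ k ≤ q`. Correctness
relates lists to finite sets through `Represents`, up to `mainL_spec`, which exhibits the computed
list as a possible output of the algorithm. -/

/-- A type whose members are represented by values of the programming language. -/
class Coded (α : Type) where
  ty : Ty
  enc : α → ty.Val
  sz : α → ℕ

open Coded

/-- A number counts with its bit length, so a loop up to a given number is not polynomial in this
sense. Counters therefore run over lists, and the list of vertices is built outside this calculus,
in `withRange`. -/
instance Coded.nat : Coded ℕ := ⟨.nat, fun n => n, Nat.size⟩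

instance Coded.prod {α β : Type} [Coded α] [Coded β] : Coded (α × β) :=
  ⟨.prod (ty α) (ty β), fun x => (enc x.1, enc x.2), fun x => sz x.1 + sz x.2 + 1⟩

instance Coded.list {α : Type} [Coded α] : Coded (List α) :=
  ⟨.list (ty α), fun l => l.map enc, fun l => (l.map fun a => sz a + 1).sum⟩

section PolyBd

variable {α β γ : Type} [Coded α] [Coded β] [Coded γ]

/-- The function `h` is bounded by a polynomial in the size of its argument. -/
def PolyBd (h : α → ℕ) : Prop := ∃ p : Polynomial ℕ, ∀ x, h x ≤ p.eval (sz x)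

/-- Natural coefficients make the bounding polynomials monotone, so that estimates of the argument
can be substituted into them. -/
theorem eval_mono (p : Polynomial ℕ) : Monotone fun n => p.eval n := by
  intro m n h
  simp only [Polynomial.eval_eq_sum, Polynomial.sum]
  exact Finset.sum_le_sum fun i _ => Nat.mul_le_mul_left _ (Nat.pow_le_pow_left h i)

theorem PolyBd.mono {h h' : α → ℕ} (hh : PolyBd h') (le : ∀ x, h x ≤ h' x) : PolyBd h := by
  obtain ⟨p, hp⟩ := hh
  exact ⟨p, fun x => (le x).trans (hp x)⟩

theorem PolyBd.const (c : ℕ) : PolyBd fun _ : α => c := ⟨Polynomial.C c, fun x => by simp⟩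

theorem PolyBd.size : PolyBd fun x : α => sz x := ⟨Polynomial.X, fun x => by simp⟩

theorem PolyBd.add {h h' : α → ℕ} (hh : PolyBd h) (hh' : PolyBd h') :
    PolyBd fun x => h x + h' x := by
  obtain ⟨p, hp⟩ := hh
  obtain ⟨p', hp'⟩ := hh'
  exact ⟨p + p', fun x => by simpa using Nat.add_le_add (hp x) (hp' x)⟩

theorem PolyBd.mul {h h' : α → ℕ} (hh : PolyBd h) (hh' : PolyBd h') :
    PolyBd fun x => h x * h' x := by
  obtain ⟨p, hp⟩ := hh
  obtain ⟨p', hp'⟩ := hh'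
  exact ⟨p * p', fun x => by simpa using Nat.mul_le_mul (hp x) (hp' x)⟩

theorem PolyBd.eval {h : α → ℕ} (hh : PolyBd h) (q : Polynomial ℕ) :
    PolyBd fun x => q.eval (h x) := by
  obtain ⟨p, hp⟩ := hh
  exact ⟨q.comp p, fun x => by simpa using eval_mono q (hp x)⟩

theorem PolyBd.comp {h : β → ℕ} {f : α → β} (hh : PolyBd h) (hf : PolyBd fun x => sz (f x)) :
    PolyBd fun x => h (f x) := by
  obtain ⟨q, hq⟩ := hh
  exact (hf.eval q).mono fun x => hq (f x)

theorem sz_mem_le {l : List α} {a : α} (h : a ∈ l) : sz a + 1 ≤ sz l :=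
  List.single_le_sum (by simp) _ (List.mem_map_of_mem (f := fun a => sz a + 1) h)

theorem length_le_sz (l : List α) : l.length ≤ sz l := by
  induction l with
  | nil => simp
  | cons a l ih =>
    simp only [sz, List.length_cons, List.map_cons, List.sum_cons] at ih ⊢
    omega

theorem sz_list_le {l : List α} {B : ℕ} (h : ∀ a ∈ l, sz a ≤ B) : sz l ≤ l.length * (B + 1) := by
  have := List.sum_le_card_nsmul (l.map fun a => sz a + 1) (B + 1) (by
    simpa using h)
  simpa [sz] using this

theorem sz_sublist_le {l l' : List α} (h : l.Sublist l') : sz l ≤ sz l' :=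
  (h.map _).sum_le_sum (by simp)

theorem sz_append (l l' : List α) : sz (l ++ l') = sz l + sz l' := by simp [sz]

theorem sz_cons (a : α) (l : List α) : sz (a :: l) = sz a + 1 + sz l := by simp [sz]

theorem sz_nil : sz ([] : List α) = 0 := rfl

theorem sz_prod (a : α) (b : β) : sz (a, b) = sz a + sz b + 1 := rfl

end PolyBd

/-! ### Closure of the polynomial-time functions under the constructs of the language. -/

section PT

variable {α β γ δ : Type} [Coded α] [Coded β] [Coded γ] [Coded δ]

/-- The function `f` is computed by a program in polynomial time, and the size of its value is
polynomially bounded. -/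
@[fun_prop]
def PT (f : α → β) : Prop :=
  (PolyBd fun x => sz (f x)) ∧
    ∃ (P : ∀ Γ : List Ty, Prog (ty α :: Γ) (ty β)) (c : α → ℕ), PolyBd c ∧
      ∀ (x : α) (Γ : List Ty) (ρ : Env Γ),
        (P Γ).val (enc x, ρ) = enc (f x) ∧ (P Γ).cost (enc x, ρ) ≤ c x

theorem exists_constProg (a : Ty) (v : a.Val) :
    ∃ (P : ∀ Γ : List Ty, Prog Γ a) (c : ℕ),
      ∀ (Γ : List Ty) (ρ : Env Γ), (P Γ).val ρ = v ∧ (P Γ).cost ρ ≤ c := by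
  induction a with
  | nat => exact ⟨fun Γ => .const v, 1, fun Γ ρ => ⟨rfl, le_rfl⟩⟩
  | prod a b iha ihb =>
    obtain ⟨P, c, hP⟩ := iha v.1
    obtain ⟨Q, d, hQ⟩ := ihb v.2
    refine ⟨fun Γ => .pair (P Γ) (Q Γ), 1 + c + d, fun Γ ρ => ⟨?_, ?_⟩⟩
    · simp only [Prog.val, (hP Γ ρ).1, (hQ Γ ρ).1]; rfl
    · simp only [Prog.cost]
      have := (hP Γ ρ).2
      have := (hQ Γ ρ).2
      omega
  | list a ih =>
    have key : ∀ v : List a.Val, ∃ (P : ∀ Γ : List Ty, Prog Γ (.list a)) (c : ℕ),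
        ∀ (Γ : List Ty) (ρ : Env Γ), (P Γ).val ρ = v ∧ (P Γ).cost ρ ≤ c := by
      intro v
      induction v with
      | nil => exact ⟨fun Γ => .nil, 1, fun Γ ρ => ⟨rfl, le_rfl⟩⟩
      | cons x v ihv =>
        obtain ⟨P, c, hP⟩ := ih x
        obtain ⟨Q, d, hQ⟩ := ihv
        refine ⟨fun Γ => .cons (P Γ) (Q Γ), 1 + c + d, fun Γ ρ => ⟨?_, ?_⟩⟩
        · simp only [Prog.val, (hP Γ ρ).1, (hQ Γ ρ).1]; rfl
        · simp only [Prog.cost]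
          have := (hP Γ ρ).2
          have := (hQ Γ ρ).2
          omega
    exact key v

@[fun_prop]
theorem PT.const (b : β) : PT fun _ : α => b := by
  obtain ⟨P, c, hP⟩ := exists_constProg (ty β) (enc b)
  exact ⟨.const _, fun _ => P _, fun _ => c, .const c, fun x Γ ρ => hP _ _⟩

@[fun_prop]
theorem PT.id : PT fun x : α => x :=
  ⟨.size, fun _ => .var .zero, fun _ => 1, .const 1, fun _ _ _ => ⟨rfl, le_rfl⟩⟩

-- The programs in `PT` exist for every trailing context, which replaces a weakening operation: the
-- second program runs in the context that still holds the original input.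
@[fun_prop]
theorem PT.comp {g : β → γ} {f : α → β} (hg : PT g) (hf : PT f) : PT fun x => g (f x) := by
  obtain ⟨sg, G, d, hd, hG⟩ := hg
  obtain ⟨sf, F, c, hc, hF⟩ := hf
  refine ⟨sg.comp sf, fun Γ => .letIn (F Γ) (G _), fun x => 1 + c x + d (f x),
    ((PolyBd.const 1).add hc).add (hd.comp sf), fun x Γ ρ => ?_⟩
  simp only [Prog.val, Prog.cost, (hF x Γ ρ).1]
  refine ⟨(hG _ _ _).1, ?_⟩
  exact Nat.add_le_add (Nat.add_le_add_left (hF x Γ ρ).2 _) (hG _ _ _).2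

@[fun_prop]
theorem PT.prodMk {f : α → β} {g : α → γ} (hf : PT f) (hg : PT g) : PT fun x => (f x, g x) := by
  obtain ⟨sg, G, d, hd, hG⟩ := hg
  obtain ⟨sf, F, c, hc, hF⟩ := hf
  refine ⟨(sf.add sg).add (.const 1), fun Γ => .pair (F Γ) (G Γ), fun x => 1 + c x + d x,
    ((PolyBd.const 1).add hc).add hd, fun x Γ ρ => ?_⟩
  simp only [Prog.val, Prog.cost, (hF x Γ ρ).1, (hG x Γ ρ).1]
  refine ⟨rfl, ?_⟩
  have := (hF x Γ ρ).2
  have := (hG x Γ ρ).2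
  omega

@[fun_prop]
theorem PT.fst {f : α → β × γ} (hf : PT f) : PT fun x => (f x).1 := by
  obtain ⟨sf, F, c, hc, hF⟩ := hf
  refine ⟨sf.mono fun x => ?_, fun Γ => .fst (F Γ), fun x => 1 + c x,
    (PolyBd.const 1).add hc, fun x Γ ρ => ?_⟩
  · change sz (f x).1 ≤ sz (f x).1 + sz (f x).2 + 1
    omega
  · simp only [Prog.val, Prog.cost, (hF x Γ ρ).1]
    exact ⟨rfl, Nat.add_le_add_left (hF x Γ ρ).2 _⟩

@[fun_prop]
theorem PT.snd {f : α → β × γ} (hf : PT f) : PT fun x => (f x).2 := by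
  obtain ⟨sf, F, c, hc, hF⟩ := hf
  refine ⟨sf.mono fun x => ?_, fun Γ => .snd (F Γ), fun x => 1 + c x,
    (PolyBd.const 1).add hc, fun x Γ ρ => ?_⟩
  · change sz (f x).2 ≤ sz (f x).1 + sz (f x).2 + 1
    omega
  · simp only [Prog.val, Prog.cost, (hF x Γ ρ).1]
    exact ⟨rfl, Nat.add_le_add_left (hF x Γ ρ).2 _⟩

theorem size_mul_le (m n : ℕ) : Nat.size (m * n) ≤ Nat.size m + Nat.size n := by
  rcases Nat.eq_zero_or_pos m with rfl | hm
  · simp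
  rw [Nat.size_le, pow_add]
  exact Nat.mul_lt_mul'' (Nat.lt_size_self m) (Nat.lt_size_self n)

theorem size_add_le (m n : ℕ) : Nat.size (m + n) ≤ Nat.size m + Nat.size n + 1 := by
  rw [Nat.size_le, pow_succ, pow_add]
  have h1 := Nat.lt_size_self m
  have h2 := Nat.lt_size_self n
  have h3 : 2 ^ Nat.size m ≤ 2 ^ Nat.size m * 2 ^ Nat.size n :=
    Nat.le_mul_of_pos_right _ (by positivity)
  have h4 : 2 ^ Nat.size n ≤ 2 ^ Nat.size m * 2 ^ Nat.size n :=
    Nat.le_mul_of_pos_left _ (by positivity)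
  omega

@[fun_prop]
theorem PT.add {f g : α → ℕ} (hf : PT f) (hg : PT g) : PT fun x => f x + g x := by
  obtain ⟨sg, G, d, hd, hG⟩ := hg
  obtain ⟨sf, F, c, hc, hF⟩ := hf
  refine ⟨((sf.add sg).add (.const 1)).mono fun x => size_add_le _ _,
    fun Γ => .plus (F Γ) (G Γ), fun x => 1 + c x + d x,
    ((PolyBd.const 1).add hc).add hd, fun x Γ ρ => ?_⟩
  have h1 := hF x Γ ρ
  have h2 := hG x Γ ρ
  refine ⟨?_, ?_⟩
  · simp only [Prog.val]
    exact congrArg₂ Nat.add h1.1 h2.1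
  · exact Nat.add_le_add (Nat.add_le_add_left h1.2 _) h2.2

@[fun_prop]
theorem PT.mul {f g : α → ℕ} (hf : PT f) (hg : PT g) : PT fun x => f x * g x := by
  obtain ⟨sg, G, d, hd, hG⟩ := hg
  obtain ⟨sf, F, c, hc, hF⟩ := hf
  refine ⟨(sf.add sg).mono fun x => size_mul_le _ _,
    fun Γ => .times (F Γ) (G Γ), fun x => 1 + sz (f x) + sz (g x) + c x + d x,
    ((((PolyBd.const 1).add sf).add sg).add hc).add hd, fun x Γ ρ => ?_⟩
  have h1 := hF x Γ ρ
  have h2 := hG x Γ ρ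
  refine ⟨?_, ?_⟩
  · simp only [Prog.val]
    exact congrArg₂ Nat.mul h1.1 h2.1
  · have e1 : Nat.size ((F Γ).val (enc x, ρ)) = sz (f x) := congrArg Nat.size h1.1
    have e2 : Nat.size ((G Γ).val (enc x, ρ)) = sz (g x) := congrArg Nat.size h2.1
    exact Nat.add_le_add (Nat.add_le_add (Nat.add_le_add (Nat.add_le_add_left e1.le _) e2.le) h1.2)
      h2.2

/-- if `a ≤ b` then `x` else `y` -/
def ifLe (a b : ℕ) (x y : α) : α := if a ≤ b then x else y

@[fun_prop]
theorem PT.ifLe {f g : α → ℕ} {u v : α → β} (hf : PT f) (hg : PT g) (hu : PT u) (hv : PT v) :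
    PT fun x => ifLe (f x) (g x) (u x) (v x) := by
  obtain ⟨sg, G, d, hd, hG⟩ := hg
  obtain ⟨sf, F, c, hc, hF⟩ := hf
  obtain ⟨su, U, cu, hcu, hU⟩ := hu
  obtain ⟨sv, V, cv, hcv, hV⟩ := hv
  refine ⟨(su.add sv).mono fun x => ?_,
    fun Γ => .ifLe (F Γ) (G Γ) (U Γ) (V Γ), fun x => 1 + c x + d x + (cu x + cv x),
    (((PolyBd.const 1).add hc).add hd).add (hcu.add hcv), fun x Γ ρ => ?_⟩
  · simp only [LabelCut.ifLe]
    split_ifs <;> omega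
  have h1 := hF x Γ ρ
  have h2 := hG x Γ ρ
  have h3 := hU x Γ ρ
  have h4 := hV x Γ ρ
  have e : Nat.ble ((F Γ).val (enc x, ρ)) ((G Γ).val (enc x, ρ)) = Nat.ble (f x) (g x) :=
    congrArg₂ Nat.ble h1.1 h2.1
  simp only [Prog.val, Prog.cost, e, Nat.ble_eq, LabelCut.ifLe]
  split_ifs
  · exact ⟨h3.1, Nat.add_le_add (Nat.add_le_add (Nat.add_le_add_left h1.2 _) h2.2)
      (le_add_right h3.2)⟩
  · exact ⟨h4.1, Nat.add_le_add (Nat.add_le_add (Nat.add_le_add_left h1.2 _) h2.2)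
      (le_add_left h4.2)⟩

@[fun_prop]
theorem PT.cons {f : α → β} {g : α → List β} (hf : PT f) (hg : PT g) :
    PT fun x => f x :: g x := by
  obtain ⟨sg, G, d, hd, hG⟩ := hg
  obtain ⟨sf, F, c, hc, hF⟩ := hf
  refine ⟨((sf.add (.const 1)).add sg).mono fun x => (sz_cons _ _).le,
    fun Γ => .cons (F Γ) (G Γ), fun x => 1 + c x + d x,
    ((PolyBd.const 1).add hc).add hd, fun x Γ ρ => ?_⟩
  simp only [Prog.val, Prog.cost, (hF x Γ ρ).1, (hG x Γ ρ).1]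
  refine ⟨rfl, ?_⟩
  have := (hF x Γ ρ).2
  have := (hG x Γ ρ).2
  omega

/-- `x` if the list is empty, else `y` applied to its head and tail -/
def caseL {α β : Type} (l : List α) (x : β) (y : α → List α → β) : β := List.casesOn l x y

@[fun_prop]
theorem PT.caseL {l : α → List β} {u : α → γ} {v : α → β → List β → γ} (hl : PT l) (hu : PT u)
    (hv : PT fun y : α × β × List β => v y.1 y.2.1 y.2.2) :
    PT fun x => caseL (l x) (u x) (v x) := by
  obtain ⟨sl, L, c, hc, hL⟩ := hl
  obtain ⟨su, U, cu, hcu, hU⟩ := hu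
  obtain ⟨⟨p, hp⟩, V, cv, ⟨q, hq⟩, hV⟩ := hv
  have hB : PolyBd fun x => sz x + sz (l x) + 1 := (PolyBd.size.add sl).add (.const 1)
  refine ⟨(su.add (hB.eval p)).mono fun x => ?_,
    -- In the branch the variables are head, tail, input; they are packed into the triple that `V`
    -- expects. This packing, together with the case distinction itself, accounts for the constant 7
    -- in the cost.
    fun Γ => .caseList (L Γ) (U Γ)
      (.letIn (.pair (.var (.succ (.succ .zero))) (.pair (.var .zero) (.var (.succ .zero))))
        (V _)),
    fun x => 7 + c x + (cu x + q.eval (sz x + sz (l x) + 1)),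
    ((PolyBd.const 7).add hc).add (hcu.add (hB.eval q)), fun x Γ ρ => ?_⟩
  · simp only [LabelCut.caseL]
    rcases h : l x with _ | ⟨b, t⟩
    · exact Nat.le_add_right _ _
    · refine le_trans (hp (x, b, t)) (le_add_left (eval_mono p ?_))
      simp only [sz_prod, sz_cons]
      omega
  · have hl := hL x Γ ρ
    have hu := hU x Γ ρ
    simp only [Prog.val, Prog.cost, hl.1, Var.get]
    rcases h : l x with _ | ⟨b, t⟩
    · exact ⟨hu.1, by simp only [enc, List.map_nil]; omega⟩
    · have hv := hV (x, b, t) (ty β :: .list (ty β) :: ty α :: Γ) (enc b, enc t, enc x, ρ)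
      refine ⟨hv.1, ?_⟩
      have h1 := hv.2.trans (hq _)
      have h2 : q.eval (sz (x, b, t)) ≤ q.eval (sz x + sz (b :: t) + 1) := by
        refine eval_mono q ?_
        simp only [sz_prod, sz_cons]
        omega
      have h3 := hl.2
      change 1 + _ + (1 + (1 + 1 + (1 + 1 + 1)) + _) ≤ _
      refine le_trans (Nat.add_le_add_left (Nat.add_le_add_left (h1.trans h2) _) _) ?_
      omega

/-- A polynomial number of polynomial rounds is not enough, since the state could double in each
round. Hence the hypothesis `hs`: the states after all prefixes of the list obey one polynomial
bound, which then bounds the cost of every single round. -/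
theorem PT.foldl {l : γ → List α} {i : γ → β} {b : γ → β → α → β} {h : γ → ℕ} (hl : PT l)
    (hi : PT i) (hb : PT fun y : γ × β × α => b y.1 y.2.1 y.2.2) (hh : PolyBd h)
    (hs : ∀ x l', l' <+: l x → sz (l'.foldl (b x) (i x)) ≤ h x) :
    PT fun x => (l x).foldl (b x) (i x) := by
  obtain ⟨sl, L, c, hc, hL⟩ := hl
  obtain ⟨si, U, cu, hcu, hU⟩ := hi
  obtain ⟨_, V, cv, ⟨q, hq⟩, hV⟩ := hb
  have hB : PolyBd fun x => sz x + (h x + sz (l x) + 1) + 1 :=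
    (PolyBd.size.add ((hh.add sl).add (.const 1))).add (.const 1)
  let body (Γ : List Ty) : Prog (ty α :: ty β :: ty γ :: Γ) (ty β) :=
    .letIn (.pair (.var (.succ (.succ .zero))) (.pair (.var (.succ .zero)) (.var .zero))) (V _)
  refine ⟨hh.mono fun x => hs x _ (List.prefix_refl _),
    fun Γ => .forEach (L Γ) (U Γ) (body Γ),
    fun x => 1 + c x + cu x + sz (l x) * (7 + q.eval (sz x + (h x + sz (l x) + 1) + 1)),
    (((PolyBd.const 1).add hc).add hcu).add (sl.mul ((PolyBd.const 7).add (hB.eval q))),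
    fun x Γ ρ => ?_⟩
  have hl := hL x Γ ρ
  have hu := hU x Γ ρ
  have hval : ∀ (st : β) (a : α), (body Γ).val (enc a, enc st, enc x, ρ) = enc (b x st a) :=
    fun st a =>
      (hV (x, st, a) (ty α :: ty β :: ty γ :: Γ) (enc a, enc st, enc x, ρ)).1
  have hcost : ∀ (st : β) (a : α), sz st ≤ h x → a ∈ l x →
      1 + (body Γ).cost (enc a, enc st, enc x, ρ) ≤
        7 + q.eval (sz x + (h x + sz (l x) + 1) + 1) := by
    intro st a h1 h2
    have h3 := (hV (x, st, a) (ty α :: ty β :: ty γ :: Γ) (enc a, enc st, enc x, ρ)).2.trans (hq _)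
    have h4 : q.eval (sz (x, st, a)) ≤ q.eval (sz x + (h x + sz (l x) + 1) + 1) := by
      refine eval_mono q ?_
      have := sz_mem_le h2
      simp only [sz_prod]
      omega
    change 1 + (1 + (1 + 1 + (1 + 1 + 1)) + _) ≤ _
    refine le_trans (Nat.add_le_add_left (Nat.add_le_add_left (h3.trans h4) _) _) ?_
    omega
  -- The second component of the fold in `Prog.cost` accumulates the steps. Induction from the right
  -- keeps the state of the last round in the form for which `hs` gives a bound.
  have key : ∀ l', l' <+: l x → ∃ m : ℕ,
      List.foldl (fun (st : (ty β).Val × ℕ) a => ((body Γ).val (a, st.1, enc x, ρ),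
          st.2 + 1 + (body Γ).cost (a, st.1, enc x, ρ))) (enc (i x), 0) (l'.map enc) =
        (enc (l'.foldl (b x) (i x)), m) ∧
      m ≤ l'.length * (7 + q.eval (sz x + (h x + sz (l x) + 1) + 1)) := by
    intro l'
    induction l' using List.reverseRecOn with
    | nil => exact fun _ => ⟨0, rfl, Nat.zero_le _⟩
    | append_singleton l' a ih =>
      intro hp
      have hp' : l' <+: l x := (List.prefix_append _ _).trans hp
      obtain ⟨m, e, hm⟩ := ih hp'
      refine ⟨m + 1 + (body Γ).cost (enc a, enc (l'.foldl (b x) (i x)), enc x, ρ), ?_, ?_⟩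
      · simp only [List.map_append, List.foldl_append, e, List.map_cons, List.map_nil,
          List.foldl_cons, List.foldl_nil, hval]
      · have := hcost _ a (hs x l' hp') (hp.subset (by simp))
        rw [List.length_append, List.length_singleton, add_mul, one_mul]
        omega
  have key' : ∀ l' : List α, List.foldl (fun st a => (body Γ).val (a, st, enc x, ρ)) (enc (i x))
      (l'.map enc) = enc (l'.foldl (b x) (i x)) := by
    intro l'
    induction l' using List.reverseRecOn with
    | nil => rfl
    | append_singleton l' a ih =>
      simp only [List.map_append, List.foldl_append, ih, List.map_cons, List.map_nil,
          List.foldl_cons, List.foldl_nil, hval]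
  simp only [Prog.val, Prog.cost, hl.1, hu.1]
  refine ⟨key' _, ?_⟩
  obtain ⟨m, e, hm⟩ := key (l x) (List.prefix_refl _)
  have e2 := congrArg Prod.snd e
  have h5 : (l x).length * (7 + q.eval (sz x + (h x + sz (l x) + 1) + 1)) ≤
      sz (l x) * (7 + q.eval (sz x + (h x + sz (l x) + 1) + 1)) :=
    Nat.mul_le_mul_right _ (length_le_sz _)
  refine (Nat.add_le_add_left (e2.le.trans (hm.trans h5)) _).trans ?_
  have := hl.2
  have := hu.2
  omega

end PT


/-! ## List operations in polynomial time -/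

section ListOps

variable {α β γ : Type} [Coded α] [Coded β] [Coded γ]

@[fun_prop]
theorem PT.reverse {l : α → List β} (hl : PT l) : PT fun x => (l x).reverse := by
  have h : PT fun x => (l x).foldl (fun acc a => a :: acc) [] := by
    refine PT.foldl hl (by fun_prop) (by fun_prop) hl.1 fun x l' hp => ?_
    rw [List.foldl_flip_cons_eq_append', List.append_nil]
    exact (List.reverse_perm l').map _ |>.sum_eq.le.trans (sz_sublist_le hp.sublist)
  simpa only [List.foldl_flip_cons_eq_append', List.append_nil] using h

@[fun_prop]
theorem PT.append {l l' : α → List β} (hl : PT l) (hl' : PT l') : PT fun x => l x ++ l' x := by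
  have h : PT fun x => (l x).reverse.foldl (fun acc a => a :: acc) (l' x) := by
    refine PT.foldl hl.reverse hl' (by fun_prop) (hl.reverse.1.add hl'.1) fun x m hp => ?_
    rw [List.foldl_flip_cons_eq_append', sz_append]
    refine Nat.add_le_add_right ?_ _
    exact (List.reverse_perm m).map _ |>.sum_eq.le.trans (sz_sublist_le hp.sublist)
  simpa only [List.foldl_flip_cons_eq_append', List.reverse_reverse] using h

theorem foldl_append_eq {α β : Type} (l : List α) (f : α → List β) :
    l.foldl (fun acc a => acc ++ f a) [] = l.flatMap f := by
  induction l using List.reverseRecOn with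
  | nil => rfl
  | append_singleton l a ih => simp [ih]

theorem sz_flatMap_le {α : Type} {l : List α} {f : α → List β} {B : ℕ} (h : ∀ a ∈ l, sz (f a) ≤ B) :
    sz (l.flatMap f) ≤ l.length * B := by
  induction l with
  | nil => simp [sz_nil]
  | cons a l ih =>
    rw [List.flatMap_cons, sz_append, List.length_cons, add_mul, one_mul, add_comm]
    exact Nat.add_le_add (ih fun b hb => h b (by simp [hb])) (h a (by simp))

-- With the conditionals this yields maps, filters and lookups, so that list comprehensions need no
-- size estimate of their own.
@[fun_prop]
theorem PT.flatMap {l : γ → List α} {f : γ → α → List β} (hl : PT l)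
    (hf : PT fun y : γ × α => f y.1 y.2) : PT fun x => (l x).flatMap (f x) := by
  obtain ⟨p, hp⟩ := hf.1
  have hB : PolyBd fun x => p.eval (sz x + sz (l x) + 1) :=
    ((PolyBd.size.add hl.1).add (.const 1)).eval p
  have h : PT fun x => (l x).foldl (fun acc a => acc ++ f x a) [] := by
    refine PT.foldl hl (by fun_prop) (by fun_prop) (hl.1.mul hB) fun x l' hpre => ?_
    rw [foldl_append_eq]
    refine (sz_flatMap_le (B := p.eval (sz x + sz (l x) + 1)) fun a ha => ?_).trans
      (Nat.mul_le_mul_right _ (hpre.length_le.trans (length_le_sz _)))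
    refine (hp (x, a)).trans (eval_mono p ?_)
    have := sz_mem_le (hpre.subset ha)
    rw [sz_prod]
    omega
  simpa only [foldl_append_eq] using h

@[fun_prop]
theorem PT.map {l : γ → List α} {f : γ → α → β} (hl : PT l)
    (hf : PT fun y : γ × α => f y.1 y.2) : PT fun x => (l x).map (f x) := by
  simp only [List.map_eq_flatMap]
  fun_prop

@[fun_prop]
theorem PT.length {l : α → List β} (hl : PT l) : PT fun x => (l x).length := by
  have key : ∀ l : List β, l.foldl (fun n _ => n + 1) 0 = l.length := fun l => by
    induction l using List.reverseRecOn with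
    | nil => rfl
    | append_singleton l a ih => simp [ih]
  have h : PT fun x => (l x).foldl (fun n _ => n + 1) 0 := by
    refine PT.foldl hl (by fun_prop) (by fun_prop) hl.1 fun x l' hp => ?_
    rw [key]
    exact (Nat.size_le.2 Nat.lt_two_pow_self).trans (hp.length_le.trans (length_le_sz _))
  simpa only [key] using h

@[fun_prop]
theorem PT.sum {l : α → List ℕ} (hl : PT l) : PT fun x => (l x).sum := by
  have key : ∀ l : List ℕ, l.foldl (fun n a => n + a) 0 = l.sum := fun l => by
    induction l using List.reverseRecOn with
    | nil => rfl
    | append_singleton l a ih => simp [ih]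
  have hs : ∀ l : List ℕ, sz l.sum ≤ sz l := fun l => by
    induction l with
    | nil => exact le_rfl
    | cons a l ih =>
      rw [List.sum_cons, sz_cons]
      refine (size_add_le _ _).trans ?_
      change sz a + sz l.sum + 1 ≤ _
      omega
  have h : PT fun x => (l x).foldl (fun n a => n + a) 0 := by
    refine PT.foldl hl (by fun_prop) (by fun_prop) hl.1 fun x l' hp => ?_
    rw [key]
    exact (hs _).trans (sz_sublist_le hp.sublist)
  simpa only [key] using h

-- Bit lengths are subadditive under multiplication, so even the product of all members of a list
-- has polynomial size. This is what permits the product of all denominators as a common one.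
@[fun_prop]
theorem PT.prod {l : α → List ℕ} (hl : PT l) : PT fun x => (l x).prod := by
  have key : ∀ l : List ℕ, l.foldl (fun n a => n * a) 1 = l.prod := fun l => by
    induction l using List.reverseRecOn with
    | nil => rfl
    | append_singleton l a ih => simp [ih]
  have hs : ∀ l : List ℕ, sz l.prod ≤ sz l + 1 := fun l => by
    induction l with
    | nil => exact (Nat.size_one).le
    | cons a l ih =>
      rw [List.prod_cons, sz_cons]
      refine (size_mul_le _ _).trans ?_
      change sz a + sz l.prod ≤ _
      omega
  have h : PT fun x => (l x).foldl (fun n a => n * a) 1 := by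
    refine PT.foldl hl (by fun_prop) (by fun_prop) (hl.1.add (.const 1)) fun x l' hp => ?_
    rw [key]
    exact (hs _).trans (Nat.add_le_add_right (sz_sublist_le hp.sublist) 1)
  simpa only [key] using h

/-- The positions in a list. -/
def indices (l : List α) : List ℕ := List.range l.length

-- Counting up to the length of a list is harmless, since the length is at most the size. This
-- replaces loops up to a number.
@[fun_prop]
theorem PT.indices {l : α → List β} (hl : PT l) : PT fun x => indices (l x) := by
  have key : ∀ l : List β, l.foldl (fun r _ => r ++ [r.length]) [] = LabelCut.indices l :=
    fun l => by
      unfold LabelCut.indices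
      induction l using List.reverseRecOn with
      | nil => rfl
      | append_singleton l a ih => simp [ih, List.range_succ]
  have h : PT fun x => (l x).foldl (fun r _ => r ++ [r.length]) [] := by
    refine PT.foldl hl (by fun_prop) (by fun_prop) (hl.1.mul (hl.1.add (.const 1)))
      fun x l' hp => ?_
    rw [key]
    have hlen := hp.length_le.trans (length_le_sz _)
    have := sz_list_le (l := LabelCut.indices l') (B := sz (l x)) fun i hi => by
      have : i < l'.length := by simpa [LabelCut.indices] using hi
      have h2 : Nat.size i ≤ i := Nat.size_le.2 Nat.lt_two_pow_self
      change Nat.size i ≤ _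
      omega
    refine this.trans (Nat.mul_le_mul_right _ ?_)
    simpa [LabelCut.indices] using hlen
  simpa only [key] using h

/-- if `a = b` then `x` else `y` -/
def ifEq (a b : ℕ) (x y : α) : α := ifLe a b (ifLe b a x y) y

theorem ifEq_eq {α : Type} (a b : ℕ) (x y : α) : ifEq a b x y = if a = b then x else y := by
  unfold ifEq ifLe
  split_ifs <;> first | rfl | omega

@[fun_prop]
theorem PT.ifEq {f g : α → ℕ} {u v : α → β} (hf : PT f) (hg : PT g) (hu : PT u) (hv : PT v) :
    PT fun x => ifEq (f x) (g x) (u x) (v x) := by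
  unfold LabelCut.ifEq
  fun_prop

/-- A list with one member, an element of `l` with the least key, or the empty list if `l` is
empty. -/
def best (l : List (ℕ × α)) : List (ℕ × α) :=
  l.foldl (fun st a => caseL st [a] fun h _ => ifLe h.1 a.1 st [a]) []

theorem best_spec {α : Type} (l : List (ℕ × α)) :
    (l = [] ∧ best l = []) ∨ ∃ m ∈ l, best l = [m] ∧ ∀ a ∈ l, m.1 ≤ a.1 := by
  unfold best
  induction l using List.reverseRecOn with
  | nil => exact Or.inl ⟨rfl, rfl⟩
  | append_singleton l a ih =>
    right
    rw [List.foldl_append, List.foldl_cons, List.foldl_nil]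
    rcases ih with ⟨rfl, h⟩ | ⟨m, hm, h, hmin⟩
    · exact ⟨a, by simp, by simp [caseL], by simp⟩
    · rw [h]
      simp only [caseL, ifLe]
      split_ifs with hle
      · exact ⟨m, by simp [hm], rfl, by
          simp only [List.mem_append, List.mem_singleton]
          rintro b (hb | rfl)
          exacts [hmin b hb, hle]⟩
      · exact ⟨a, by simp, rfl, by
          simp only [List.mem_append, List.mem_singleton]
          rintro b (hb | rfl)
          exacts [(le_of_not_ge hle).trans (hmin b hb), le_rfl]⟩

@[fun_prop]
theorem PT.best {l : α → List (ℕ × β)} (hl : PT l) : PT fun x => best (l x) := by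
  unfold LabelCut.best
  refine PT.foldl hl (by fun_prop) (by fun_prop) hl.1 fun x l' hp => ?_
  refine le_trans ?_ (sz_sublist_le hp.sublist)
  have := best_spec l'
  unfold LabelCut.best at this
  rcases this with ⟨rfl, h⟩ | ⟨m, hm, h, -⟩
  · exact le_rfl
  · rw [h]
    exact sz_sublist_le (List.singleton_sublist.2 hm)

end ListOps

/-! ## The algorithm on lists of numbers -/

/-- Labels of the multigraph: the `i`-th copy of a label `ℓ` is `(ℓ, i)`. -/
abbrev Lab := ℕ × ℕ

/-- Edges of the multigraph: source, target, label, and the length of the edge. -/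
abbrev MEdge := ℕ × ℕ × Lab × ℕ

/-- Pairs of a vertex and the list of the admissible labels on a walk to it. -/
abbrev Table := List (ℕ × List Lab)

/-- The values that are associated with `v`. -/
def lookup {α : Type} (v : ℕ) (T : List (ℕ × α)) : List α :=
  T.flatMap fun e => ifEq e.1 v [e.2] []

/-- One round of the Bellman-Ford algorithm. -/
def relax (verts : List ℕ) (E : List MEdge) (T : Table) : Table :=
  verts.flatMap fun v =>
    (best ((lookup v T ++ E.flatMap fun e => ifEq e.2.1 v
      ((lookup e.1 T).map fun p => ifLe 1 e.2.2.2 (e.2.2.1 :: p) p) []).map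
        fun p => (p.length, p))).map fun m => (v, m.2)

/-- The table of the shortest walks from `s`. -/
def table (verts : List ℕ) (E : List MEdge) (s : ℕ) : Table :=
  verts.foldl (fun T _ => relax verts E T) [(s, [])]

/-- The number of occurrences of `a` in `l`. -/
def hasLab (a : Lab) (l : List Lab) : ℕ :=
  (l.flatMap fun b => ifEq b.1 a.1 (ifEq b.2 a.2 [b] []) []).length

/-- The edges whose labels are not in `p`. -/
def removeLabs (R : List MEdge) (p : List Lab) : List MEdge :=
  R.flatMap fun e => ifLe 1 (hasLab e.2.2.1 p) [] [e]

/-- One round of the first stage, on the remaining edges. -/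
def stageOneStep (verts : List ℕ) (s t N g : ℕ) (R : List MEdge) : List MEdge :=
  caseL (lookup t (table verts R s)) R fun p _ =>
    ifLe (p.length * p.length * p.length * g) N (removeLabs R p) R

/-- The edges that remain after the first stage. -/
def stageOneL (verts : List ℕ) (s t N g : ℕ) (E : List MEdge) : List MEdge :=
  E.foldl (fun R _ => stageOneStep verts s t N g R) E

/-- The edges between the layers `i` and `i + 1`. -/
def layerL (T : Table) (R : List MEdge) (i : ℕ) : List MEdge :=
  R.flatMap fun e => (lookup e.1 T).flatMap fun p => (lookup e.2.1 T).flatMap fun p' =>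
    ifEq p.length i (ifEq p'.length (i + 1) [e] []) []

/-- The edges that remain after the second stage. -/
def stageTwoL (verts : List ℕ) (s t : ℕ) (R : List MEdge) : List MEdge :=
  caseL (lookup t (table verts R s)) R fun p _ =>
    caseL (best ((indices p).map fun i => ((layerL (table verts R s) R i).length,
      (layerL (table verts R s) R i).map fun e => e.2.2.1))) R fun m _ => removeLabs R m.2

/-- The labels in `A` of the edges in `E` that are not labels of edges in `R`. -/
def removedL (A : List Lab) (E R : List MEdge) : List Lab :=
  A.flatMap fun a => ifLe 1 (hasLab a (E.map fun e => e.2.2.1))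
    (ifLe 1 (hasLab a (R.map fun e => e.2.2.1)) [] [a]) []

/-- The largest member of a list, or zero. -/
def maxL (l : List ℕ) : ℕ := l.foldl (fun m a => ifLe m a a m) 0

/-- The maximum multiplicity of an edge. -/
def muL (E : List MEdge) : ℕ :=
  maxL (E.map fun e => (E.flatMap fun f => ifEq f.1 e.1 (ifEq f.2.1 e.2.1 [f] []) []).length)

/-- Both stages, for the guess `g`. -/
def twoStageL (verts : List ℕ) (s t : ℕ) (A : List Lab) (E : List MEdge) (g : ℕ) : List Lab :=
  removedL A E (stageTwoL verts s t
    (stageOneL verts s t (verts.length * verts.length * muL E) g E))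

/-- A smallest set found by the two stages for any of the guesses. -/
def bestGuessL (verts : List ℕ) (s t : ℕ) (A : List Lab) (E : List MEdge) : List (List Lab) :=
  (best ((1 :: (indices A).map fun i => i + 1).map fun g =>
    ((twoStageL verts s t A E g).length, twoStageL verts s t A E g))).map fun m => m.2

/-- The two-stage algorithm; the empty list stands for failure. -/
def multiL (verts : List ℕ) (s t : ℕ) (A : List Lab) (E : List MEdge) : List (List Lab) :=
  caseL (lookup t (table verts E s)) (bestGuessL verts s t A E) fun p _ =>
    ifEq p.length 0 [] (bestGuessL verts s t A E)

/-- The copies of a label of weight `w`, for the guesses `k` and `W`. -/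
def copiesL (idx : List ℕ) (k W w : ℕ) : List ℕ :=
  idx.flatMap fun j => ifLe (w * k) (j * W) [] [j]

/-- The edges of the multigraph. -/
def medgesL (edges : List (ℕ × ℕ × ℕ)) (lw : List (ℕ × ℕ)) (k W : ℕ) : List MEdge :=
  edges.flatMap fun e => lw.flatMap fun c => ifEq c.1 e.2.2
    (ifLe c.2 W ((copiesL (indices lw) k W c.2).map fun i => (e.1, e.2.1, (e.2.2, i), 1))
      [(e.1, e.2.1, (e.2.2, 0), 0)]) []

/-- The admissible labels of the multigraph. -/
def admL (lw : List (ℕ × ℕ)) (k W : ℕ) : List Lab :=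
  lw.flatMap fun c => ifLe c.2 W ((copiesL (indices lw) k W c.2).map fun i => (c.1, i)) []

/-- The labels (with their weights) all of whose copies lie in `A'`. -/
def convertL (lw : List (ℕ × ℕ)) (k W : ℕ) (A' : List Lab) : List (ℕ × ℕ) :=
  lw.flatMap fun c => ifLe c.2 W
    (ifLe 1 ((copiesL (indices lw) k W c.2).flatMap fun i =>
      ifLe 1 (hasLab (c.1, i) A') [] [i]).length [] [c]) []

/-- The candidates, with their weights, for the guesses `k` and `W`. -/
def guessL (verts : List ℕ) (s t : ℕ) (edges : List (ℕ × ℕ × ℕ)) (lw : List (ℕ × ℕ)) (k W : ℕ) :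
    List (ℕ × List ℕ) :=
  (multiL verts s t (admL lw k W) (medgesL edges lw k W)).map fun A' =>
    (((convertL lw k W A').map fun c => c.2).sum, (convertL lw k W A').map fun c => c.1)

/-- The algorithm for integral weights. -/
def algoL (verts : List ℕ) (s t : ℕ) (edges : List (ℕ × ℕ × ℕ)) (lw : List (ℕ × ℕ)) : List ℕ :=
  (best ((indices lw).flatMap fun k => lw.flatMap fun c =>
    guessL verts s t edges lw (k + 1) c.2)).flatMap fun m => m.2

/-- The members of a list with their positions. -/
def enumL {α : Type} (l : List α) : List (ℕ × α) :=
  l.foldl (fun acc a => acc ++ [(acc.length, a)]) []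

/-- Integral weights that are proportional to the fractions in the list. -/
def intWeights (ws : List (ℕ × ℕ)) : List (ℕ × ℕ) :=
  (indices ws).map fun l => (l, ((enumL ws).map fun c => ifEq c.1 l c.2.1 c.2.2).prod)

/-- The algorithm for weights that are given as fractions. -/
def mainL (x : List ℕ × ℕ × ℕ × List (ℕ × ℕ × ℕ) × List (ℕ × ℕ)) : List ℕ :=
  algoL x.1 x.2.1 x.2.2.1 x.2.2.2.1 (intWeights x.2.2.2.2)

/-! ### Elementary properties of the list functions. -/

theorem enumL_append {α : Type} (l : List α) (a : α) :
    enumL (l ++ [a]) = enumL l ++ [((enumL l).length, a)] := by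
  simp [enumL]

theorem length_enumL {α : Type} (l : List α) : (enumL l).length = l.length := by
  induction l using List.reverseRecOn with
  | nil => rfl
  | append_singleton l a ih => rw [enumL_append]; simp [ih]

theorem mem_enumL {α : Type} {l : List α} {c : ℕ × α} : c ∈ enumL l ↔ l[c.1]? = some c.2 := by
  obtain ⟨i, b⟩ := c
  induction l using List.reverseRecOn with
  | nil => simp [enumL]
  | append_singleton l a ih =>
    rw [enumL_append, List.mem_append, ih, List.mem_singleton, length_enumL]
    simp only [Prod.mk.injEq]
    rcases lt_trichotomy i l.length with h | rfl | h
    · rw [List.getElem?_append_left h]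
      simp [h.ne]
    · simp [eq_comm]
    · rw [List.getElem?_append_right h.le, List.getElem?_eq_none h.le, List.getElem?_eq_none
        (by simp; omega)]
      simp [h.ne']

theorem lookup_eq {α : Type} (v : ℕ) (T : List (ℕ × α)) :
    lookup v T = (T.filter fun e => e.1 = v).map fun e => e.2 := by
  unfold lookup
  induction T with
  | nil => rfl
  | cons a T ih =>
    rw [List.flatMap_cons, ih, ifEq_eq, List.filter_cons]
    by_cases h : a.1 = v <;> simp [h]

theorem mem_lookup {α : Type} {v : ℕ} {T : List (ℕ × α)} {p : α} :
    p ∈ lookup v T ↔ (v, p) ∈ T := by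
  rw [lookup_eq]
  simp

theorem hasLab_eq (a : Lab) (l : List Lab) :
    hasLab a l = (l.filter fun b => b = a).length := by
  unfold hasLab
  congr 1
  induction l with
  | nil => rfl
  | cons b l ih =>
    rw [List.flatMap_cons, ih, ifEq_eq, ifEq_eq, List.filter_cons]
    by_cases h1 : b.1 = a.1 <;> by_cases h2 : b.2 = a.2 <;> simp [h1, h2, Prod.ext_iff]

/-- Comparison of numbers is the only test on numbers in the language, so membership is tested by
comparing 1 with the number of occurrences. -/
theorem ifLe_hasLab {α : Type} (a : Lab) (l : List Lab) (x y : α) :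
    ifLe 1 (hasLab a l) x y = if a ∈ l then x else y := by
  rw [hasLab_eq, ifLe]
  congr 1
  rw [Nat.one_le_iff_ne_zero, ne_eq, List.length_eq_zero_iff, List.filter_eq_nil_iff]
  obtain ⟨i, j⟩ := a
  simp

theorem flatMap_ite_eq_filter {α : Type} (l : List α) (P : α → Prop) [DecidablePred P] :
    (l.flatMap fun a => if P a then [a] else []) = l.filter fun a => P a := by
  induction l with
  | nil => rfl
  | cons a l ih =>
    rw [List.flatMap_cons, ih, List.filter_cons]
    by_cases h : P a <;> simp [h]

theorem removeLabs_eq (R : List MEdge) (p : List Lab) :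
    removeLabs R p = R.filter fun e => e.2.2.1 ∉ p := by
  unfold removeLabs
  rw [← flatMap_ite_eq_filter]
  simp only [ifLe_hasLab, ite_not]

theorem stageOneStep_sublist (verts : List ℕ) (s t N g : ℕ) (R : List MEdge) :
    (stageOneStep verts s t N g R).Sublist R := by
  unfold stageOneStep
  rcases lookup t (table verts R s) with _ | ⟨p, _⟩
  · exact .refl _
  · simp only [caseL, ifLe]
    split_ifs
    · rw [removeLabs_eq]
      exact List.filter_sublist
    · exact .refl _

/-- Rounds only delete edges; this bounds the states of the fold in `PT.stageOneL`. -/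
theorem stageOne_foldl_sublist (verts : List ℕ) (s t N g : ℕ) (E l : List MEdge) :
    (l.foldl (fun R _ => stageOneStep verts s t N g R) E).Sublist E := by
  induction l using List.reverseRecOn with
  | nil => exact .refl _
  | append_singleton l a ih =>
    rw [List.foldl_append]
    exact (stageOneStep_sublist ..).trans ih

/-- The soundness half of a Bellman-Ford round: a new entry is an old one or extends an old one by
an edge. The optimality half is `exists_mem_relax`. -/
theorem mem_relax {verts : List ℕ} {E : List MEdge} {T : Table} {v : ℕ} {p : List Lab}
    (h : (v, p) ∈ relax verts E T) :
    v ∈ verts ∧ ((v, p) ∈ T ∨ ∃ e ∈ E, e.2.1 = v ∧ ∃ p' : List Lab, (e.1, p') ∈ T ∧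
      p = if 1 ≤ e.2.2.2 then e.2.2.1 :: p' else p') := by
  simp only [relax, List.mem_flatMap, List.mem_map] at h
  obtain ⟨v', hv', m, hm, e⟩ := h
  simp only [Prod.mk.injEq] at e
  obtain ⟨rfl, rfl⟩ := e
  refine ⟨hv', ?_⟩
  rcases best_spec ((lookup v' T ++ E.flatMap fun e => ifEq e.2.1 v'
      ((lookup e.1 T).map fun p => ifLe 1 e.2.2.2 (e.2.2.1 :: p) p) []).map
        fun p => (p.length, p)) with ⟨-, h⟩ | ⟨m', hm', h, -⟩
  · rw [h] at hm
    simp at hm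
  · rw [h, List.mem_singleton] at hm
    subst hm
    simp only [List.mem_map, List.mem_append, List.mem_flatMap, mem_lookup] at hm'
    obtain ⟨p, hp, rfl⟩ := hm'
    refine hp.imp_right ?_
    rintro ⟨e, he, hp⟩
    rw [ifEq_eq] at hp
    split_ifs at hp with h1
    · simp only [List.mem_map, mem_lookup] at hp
      obtain ⟨p', hp', rfl⟩ := hp
      exact ⟨e, he, h1, p', hp', rfl⟩
    · simp at hp

theorem length_best_le {α : Type} (l : List (ℕ × α)) : (best l).length ≤ 1 := by
  rcases best_spec l with ⟨-, h⟩ | ⟨m, -, h, -⟩ <;> simp [h]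

theorem length_relax_le (verts : List ℕ) (E : List MEdge) (T : Table) :
    (relax verts E T).length ≤ verts.length := by
  unfold relax
  rw [List.length_flatMap]
  have := List.sum_le_card_nsmul (l := List.map (fun v => ((best ((lookup v T ++
    E.flatMap fun e => ifEq e.2.1 v
      ((lookup e.1 T).map fun p => ifLe 1 e.2.2.2 (e.2.2.1 :: p) p) []).map
        fun p => (p.length, p))).map fun m => (v, m.2)).length) verts) 1 (by
    simp only [List.mem_map, List.length_map]
    rintro _ ⟨v, -, rfl⟩
    exact length_best_le _)
  simpa using this

/-! ### Running time of the list algorithm. -/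

section PT

variable {α β : Type} [Coded α] [Coded β]

@[fun_prop]
theorem PT.lookup {v : α → ℕ} {T : α → List (ℕ × β)} (hv : PT v) (hT : PT T) :
    PT fun x => lookup (v x) (T x) := by
  unfold LabelCut.lookup
  fun_prop

@[fun_prop]
theorem PT.relax {verts : α → List ℕ} {E : α → List MEdge} {T : α → Table} (hv : PT verts)
    (hE : PT E) (hT : PT T) : PT fun x => relax (verts x) (E x) (T x) := by
  unfold LabelCut.relax
  fun_prop

@[fun_prop]
theorem PT.table {verts : α → List ℕ} {E : α → List MEdge} {s : α → ℕ} (hv : PT verts)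
    (hE : PT E) (hs : PT s) : PT fun x => table (verts x) (E x) (s x) := by
  unfold LabelCut.table
  -- The bound is the number of entries times the size of one entry. A round leaves at most one
  -- entry per vertex (the summand 1 covers the initial table), and after `i` rounds an entry lists
  -- at most `i` labels, each from some edge.
  refine PT.foldl (h := fun x => (sz (verts x) + 1) *
      ((sz (s x) + sz (verts x) + sz (verts x) * (sz (E x) + 1) + 1) + 1)) hv (by fun_prop)
    (by fun_prop) ?_ fun x l hl => ?_
  · exact (hv.1.add (.const 1)).mul (((((hs.1.add hv.1).add
      (hv.1.mul (hE.1.add (.const 1)))).add (.const 1))).add (.const 1))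
  · have key : ∀ l : List ℕ,
        (l.foldl (fun T _ => LabelCut.relax (verts x) (E x) T) [(s x, [])]).length ≤
          (verts x).length + 1 ∧
        ∀ v p, (v, p) ∈ l.foldl (fun T _ => LabelCut.relax (verts x) (E x) T) [(s x, [])] →
          sz v ≤ sz (s x) + sz (verts x) ∧ p.length ≤ l.length ∧ ∀ a ∈ p, sz a ≤ sz (E x) := by
      intro l
      induction l using List.reverseRecOn with
      | nil =>
        refine ⟨by simp, fun v p h => ?_⟩
        simp only [List.foldl_nil, List.mem_singleton, Prod.mk.injEq] at h
        obtain ⟨rfl, rfl⟩ := h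
        exact ⟨Nat.le_add_right _ _, le_rfl, by simp⟩
      | append_singleton l a ih =>
        simp only [List.foldl_append, List.foldl_cons, List.foldl_nil]
        refine ⟨(length_relax_le _ _ _).trans (Nat.le_succ _), fun v p h => ?_⟩
        obtain ⟨h1, h2⟩ := mem_relax h
        have hvs := sz_mem_le h1
        refine ⟨by omega, ?_⟩
        rw [List.length_append, List.length_singleton]
        rcases h2 with h2 | ⟨e, he, -, p', hp', rfl⟩
        · have := ih.2 _ _ h2
          exact ⟨by omega, this.2.2⟩
        · have := ih.2 _ _ hp'
          split_ifs
          · refine ⟨by simpa using this.2.1, fun a ha => ?_⟩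
            rcases List.mem_cons.1 ha with rfl | ha
            · have h3 := sz_mem_le he
              have h4 : sz e = sz e.1 + (sz e.2.1 + (sz e.2.2.1 + sz e.2.2.2 + 1) + 1) + 1 := rfl
              omega
            · exact this.2.2 a ha
          · exact ⟨by omega, this.2.2⟩
    refine (sz_list_le (B := sz (s x) + sz (verts x) + sz (verts x) * (sz (E x) + 1) + 1)
      fun e he => ?_).trans (Nat.mul_le_mul_right _ ?_)
    · obtain ⟨v, p⟩ := e
      obtain ⟨h1, h2, h3⟩ := (key l).2 v p he
      rw [sz_prod]
      have h4 := (sz_list_le h3).trans (Nat.mul_le_mul_right (sz (E x) + 1)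
        (h2.trans (hl.length_le.trans (length_le_sz _))))
      omega
    · exact (key l).1.trans (Nat.add_le_add_right (length_le_sz _) _)

@[fun_prop]
theorem PT.hasLab {a : α → Lab} {l : α → List Lab} (ha : PT a) (hl : PT l) :
    PT fun x => hasLab (a x) (l x) := by
  unfold LabelCut.hasLab
  fun_prop

@[fun_prop]
theorem PT.removeLabs {R : α → List MEdge} {p : α → List Lab} (hR : PT R) (hp : PT p) :
    PT fun x => removeLabs (R x) (p x) := by
  unfold LabelCut.removeLabs
  fun_prop

variable {verts : α → List ℕ} {s t N g : α → ℕ} {E R : α → List MEdge} {A : α → List Lab}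
  {k W w : α → ℕ} {edges : α → List (ℕ × ℕ × ℕ)} {lw : α → List (ℕ × ℕ)}

@[fun_prop]
theorem PT.stageOneStep (hv : PT verts) (hs : PT s) (ht : PT t) (hN : PT N) (hg : PT g)
    (hR : PT R) : PT fun x => stageOneStep (verts x) (s x) (t x) (N x) (g x) (R x) := by
  unfold LabelCut.stageOneStep
  fun_prop

@[fun_prop]
theorem PT.stageOneL (hv : PT verts) (hs : PT s) (ht : PT t) (hN : PT N) (hg : PT g)
    (hE : PT E) : PT fun x => stageOneL (verts x) (s x) (t x) (N x) (g x) (E x) := by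
  unfold LabelCut.stageOneL
  exact PT.foldl hE hE (by fun_prop) hE.1 fun x l _ =>
    sz_sublist_le (stageOne_foldl_sublist _ _ _ _ _ _ _)

@[fun_prop]
theorem PT.layerL {T : α → Table} {i : α → ℕ} (hT : PT T) (hR : PT R) (hi : PT i) :
    PT fun x => layerL (T x) (R x) (i x) := by
  unfold LabelCut.layerL
  fun_prop

@[fun_prop]
theorem PT.stageTwoL (hv : PT verts) (hs : PT s) (ht : PT t) (hR : PT R) :
    PT fun x => stageTwoL (verts x) (s x) (t x) (R x) := by
  unfold LabelCut.stageTwoL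
  fun_prop

@[fun_prop]
theorem PT.removedL (hA : PT A) (hE : PT E) (hR : PT R) :
    PT fun x => removedL (A x) (E x) (R x) := by
  unfold LabelCut.removedL
  fun_prop

@[fun_prop]
theorem PT.maxL {l : α → List ℕ} (hl : PT l) : PT fun x => maxL (l x) := by
  unfold LabelCut.maxL
  refine PT.foldl hl (by fun_prop) (by fun_prop) hl.1 fun x l' hp => ?_
  have key : ∀ l' : List ℕ, l'.foldl (fun m a => LabelCut.ifLe m a a m) 0 = 0 ∨
      l'.foldl (fun m a => LabelCut.ifLe m a a m) 0 ∈ l' := by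
    intro l'
    induction l' using List.reverseRecOn with
    | nil => exact Or.inl rfl
    | append_singleton l a ih =>
      rw [List.foldl_append, List.foldl_cons, List.foldl_nil]
      generalize l.foldl (fun m a => LabelCut.ifLe m a a m) 0 = m at ih
      simp only [LabelCut.ifLe]
      split_ifs
      · simp
      · exact ih.imp_right fun h => by simp [h]
  rcases key l' with h | h
  · rw [h]
    exact Nat.zero_le _
  · have := sz_mem_le (hp.subset h)
    omega

@[fun_prop]
theorem PT.muL (hE : PT E) : PT fun x => muL (E x) := by
  unfold LabelCut.muL
  fun_prop

@[fun_prop]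
theorem PT.twoStageL (hv : PT verts) (hs : PT s) (ht : PT t) (hA : PT A) (hE : PT E)
    (hg : PT g) : PT fun x => twoStageL (verts x) (s x) (t x) (A x) (E x) (g x) := by
  unfold LabelCut.twoStageL
  fun_prop

@[fun_prop]
theorem PT.bestGuessL (hv : PT verts) (hs : PT s) (ht : PT t) (hA : PT A) (hE : PT E) :
    PT fun x => bestGuessL (verts x) (s x) (t x) (A x) (E x) := by
  unfold LabelCut.bestGuessL
  fun_prop

@[fun_prop]
theorem PT.multiL (hv : PT verts) (hs : PT s) (ht : PT t) (hA : PT A) (hE : PT E) :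
    PT fun x => multiL (verts x) (s x) (t x) (A x) (E x) := by
  unfold LabelCut.multiL
  fun_prop

@[fun_prop]
theorem PT.copiesL {idx : α → List ℕ} (hi : PT idx) (hk : PT k) (hW : PT W) (hw : PT w) :
    PT fun x => copiesL (idx x) (k x) (W x) (w x) := by
  unfold LabelCut.copiesL
  fun_prop

@[fun_prop]
theorem PT.medgesL (he : PT edges) (hl : PT lw) (hk : PT k) (hW : PT W) :
    PT fun x => medgesL (edges x) (lw x) (k x) (W x) := by
  unfold LabelCut.medgesL
  fun_prop

@[fun_prop]
theorem PT.admL (hl : PT lw) (hk : PT k) (hW : PT W) :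
    PT fun x => admL (lw x) (k x) (W x) := by
  unfold LabelCut.admL
  fun_prop

@[fun_prop]
theorem PT.convertL (hl : PT lw) (hk : PT k) (hW : PT W) (hA : PT A) :
    PT fun x => convertL (lw x) (k x) (W x) (A x) := by
  unfold LabelCut.convertL
  fun_prop

@[fun_prop]
theorem PT.guessL (hv : PT verts) (hs : PT s) (ht : PT t) (he : PT edges) (hl : PT lw) (hk : PT k)
    (hW : PT W) : PT fun x => guessL (verts x) (s x) (t x) (edges x) (lw x) (k x) (W x) := by
  unfold LabelCut.guessL
  fun_prop

@[fun_prop]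
theorem PT.algoL (hv : PT verts) (hs : PT s) (ht : PT t) (he : PT edges) (hl : PT lw) :
    PT fun x => algoL (verts x) (s x) (t x) (edges x) (lw x) := by
  unfold LabelCut.algoL
  fun_prop

@[fun_prop]
theorem PT.enumL {l : α → List β} (hl : PT l) : PT fun x => enumL (l x) := by
  unfold LabelCut.enumL
  refine PT.foldl (h := fun x => sz (l x) * (sz (l x) + sz (l x) + 1 + 1)) hl (by fun_prop)
    (by fun_prop) (hl.1.mul (((hl.1.add hl.1).add (.const 1)).add (.const 1))) fun x l' hp => ?_
  change sz (LabelCut.enumL l') ≤ _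
  refine (sz_list_le (B := sz (l x) + sz (l x) + 1) fun c hc => ?_).trans
    (Nat.mul_le_mul_right _ ?_)
  · rw [mem_enumL] at hc
    have h1 := sz_mem_le (hp.subset (List.mem_of_getElem? hc))
    have h2 := (List.getElem?_eq_some_iff.1 hc).1
    have h3 : sz c.1 ≤ c.1 := Nat.size_le.2 Nat.lt_two_pow_self
    have h4 := hp.length_le.trans (length_le_sz _)
    change sz c.1 + sz c.2 + 1 ≤ _
    omega
  · rw [length_enumL]
    exact hp.length_le.trans (length_le_sz _)

@[fun_prop]
theorem PT.intWeights {ws : α → List (ℕ × ℕ)} (hw : PT ws) : PT fun x => intWeights (ws x) := by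
  unfold LabelCut.intWeights
  fun_prop

theorem PT.mainL : PT mainL := by
  unfold LabelCut.mainL
  fun_prop

end PT

/-! ## Walks and distances in multigraphs -/

namespace MultiInstance

section Walks

variable {V E Λ : Type} {M : MultiInstance V E Λ} {R R' : Finset E} {u v x : V} {p p' : List E}
  {e : E}

theorem isWalk_append :
    M.IsWalk R u (p ++ p') v ↔ ∃ x, M.IsWalk R u p x ∧ M.IsWalk R x p' v := by
  induction p generalizing u with
  | nil => simp [IsWalk]
  | cons e p ih =>
    simp only [List.cons_append, IsWalk, ih]
    constructor
    · rintro ⟨h1, h2, x, h3, h4⟩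
      exact ⟨x, ⟨h1, h2, h3⟩, h4⟩
    · rintro ⟨x, ⟨h1, h2, h3⟩, h4⟩
      exact ⟨h1, h2, x, h3, h4⟩

theorem IsWalk.concat (h : M.IsWalk R u p (M.src e)) (he : e ∈ R) :
    M.IsWalk R u (p ++ [e]) (M.tgt e) :=
  isWalk_append.2 ⟨_, h, he, rfl, rfl⟩

theorem isWalk_filter {P : E → Prop} [DecidablePred P] :
    M.IsWalk (R.filter P) u p v ↔ M.IsWalk R u p v ∧ ∀ e ∈ p, P e := by
  induction p generalizing u with
  | nil => simp [IsWalk]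
  | cons e p ih =>
    simp only [IsWalk, ih, Finset.mem_filter, List.forall_mem_cons]
    tauto

theorem IsWalk.mem (h : M.IsWalk R u p v) : ∀ e ∈ p, e ∈ R := by
  induction p generalizing u with
  | nil => simp
  | cons e p ih => simpa [h.1] using ih h.2.2

theorem IsWalk.mono (h : M.IsWalk R u p v) (hR : R ⊆ R') : M.IsWalk R' u p v := by
  induction p generalizing u with
  | nil => exact h
  | cons e p ih => exact ⟨hR h.1, h.2.1, ih h.2.2⟩

/-- Walks can be shortened so that no vertex is left twice. -/
theorem IsWalk.exists_nodup (h : M.IsWalk R u p v) :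
    ∃ p' : List E, p'.Sublist p ∧ M.IsWalk R u p' v ∧ (p'.map M.src).Nodup := by
  induction p generalizing u with
  | nil => exact ⟨[], .slnil, h, .nil⟩
  | cons e p ih =>
    obtain ⟨p', hs, hw, hn⟩ := ih h.2.2
    by_cases hu : u ∈ p'.map M.src
    · obtain ⟨f, hf, rfl⟩ := List.mem_map.1 hu
      obtain ⟨a, b, rfl⟩ := List.append_of_mem hf
      obtain ⟨x, -, hx⟩ := isWalk_append.1 hw
      refine ⟨f :: b, ((List.sublist_append_right _ _).trans hs).cons _, ?_, ?_⟩
      · exact ⟨hx.1, rfl, hx.2.2⟩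
      · rw [List.map_append] at hn
        exact hn.of_append_right
    · refine ⟨e :: p', hs.cons_cons _, ⟨h.1, h.2.1, hw⟩, ?_⟩
      rw [List.map_cons, List.nodup_cons, h.2.1]
      exact ⟨hu, hn⟩

end Walks

/-! ### Lengths and distances. -/

variable {V E Λ : Type} [DecidableEq Λ] {M : MultiInstance V E Λ} {R R' : Finset E} {u v x : V}
  {p p' : List E} {e : E}

theorem len_cons : M.len (e :: p) = (if M.lab e ∈ M.A then 1 else 0) + M.len p := by
  simp [len]

theorem len_append : M.len (p ++ p') = M.len p + M.len p' := by
  simp [len]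

theorem len_le_of_sublist (h : p.Sublist p') : M.len p ≤ M.len p' :=
  (h.map _).sum_le_sum (by simp)

theorem card_admLabels_le (p : List E) : (M.admLabels p).card ≤ M.len p := by
  induction p with
  | nil => simp [admLabels]
  | cons e p ih =>
    rw [len_cons]
    unfold admLabels at ih ⊢
    rw [List.map_cons, List.toFinset_cons]
    split_ifs with h
    · rw [Finset.insert_inter_of_mem h, add_comm]
      exact (Finset.card_insert_le _ _).trans (Nat.add_le_add_right ih 1)
    · rw [Finset.insert_inter_of_notMem h, zero_add]
      exact ih

theorem mem_admLabels {l : Λ} : l ∈ M.admLabels p ↔ (∃ e ∈ p, M.lab e = l) ∧ l ∈ M.A := by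
  simp [admLabels]

theorem dist_le (h : M.IsWalk R u p v) : M.dist R u v ≤ M.len p :=
  iInf₂_le p h

theorem le_dist_iff {d : ℕ∞} : d ≤ M.dist R u v ↔ ∀ p, M.IsWalk R u p v → d ≤ M.len p := by
  simp [dist]

theorem dist_eq_top_iff : M.dist R u v = ⊤ ↔ ∀ p, ¬ M.IsWalk R u p v := by
  rw [← top_le_iff, le_dist_iff]
  simp

theorem exists_walk (h : M.dist R u v ≠ ⊤) :
    ∃ p, M.IsWalk R u p v ∧ (M.len p : ℕ∞) = M.dist R u v := by
  classical
  have h1 : ∃ n p, M.IsWalk R u p v ∧ M.len p = n := by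
    rw [ne_eq, dist_eq_top_iff] at h
    push Not at h
    obtain ⟨p, hp⟩ := h
    exact ⟨_, p, hp, rfl⟩
  obtain ⟨p, hp, hn⟩ := Nat.find_spec h1
  refine ⟨p, hp, le_antisymm (le_dist_iff.2 fun p' hp' => ?_) (dist_le hp)⟩
  rw [hn]
  exact_mod_cast Nat.find_min' h1 ⟨p', hp', rfl⟩

theorem dist_self : M.dist R u u = 0 :=
  le_antisymm (dist_le (p := []) rfl) (zero_le)

theorem dist_anti (h : R ⊆ R') : M.dist R' u v ≤ M.dist R u v :=
  le_dist_iff.2 fun _ hp => dist_le (hp.mono h)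

theorem dist_tgt_le (he : e ∈ R) :
    M.dist R u (M.tgt e) ≤ M.dist R u (M.src e) + if M.lab e ∈ M.A then 1 else 0 := by
  by_cases h : M.dist R u (M.src e) = ⊤
  · simp [h]
  · obtain ⟨p, hp, hl⟩ := exists_walk h
    refine (dist_le (hp.concat he)).trans ?_
    rw [len_append, Nat.cast_add, hl, len_cons]
    simp [len]

/-- A walk that leaves the ball of radius `i` uses an edge between the layers `i` and `i + 1`. -/
theorem exists_mem_layerCut {s : V} {i : ℕ} (hM : M.s = s) (hp : M.IsWalk R u p v)
    (hu : M.dist R s u ≤ i) (hv : ((i + 1 : ℕ) : ℕ∞) ≤ M.dist R s v) :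
    ∃ e ∈ p, e ∈ M.layerCut R i := by
  subst hM
  induction p generalizing u with
  | nil =>
    obtain rfl : u = v := hp
    have := hv.trans hu
    norm_cast at this
    omega
  | cons e p ih =>
    obtain ⟨he, rfl, hp⟩ := hp
    by_cases h : M.dist R M.s (M.tgt e) ≤ i
    · obtain ⟨f, hf, hf'⟩ := ih hp h
      exact ⟨f, by simp [hf], hf'⟩
    -- Here `e` leaves the ball: its source is at distance at most `i`, its target at distance at
    -- least `i + 1`. An edge raises the distance by at most one, so both bounds are equalities.
    · refine ⟨e, by simp, ?_⟩
      have h1 : ((i + 1 : ℕ) : ℕ∞) ≤ M.dist R M.s (M.tgt e) := by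
        push_cast
        exact Order.add_one_le_of_lt (not_le.1 h)
      have h2 := dist_tgt_le (M := M) (u := M.s) he
      have h3 : M.dist R M.s (M.tgt e) ≤ M.dist R M.s (M.src e) + 1 :=
        h2.trans (add_le_add le_rfl (by split_ifs <;> simp))
      obtain ⟨a, ha⟩ := ENat.ne_top_iff_exists.1 (ne_top_of_le_ne_top (ENat.natCast_ne_top i) hu)
      rw [← ha] at h3 hu
      obtain ⟨b, hb⟩ := ENat.ne_top_iff_exists.1
        (ne_top_of_le_ne_top (b := ((a + 1 : ℕ) : ℕ∞)) (ENat.natCast_ne_top _) (by exact_mod_cast h3))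
      rw [← hb] at h1 h3
      norm_cast at h1 h3 hu
      simp only [layerCut, Finset.mem_filter]
      refine ⟨he, ?_, ?_⟩
      · rw [← ha]
        norm_cast
        omega
      · rw [← hb]
        norm_cast
        omega

/-- A forbidden edge has length zero, so it cannot lead to a farther layer. This is the purpose of
the zero lengths: stage two never needs a forbidden label. -/
theorem lab_mem_of_mem_layerCut {i : ℕ} (h : e ∈ M.layerCut R i) : M.lab e ∈ M.A := by
  simp only [layerCut, Finset.mem_filter] at h
  by_contra hA
  have := dist_tgt_le (M := M) (u := M.s) h.1
  rw [if_neg hA, h.2.1, h.2.2, add_zero] at this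
  norm_cast at this
  omega

/-! ## The sets found by the two stages -/

/-- The set `S` of labels meets every `s`-`t` walk. -/
def Cuts (M : MultiInstance V E Λ) (S : Finset Λ) : Prop :=
  ∀ p, M.IsWalk M.edges M.s p M.t → ∃ e ∈ p, M.lab e ∈ S

/-- Loop invariant: the remaining edges are exactly those whose labels have not been chosen, and
only admissible labels are chosen. On exit the loop condition fails. -/
theorem StageOne.spec {θ : ℝ} {A₁ A₁' : Finset Λ} (h : M.StageOne θ R A₁ R' A₁')
    (hR : R = M.edges.filter fun e => M.lab e ∉ A₁) (hA : A₁ ⊆ M.A) :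
    (R' = M.edges.filter fun e => M.lab e ∉ A₁') ∧ A₁' ⊆ M.A ∧
      ¬ ∃ d : ℕ, M.dist R' M.s M.t = (d : ℕ∞) ∧ (d : ℝ) ≤ θ := by
  induction h with
  | done R A₁ h => exact ⟨hR, hA, h⟩
  | step R A₁ p R' A₁' h hp _ ih =>
    refine ih ?_ (Finset.union_subset hA Finset.inter_subset_right)
    rw [hR, Finset.filter_filter]
    simp only [Finset.mem_union, not_or]

/-- The number of members of `S` not yet chosen serves as a potential: a round adds at most `θ`
labels and lowers the potential by at least one. -/
theorem StageOne.card_le {θ : ℝ} {A₁ A₁' S : Finset Λ} (h : M.StageOne θ R A₁ R' A₁')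
    (hR : R = M.edges.filter fun e => M.lab e ∉ A₁) (hS : M.Cuts S) (hSA : S ⊆ M.A)
    (hθ : 0 ≤ θ) : (A₁'.card : ℝ) ≤ A₁.card + (S \ A₁).card * θ := by
  induction h with
  | done R A₁ h =>
    have : (0 : ℝ) ≤ (S \ A₁).card * θ := by positivity
    linarith
  | step R A₁ p R' A₁' h hp _ ih =>
    have h1 := ih (by
      rw [hR, Finset.filter_filter]
      simp only [Finset.mem_union, not_or])
    obtain ⟨d, hd, hdθ⟩ := h
    have h2 : ((A₁ ∪ M.admLabels p).card : ℝ) ≤ A₁.card + d := by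
      have h3 := (Finset.card_union_le A₁ (M.admLabels p)).trans
        (Nat.add_le_add_left (card_admLabels_le p) _)
      have h4 := hp.2
      rw [hd] at h4
      norm_cast at h4
      rw [h4] at h3
      exact_mod_cast h3
    -- The path taken meets `S`, in a label outside `A₁` because the path consists of remaining
    -- edges; being admissible, this label is now chosen.
    have h5 : (S \ (A₁ ∪ M.admLabels p)).card + 1 ≤ (S \ A₁).card := by
      have hw := hp.1
      rw [hR, isWalk_filter] at hw
      obtain ⟨e, he, heS⟩ := hS p hw.1
      refine Finset.card_lt_card ⟨Finset.sdiff_subset_sdiff le_rfl Finset.subset_union_left, ?_⟩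
      intro hsub
      have := hsub (Finset.mem_sdiff.2 ⟨heS, hw.2 e he⟩)
      rw [Finset.mem_sdiff, Finset.mem_union] at this
      exact this.2 (Or.inr (mem_admLabels.2 ⟨⟨e, he, rfl⟩, hSA heS⟩))
    have h6 : ((S \ (A₁ ∪ M.admLabels p)).card : ℝ) + 1 ≤ (S \ A₁).card := by exact_mod_cast h5
    nlinarith

/-- A walk of length zero carries no admissible label, so it would avoid `S`. Thus the two-stage
algorithm does not fail when an admissible cut exists. -/
theorem Cuts.dist_ne_zero {S : Finset Λ} (hS : M.Cuts S) (hSA : S ⊆ M.A) :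
    M.dist M.edges M.s M.t ≠ 0 := by
  intro h0
  obtain ⟨p, hp, hl⟩ := exists_walk (h0 ▸ ENat.zero_ne_top)
  rw [h0] at hl
  norm_cast at hl
  obtain ⟨e, he, heS⟩ := hS p hp
  have h1 : M.len [e] ≤ M.len p := len_le_of_sublist (List.singleton_sublist.2 he)
  rw [len_cons, if_pos (hSA heS)] at h1
  omega

/-- A path of positive length has an edge with an admissible label, and this edge is deleted. Hence
the loop of stage one terminates, after at most as many rounds as there are edges. -/
theorem IsShortest.card_filter_lt {p : List E} (hp : M.IsShortest R p)
    (h0 : M.dist R M.s M.t ≠ 0) :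
    (R.filter fun e => M.lab e ∉ M.admLabels p).card < R.card := by
  have he : ∃ e ∈ p, M.lab e ∈ M.A := by
    by_contra! hc
    have : M.len p = 0 := by
      simp only [len, List.sum_eq_zero_iff, List.mem_map]
      rintro _ ⟨e, he, rfl⟩
      simp [hc e he]
    exact h0 (by rw [← hp.2, this]; rfl)
  obtain ⟨e, he, heA⟩ := he
  refine Finset.card_lt_card (Finset.filter_ssubset.2 ⟨e, hp.1.mem e he, ?_⟩)
  rw [not_not]
  exact mem_admLabels.2 ⟨⟨e, he, rfl⟩, heA⟩

/-- Needed because the list algorithm recovers the chosen labels from the edges that have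
disappeared, which only sees labels that occur on edges. -/
theorem StageOne.subset_image {θ : ℝ} {R' : Finset E} {A₁ A₁' : Finset Λ}
    (h : M.StageOne θ R A₁ R' A₁') (hR : R ⊆ M.edges) (hA : A₁ ⊆ M.edges.image M.lab) :
    R' ⊆ M.edges ∧ A₁' ⊆ M.edges.image M.lab := by
  induction h with
  | done R A₁ h => exact ⟨hR, hA⟩
  | step R A₁ p R' A₁' h hp _ ih =>
    refine ih ((Finset.filter_subset _ _).trans hR) (Finset.union_subset hA fun l hl => ?_)
    obtain ⟨⟨e, he, rfl⟩, -⟩ := mem_admLabels.1 hl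
    exact Finset.mem_image_of_mem _ (hR (hp.1.mem e he))

theorem exists_stageOne (θ : ℝ) (R : Finset E) (A₁ : Finset Λ) (h0 : M.dist R M.s M.t ≠ 0) :
    ∃ R' A₁', M.StageOne θ R A₁ R' A₁' := by
  induction hn : R.card using Nat.strong_induction_on generalizing R A₁ with
  | _ n ih =>
    by_cases h : ∃ d : ℕ, M.dist R M.s M.t = (d : ℕ∞) ∧ (d : ℝ) ≤ θ
    · obtain ⟨d, hd, -⟩ := id h
      obtain ⟨p, hp, hl⟩ := exists_walk (hd ▸ ENat.natCast_ne_top d)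
      have hps : M.IsShortest R p := ⟨hp, hl⟩
      obtain ⟨R', A₁', hR⟩ := ih (R.filter fun e => M.lab e ∉ M.admLabels p).card (by
          rw [← hn]
          exact hps.card_filter_lt h0)
        (R.filter fun e => M.lab e ∉ M.admLabels p) (A₁ ∪ M.admLabels p)
        (fun h1 => h0 (le_antisymm ((dist_anti (Finset.filter_subset _ _)).trans h1.le)
          (zero_le))) rfl
      exact ⟨R', A₁', .step R A₁ p R' A₁' h hps hR⟩
    · exact ⟨R, A₁, .done R A₁ h⟩

theorem exists_stageTwo (h0 : M.dist R M.s M.t ≠ 0) : ∃ A₂, M.StageTwo R A₂ := by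
  by_cases h : M.dist R M.s M.t = ⊤
  · exact ⟨∅, Or.inl ⟨h, rfl⟩⟩
  · obtain ⟨τ, hτ⟩ := ENat.ne_top_iff_exists.1 h
    have hpos : 0 < τ := by
      rw [Nat.pos_iff_ne_zero]
      rintro rfl
      exact h0 hτ.symm
    obtain ⟨i, hi, hmin⟩ := (Finset.range τ).exists_min_image (fun j => (M.layerCut R j).card)
      ⟨0, Finset.mem_range.2 hpos⟩
    exact ⟨_, Or.inr ⟨τ, i, hτ.symm, Finset.mem_range.1 hi,
      fun j hj => hmin j (Finset.mem_range.2 hj), rfl⟩⟩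

theorem StageTwo.subset {A₂ : Finset Λ} (h : M.StageTwo R A₂) : A₂ ⊆ M.A := by
  rcases h with ⟨-, rfl⟩ | ⟨τ, i, -, -, -, rfl⟩
  · exact Finset.empty_subset _
  · intro l hl
    obtain ⟨e, he, rfl⟩ := Finset.mem_image.1 hl
    exact lab_mem_of_mem_layerCut he

/-- A walk from distance 0 to distance `τ` crosses from layer `i` to layer `i + 1` for every `i <
τ`. -/
theorem StageTwo.exists_mem {A₂ : Finset Λ} (h : M.StageTwo R A₂) (hp : M.IsWalk R M.s p M.t) :
    ∃ e ∈ p, M.lab e ∈ A₂ := by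
  rcases h with ⟨h, -⟩ | ⟨τ, i, hτ, hi, -, rfl⟩
  · exact absurd hp (dist_eq_top_iff.1 h p)
  · obtain ⟨e, he, he'⟩ := exists_mem_layerCut (i := i) rfl hp (by simp [dist_self])
      (by rw [hτ]; exact_mod_cast hi)
    exact ⟨e, he, Finset.mem_image_of_mem _ he'⟩

/-! ### Feasibility and size of the sets found by the two stages. -/

variable [Fintype V] [DecidableEq V]

theorem TwoStage.subset {g : ℕ} {A' : Finset Λ} (h : M.TwoStage g A') : A' ⊆ M.A := by
  obtain ⟨R, A₁, A₂, h1, h2, rfl⟩ := h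
  exact Finset.union_subset (h1.spec (by simp) (Finset.empty_subset _)).2.1 h2.subset

theorem TwoStage.cuts {g : ℕ} {A' : Finset Λ} (h : M.TwoStage g A') : M.Cuts A' := by
  obtain ⟨R, A₁, A₂, h1, h2, rfl⟩ := h
  intro p hp
  by_contra! hc
  simp only [Finset.mem_union, not_or] at hc
  have hR := (h1.spec (by simp) (Finset.empty_subset _)).1
  obtain ⟨e, he, he'⟩ := h2.exists_mem (p := p) (by
    rw [hR]
    exact isWalk_filter.2 ⟨hp, fun e he => (hc e he).1⟩)
  exact (hc e he).2 he'

theorem exists_twoStage (g : ℕ) (h0 : M.dist M.edges M.s M.t ≠ 0) : ∃ A', M.TwoStage g A' := by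
  obtain ⟨R, A₁, h1⟩ := exists_stageOne (M := M) (M.threshold g) M.edges ∅ h0
  have hR := (h1.spec (by simp) (Finset.empty_subset _)).1
  obtain ⟨A₂, h2⟩ := exists_stageTwo (M := M) (R := R) fun h => h0 (le_antisymm
    ((dist_anti (by rw [hR]; exact Finset.filter_subset _ _)).trans h.le) (zero_le))
  exact ⟨_, R, A₁, A₂, h1, h2, rfl⟩

theorem card_layerCut_le (hR : R ⊆ M.edges) (j : ℕ) :
    (M.layerCut R j).card ≤ M.mu * ((Finset.univ.filter fun v => M.dist R M.s v = (j : ℕ∞)).card *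
      (Finset.univ.filter fun v => M.dist R M.s v = ((j + 1 : ℕ) : ℕ∞)).card) := by
  rw [← Finset.card_product]
  refine Finset.card_le_mul_card_image_of_maps_to (f := fun e => (M.src e, M.tgt e)) ?_ _ ?_
  · intro e he
    have he' := (Finset.mem_filter.1 (Finset.mem_coe.1 he)).2
    simp [he'.1, he'.2]
  · rintro ⟨a, b⟩ -
    by_cases hne : ((M.layerCut R j).filter fun e => (M.src e, M.tgt e) = (a, b)).Nonempty
    · obtain ⟨e, he⟩ := hne
      simp only [Finset.mem_filter, Prod.mk.injEq, layerCut] at he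
      refine le_trans (Finset.card_le_card ?_) (Finset.le_sup
        (f := fun e => (M.edges.filter fun f => M.src f = M.src e ∧ M.tgt f = M.tgt e).card)
        (hR he.1.1))
      intro f hf
      simp only [Finset.mem_filter, Prod.mk.injEq, layerCut] at hf ⊢
      exact ⟨hR hf.1.1, by rw [hf.2.1, he.2.1], by rw [hf.2.2, he.2.2]⟩
    · rw [Finset.not_nonempty_iff_eq_empty.1 hne]
      simp

/-- The layers are disjoint, so the sizes of consecutive pairs add up to at most `2 n`. By
averaging, one of the `τ` pairs has at most `2 n / τ` vertices, and its product of sizes is at most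
`n² / τ²` by the inequality of the arithmetic and geometric means. The smallest cut between layers
has no more edges than the cut at this pair. -/
theorem StageTwo.card_mul_sq_le {A₂ : Finset Λ} {τ : ℕ} (h : M.StageTwo R A₂)
    (hR : R ⊆ M.edges) (hτ : M.dist R M.s M.t = τ) :
    A₂.card * τ ^ 2 ≤ M.mu * Fintype.card V ^ 2 := by
  rcases h with ⟨h, -⟩ | ⟨τ', i, hτ', hi, hmin, rfl⟩
  · rw [h] at hτ
    exact absurd hτ.symm (ENat.natCast_ne_top _)
  obtain rfl : τ = τ' := by
    rw [hτ] at hτ'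
    exact_mod_cast hτ'
  set a : ℕ → ℕ := fun j => (Finset.univ.filter fun v => M.dist R M.s v = (j : ℕ∞)).card with ha
  have hsum : ∑ j ∈ Finset.range (τ + 1), a j ≤ Fintype.card V := by
    rw [ha, ← Finset.card_biUnion]
    · exact Finset.card_le_univ _
    · intro j _ j' _ hne
      rw [Function.onFun, Finset.disjoint_left]
      intro v hv hv'
      simp only [Finset.mem_filter, Finset.mem_univ, true_and] at hv hv'
      rw [hv] at hv'
      exact hne (by exact_mod_cast hv')
  -- The averaging inequality is multiplied by `τ` to stay in the natural numbers.
  have hsum' : ∑ j ∈ Finset.range τ, τ * (a j + a (j + 1)) ≤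
      ∑ j ∈ Finset.range τ, 2 * Fintype.card V := by
    rw [Finset.sum_const, Finset.card_range, smul_eq_mul, ← Finset.mul_sum,
      Finset.sum_add_distrib]
    refine Nat.mul_le_mul_left _ ?_
    have h1 := Finset.sum_range_succ a τ
    have h2 := Finset.sum_range_succ' a τ
    omega
  obtain ⟨j, hj, hle⟩ := Finset.exists_le_of_sum_le ⟨i, Finset.mem_range.2 hi⟩ hsum'
  have h1 : ((M.layerCut R i).image M.lab).card ≤ M.mu * (a j * a (j + 1)) :=
    Finset.card_image_le.trans ((hmin j (Finset.mem_range.1 hj)).trans (card_layerCut_le hR j))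
  have h2 : 4 * (a j * a (j + 1)) ≤ (a j + a (j + 1)) ^ 2 := by
    zify
    nlinarith [sq_nonneg ((a j : ℤ) - a (j + 1))]
  have h3 := Nat.pow_le_pow_left hle 2
  have h4 : 4 * (a j * a (j + 1) * τ ^ 2) ≤ 4 * Fintype.card V ^ 2 := by
    calc 4 * (a j * a (j + 1) * τ ^ 2) = 4 * (a j * a (j + 1)) * τ ^ 2 := by ring
      _ ≤ (a j + a (j + 1)) ^ 2 * τ ^ 2 := Nat.mul_le_mul_right _ h2
      _ = (τ * (a j + a (j + 1))) ^ 2 := by ring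
      _ ≤ _ := h3
      _ = _ := by ring
  calc _ ≤ M.mu * (a j * a (j + 1)) * τ ^ 2 := Nat.mul_le_mul_right _ h1
    _ = M.mu * (a j * a (j + 1) * τ ^ 2) := by ring
    _ ≤ _ := Nat.mul_le_mul_left _ (by omega)

theorem rpow_third_pow (n : ℕ) : ((n : ℝ) ^ (1 / 3 : ℝ)) ^ 3 = n := by
  rw [← Real.rpow_natCast, ← Real.rpow_mul (Nat.cast_nonneg n)]
  norm_num

theorem rpow_two_thirds (n : ℕ) : (n : ℝ) ^ (2 / 3 : ℝ) = ((n : ℝ) ^ (1 / 3 : ℝ)) ^ 2 := by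
  rw [← Real.rpow_natCast, ← Real.rpow_mul (Nat.cast_nonneg n)]
  norm_num

/-- The number of labels chosen by the two stages, if the guess of the optimum is correct and not
less than the multiplicity of any edge. -/
theorem TwoStage.card_le {g : ℕ} {A' S : Finset Λ} (h : M.TwoStage g A') (hS : M.Cuts S)
    (hSA : S ⊆ M.A) (hg : S.card = g) (hμ : M.mu ≤ g) :
    (A'.card : ℝ) ≤ 2 * ((Fintype.card V : ℝ) ^ (2 / 3 : ℝ) * g) := by
  obtain ⟨R, A₁, A₂, h1, h2, rfl⟩ := h
  obtain ⟨hR, -, hfin⟩ := h1.spec (by simp) (Finset.empty_subset _)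
  have hc1 := h1.card_le (by simp) hS hSA (by unfold threshold; positivity)
  have hRE : R ⊆ M.edges := by rw [hR]; exact Finset.filter_subset _ _
  rw [Finset.card_empty, Nat.cast_zero, zero_add, Finset.sdiff_empty, hg] at hc1
  unfold threshold at hc1 hfin
  rw [rpow_two_thirds] at hc1 hfin ⊢
  -- In the cube roots `a`, `b`, `c` of `n`, `μ`, `g` the threshold is `a² b / c`, and all estimates
  -- become polynomial. Both stages are bounded by `a² b c²`, and `b ≤ c` turns this into `a² c³ =
  -- a² g`.
  set a : ℝ := (Fintype.card V : ℝ) ^ (1 / 3 : ℝ)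
  set b : ℝ := (M.mu : ℝ) ^ (1 / 3 : ℝ)
  set c : ℝ := (g : ℝ) ^ (1 / 3 : ℝ)
  have ha3 : a ^ 3 = Fintype.card V := rpow_third_pow _
  have hb3 : b ^ 3 = M.mu := rpow_third_pow _
  have hc3 : c ^ 3 = g := rpow_third_pow _
  have ha : 0 < a := Real.rpow_pos_of_pos (by
    have : Nonempty V := ⟨M.s⟩
    exact_mod_cast Fintype.card_pos) _
  have hb : 0 ≤ b := Real.rpow_nonneg (Nat.cast_nonneg _) _
  have hc : 0 ≤ c := Real.rpow_nonneg (Nat.cast_nonneg _) _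
  have hbc : b ≤ c := Real.rpow_le_rpow (Nat.cast_nonneg _) (by exact_mod_cast hμ) (by norm_num)
  have hmain : a ^ 2 * b * c ^ 2 ≤ a ^ 2 * g := by
    rw [← hc3, mul_assoc]
    refine mul_le_mul_of_nonneg_left ?_ (by positivity)
    nlinarith [mul_le_mul_of_nonneg_right hbc (sq_nonneg c)]
  have hA1 : (A₁.card : ℝ) ≤ a ^ 2 * b * c ^ 2 := by
    refine hc1.trans (le_of_eq ?_)
    rw [← hc3]
    -- For `c = 0` both sides vanish by the convention for division by zero.
    rcases hc.eq_or_lt with h | h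
    · simp [← h]
    · field_simp
  have hA2 : (A₂.card : ℝ) ≤ a ^ 2 * b * c ^ 2 := by
    rcases id h2 with ⟨-, rfl⟩ | ⟨τ, i, hτ, hi, -⟩
    · simp only [Finset.card_empty, Nat.cast_zero]
      positivity
    · have h3 := h2.card_mul_sq_le hRE hτ
      have h3' : (A₂.card : ℝ) * (τ : ℝ) ^ 2 ≤ b ^ 3 * (a ^ 3) ^ 2 := by
        rw [hb3, ha3]
        exact_mod_cast h3
      have h4 : a ^ 2 * b / c < τ := by
        by_contra! hle
        exact hfin ⟨τ, hτ, hle⟩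
      have hτpos : (0 : ℝ) < τ := by
        have : 0 < τ := by omega
        exact_mod_cast this
      -- For `μ = 0` the factor `(a² b)²` of the main case cannot be cancelled, but then the edge
      -- count already forces `A₂` to be empty.
      rcases hb.eq_or_lt with h | hb'
      · rw [← h] at h3'
        have : (A₂.card : ℝ) * (τ : ℝ) ^ 2 ≤ 0 := by simpa using h3'
        have h5 : (A₂.card : ℝ) ≤ 0 := by
          by_contra! h6
          have : 0 < (A₂.card : ℝ) * (τ : ℝ) ^ 2 := by positivity
          linarith
        refine h5.trans ?_
        positivity
      · have hc' : 0 < c := hb'.trans_le hbc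
        rw [div_lt_iff₀ hc'] at h4
        have h5 : (a ^ 2 * b) ^ 2 ≤ (τ * c) ^ 2 := pow_le_pow_left₀ (by positivity) h4.le 2
        have h6 : (A₂.card : ℝ) * (a ^ 2 * b) ^ 2 ≤ (a ^ 2 * b * c ^ 2) * (a ^ 2 * b) ^ 2 := by
          calc (A₂.card : ℝ) * (a ^ 2 * b) ^ 2 ≤ A₂.card * (τ * c) ^ 2 :=
                mul_le_mul_of_nonneg_left h5 (Nat.cast_nonneg _)
            _ = A₂.card * τ ^ 2 * c ^ 2 := by ring
            _ ≤ b ^ 3 * (a ^ 3) ^ 2 * c ^ 2 := mul_le_mul_of_nonneg_right h3' (by positivity)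
            _ = _ := by ring
        exact le_of_mul_le_mul_right h6 (by positivity)
  have hU : ((A₁ ∪ A₂).card : ℝ) ≤ A₁.card + A₂.card := by
    exact_mod_cast Finset.card_union_le _ _
  linarith

end MultiInstance

/-! ## The approximation guarantee -/

namespace MultiInstance

section

variable {V E Λ : Type} [DecidableEq Λ] {M : MultiInstance V E Λ} [Fintype V] [DecidableEq V]

/-- The hypothesis says that there is no walk from the source to the sink at all, so the potential
of stage one is zero and stage two is in its default case. This serves cuts of weight zero. -/
theorem TwoStage.eq_empty {g : ℕ} {A' : Finset Λ} (h : M.TwoStage g A') (h0 : M.Cuts ∅) :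
    A' = ∅ := by
  obtain ⟨R, A₁, A₂, h1, h2, rfl⟩ := h
  have hR := (h1.spec (by simp) (Finset.empty_subset _)).1
  have hc := h1.card_le (by simp) h0 (Finset.empty_subset _) (by unfold threshold; positivity)
  simp only [Finset.card_empty, Nat.cast_zero, Finset.sdiff_empty, zero_mul, add_zero] at hc
  have hA1 : A₁ = ∅ := Finset.card_eq_zero.1 (by exact_mod_cast le_antisymm hc (Nat.cast_nonneg _))
  have hd : M.dist R M.s M.t = ⊤ := dist_eq_top_iff.2 fun p hp => by
    rw [hR, isWalk_filter] at hp
    obtain ⟨e, -, he⟩ := h0 p hp.1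
    simp at he
  rcases h2 with ⟨-, rfl⟩ | ⟨τ, i, hτ, -⟩
  · rw [hA1, Finset.empty_union]
  · rw [hd] at hτ
    exact absurd hτ.symm (ENat.natCast_ne_top _)

theorem guesses_nonempty {V E Λ : Type} (M : MultiInstance V E Λ) : M.guesses.Nonempty :=
  ⟨1, by simp [guesses]⟩

theorem exists_output (M : MultiInstance V E Λ) : ∃ o, M.Output o := by
  by_cases h : M.dist M.edges M.s M.t = 0
  · exact ⟨none, .failure h⟩
  · choose sol hsol using fun g => exists_twoStage (M := M) g h
    obtain ⟨g, hg, hmin⟩ := M.guesses.exists_min_image (fun g => (sol g).card) M.guesses_nonempty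
    exact ⟨_, .success h sol (fun g _ => hsol g) g hg hmin⟩

end

end MultiInstance

namespace Instance

/-! ### Rounded weights, and the passage between an instance and its multigraph. -/

variable {I : Instance} {k : ℕ} {W : ℝ} {l : Fin I.q}

theorem mem_group {c : Fin I.q × ℕ} : c ∈ I.group k W l ↔ c.1 = l ∧ c.2 < I.wbar k W l := by
  obtain ⟨l', i⟩ := c
  simp only [group, Finset.mem_image, Finset.mem_range, Prod.mk.injEq]
  constructor
  · rintro ⟨j, hj, rfl, rfl⟩
    exact ⟨rfl, hj⟩
  · rintro ⟨rfl, h⟩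
    exact ⟨i, h, rfl, rfl⟩

theorem card_group : (I.group k W l).card = I.wbar k W l := by
  rw [group, Finset.card_image_of_injective _ fun i j h => by simpa using h, Finset.card_range]

theorem card_biUnion_group (S : Finset (Fin I.q)) :
    (S.biUnion fun l => I.group k W l).card = ∑ l ∈ S, I.wbar k W l := by
  rw [Finset.card_biUnion]
  · simp only [card_group]
  · intro l _ l' _ hne
    rw [Function.onFun, Finset.disjoint_left]
    intro c hc hc'
    exact hne ((mem_group.1 hc).1.symm.trans (mem_group.1 hc').1)

theorem mem_reduce_A {c : Fin I.q × ℕ} :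
    c ∈ (I.reduce k W).A ↔ I.w c.1 ≤ W ∧ c.2 < I.wbar k W c.1 := by
  simp only [reduce, Finset.mem_biUnion, Finset.mem_filter, Finset.mem_univ, true_and, mem_group]
  constructor
  · rintro ⟨l, h1, rfl, h2⟩
    exact ⟨h1, h2⟩
  · rintro ⟨h1, h2⟩
    exact ⟨c.1, h1, rfl, h2⟩

open Classical in
theorem mem_reduce_edges {u v : Fin I.n} {l : Fin I.q} {i : ℕ} :
    (u, v, l, i) ∈ (I.reduce k W).edges ↔
      I.adj u v = some l ∧ i < if I.w l ≤ W then I.wbar k W l else 1 := by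
  simp only [reduce, Finset.mem_biUnion, Finset.mem_univ, true_and]
  constructor
  · rintro ⟨⟨u', v'⟩, h⟩
    rcases hadj : I.adj u' v' with _ | l'
    · simp [hadj] at h
    · simp only [hadj, Option.elim, Finset.mem_image, Finset.mem_range, Prod.mk.injEq] at h
      obtain ⟨j, hj, rfl, rfl, rfl, rfl⟩ := h
      exact ⟨hadj, hj⟩
  · rintro ⟨h1, h2⟩
    refine ⟨(u, v), ?_⟩
    simp only [h1, Option.elim, Finset.mem_image, Finset.mem_range, Prod.mk.injEq]
    exact ⟨i, h2, by simp⟩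

theorem wbar_le (h : I.w l ≤ W) : I.wbar k W l ≤ k := by
  unfold wbar
  split_ifs with h0
  · exact Nat.zero_le _
  · have hw : 0 < I.w l := lt_of_le_of_ne (I.w_nonneg l) (Ne.symm h0)
    have hW : 0 < W := hw.trans_le h
    rw [Nat.ceil_le, div_le_iff₀ hW, mul_comm]
    exact mul_le_mul_of_nonneg_left h (Nat.cast_nonneg _)

theorem le_wbar_mul (h : I.w l ≤ W) : I.w l * k ≤ I.wbar k W l * W := by
  unfold wbar
  split_ifs with h0
  · simp [h0]
  · have hw : 0 < I.w l := lt_of_le_of_ne (I.w_nonneg l) (Ne.symm h0)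
    have hW : 0 < W := hw.trans_le h
    rw [← div_le_iff₀ hW]
    exact Nat.le_ceil _

theorem wbar_mul_le (hW : 0 < W) : I.wbar k W l * W ≤ I.w l * k + W := by
  unfold wbar
  split_ifs with h0
  · simp [h0, hW.le]
  · have h1 : 0 ≤ I.w l * k / W := div_nonneg (mul_nonneg (I.w_nonneg l) (Nat.cast_nonneg _)) hW.le
    have h2 := (Nat.ceil_lt_add_one h1).le
    have h3 := mul_le_mul_of_nonneg_right h2 hW.le
    rwa [add_mul, one_mul, div_mul_cancel₀ _ hW.ne'] at h3

/-- No rounding occurs for a label of the guessed maximum weight. Its `k` copies make the guess of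
the optimum at least as large as every multiplicity. -/
theorem wbar_self (hl : I.w l = W) (hW : 0 < W) : I.wbar k W l = k := by
  rw [wbar, if_neg (hl ▸ hW.ne'), hl, mul_div_assoc, mul_div_cancel₀ _ hW.ne', Nat.ceil_natCast]

/-- Without parallel edges in the instance, parallel edges of the multigraph stem from one edge and
differ in the number of the copy only. The bound `1 ≤ k` is for forbidden edges, which are kept
once. -/
theorem mu_reduce_le (hk : 1 ≤ k) : (I.reduce k W).mu ≤ k := by
  refine Finset.sup_le fun e _ => ?_
  refine (Finset.card_le_card_of_injOn (t := Finset.range k) (fun f => f.2.2.2) ?_ ?_).trans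
    (Finset.card_range k).le
  · rintro ⟨u, v, l, i⟩ hf
    have hf' := (mem_reduce_edges.1 (Finset.mem_filter.1 (Finset.mem_coe.1 hf)).1).2
    rw [Finset.coe_range, Set.mem_Iio]
    split_ifs at hf' with h
    · exact hf'.trans_le (wbar_le h)
    · exact hf'.trans_le hk
  · rintro ⟨u, v, l, i⟩ hf ⟨u', v', l', i'⟩ hf' (rfl : i = i')
    obtain ⟨h1, h2, h3⟩ := Finset.mem_filter.1 (Finset.mem_coe.1 hf)
    obtain ⟨h1', h2', h3'⟩ := Finset.mem_filter.1 (Finset.mem_coe.1 hf')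
    obtain rfl : u = u' := h2.trans h2'.symm
    obtain rfl : v = v' := h3.trans h3'.symm
    have h4 := (mem_reduce_edges.1 h1).1
    rw [(mem_reduce_edges.1 h1').1] at h4
    rw [Option.some.inj h4]

/-- An edge that survives the removal of the converted set has a copy outside `A'`: for a light
label some copy is missing from `A'`, and a forbidden label is never in `A'`. So a surviving path
lifts to a walk that avoids `A'`. -/
theorem isLabelCut_convert {A' : Finset (Fin I.q × ℕ)} (hA : A' ⊆ (I.reduce k W).A)
    (hc : (I.reduce k W).Cuts A') : I.IsLabelCut (I.convert k W A') := by
  intro h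
  have key : ∀ u, Relation.ReflTransGen
      (fun u v => ∃ l, I.adj u v = some l ∧ l ∉ I.convert k W A') u I.t →
      ∃ p, (I.reduce k W).IsWalk (I.reduce k W).edges u p I.t ∧
        ∀ e ∈ p, (I.reduce k W).lab e ∉ A' := by
    intro u hu
    induction hu using Relation.ReflTransGen.head_induction_on with
    | refl => exact ⟨[], rfl, by simp⟩
    | @head u v huv _ ih =>
      obtain ⟨l, hadj, hl⟩ := huv
      obtain ⟨p, hp, hpA⟩ := ih
      have : ∃ i, (u, v, l, i) ∈ (I.reduce k W).edges ∧ (l, i) ∉ A' := by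
        by_cases hw : I.w l ≤ W
        · simp only [convert, Finset.mem_filter, Finset.mem_univ, true_and, not_and] at hl
          obtain ⟨⟨l', i⟩, hg, hi⟩ := Finset.not_subset.1 (hl hw)
          obtain ⟨rfl, hi'⟩ := mem_group.1 hg
          exact ⟨i, mem_reduce_edges.2 ⟨hadj, by rwa [if_pos hw]⟩, hi⟩
        · exact ⟨0, mem_reduce_edges.2 ⟨hadj, by rw [if_neg hw]; exact one_pos⟩,
            fun h => hw (mem_reduce_A.1 (hA h)).1⟩
      obtain ⟨i, hi, hiA⟩ := this
      exact ⟨(u, v, l, i) :: p, ⟨hi, rfl, hp⟩, by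
        simp only [List.forall_mem_cons]
        exact ⟨hiA, hpA⟩⟩
  obtain ⟨p, hp, hpA⟩ := key I.s h
  obtain ⟨e, he, heA⟩ := hc p hp
  exact hpA e he heA

/-- A walk that avoids the copies projects to a path that avoids `S`. The bound `hW` excludes
forbidden labels in `S`, whose edges would survive. -/
theorem IsLabelCut.cuts {S : Finset (Fin I.q)} (hS : I.IsLabelCut S) (hW : ∀ l ∈ S, I.w l ≤ W) :
    (I.reduce k W).Cuts (S.biUnion fun l => I.group k W l) := by
  intro p hp
  by_contra! hc
  have key : ∀ (p : List (Fin I.n × Fin I.n × Fin I.q × ℕ)) (u : Fin I.n),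
      (I.reduce k W).IsWalk (I.reduce k W).edges u p I.t →
      (∀ e ∈ p, (I.reduce k W).lab e ∉ S.biUnion fun l => I.group k W l) →
      Relation.ReflTransGen (fun u v => ∃ l, I.adj u v = some l ∧ l ∉ S) u I.t := by
    intro p
    induction p with
    | nil =>
      rintro u hu -
      rw [show u = I.t from hu]
    | cons e p ih =>
      obtain ⟨u', v, l, i⟩ := e
      rintro u ⟨he, hsrc, hp⟩ hne
      obtain rfl : u' = u := hsrc
      rw [List.forall_mem_cons] at hne
      refine .head ?_ (ih v hp hne.2)
      obtain ⟨h1, h2⟩ := mem_reduce_edges.1 he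
      refine ⟨l, h1, fun hl => hne.1 (Finset.mem_biUnion.2 ⟨l, hl, mem_group.2 ⟨rfl, ?_⟩⟩)⟩
      rwa [if_pos (hW l hl)] at h2
  exact hS (key p I.s hp hc)

theorem biUnion_group_subset {S : Finset (Fin I.q)} (hW : ∀ l ∈ S, I.w l ≤ W) :
    (S.biUnion fun l => I.group k W l) ⊆ (I.reduce k W).A := by
  intro c hc
  obtain ⟨l, hl, hc⟩ := Finset.mem_biUnion.1 hc
  obtain ⟨rfl, h⟩ := mem_group.1 hc
  exact mem_reduce_A.2 ⟨hW _ hl, h⟩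

/-- The groups of copies of the returned labels are disjoint subsets of `A'`, and a label of weight
`w` has at least `w k / W` copies. -/
theorem weight_convert_mul_le (A' : Finset (Fin I.q × ℕ)) (hW : 0 ≤ W) :
    I.weight (I.convert k W A') * k ≤ A'.card * W := by
  have hsub : ((I.convert k W A').biUnion fun l => I.group k W l) ⊆ A' := by
    refine Finset.biUnion_subset.2 fun l hl => ?_
    simp only [convert, Finset.mem_filter] at hl
    exact hl.2.2
  have hcard := Finset.card_le_card hsub
  rw [card_biUnion_group] at hcard
  calc I.weight (I.convert k W A') * k
      = ∑ l ∈ I.convert k W A', I.w l * k := by rw [weight, Finset.sum_mul]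
    _ ≤ ∑ l ∈ I.convert k W A', I.wbar k W l * W := by
        refine Finset.sum_le_sum fun l hl => le_wbar_mul ?_
        simp only [convert, Finset.mem_filter] at hl
        exact hl.2.1
    _ = ((∑ l ∈ I.convert k W A', I.wbar k W l : ℕ) : ℝ) * W := by
        rw [← Finset.sum_mul, Nat.cast_sum]
    _ ≤ _ := mul_le_mul_of_nonneg_right (by exact_mod_cast hcard) hW

/-! ### Existence of an output. -/

theorem isLabelCut_univ (I : Instance) : I.IsLabelCut Finset.univ := by
  intro h
  rcases Relation.ReflTransGen.cases_head h with h | ⟨v, ⟨l, -, hl⟩, -⟩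
  · exact I.s_ne_t h
  · exact hl (Finset.mem_univ l)

theorem GuessOutput.exists_eq_some {L' : Option (Finset (Fin I.q))} (h : I.GuessOutput k W L')
    (h0 : (I.reduce k W).dist (I.reduce k W).edges (I.reduce k W).s (I.reduce k W).t ≠ 0) :
    ∃ sol : ℕ → Finset (Fin I.q × ℕ), ∃ g ∈ (I.reduce k W).guesses,
      (∀ g ∈ (I.reduce k W).guesses, (I.reduce k W).TwoStage g (sol g)) ∧
      (∀ g' ∈ (I.reduce k W).guesses, (sol g).card ≤ (sol g').card) ∧
      L' = some (I.convert k W (sol g)) := by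
  obtain ⟨A', hA', rfl⟩ := h
  cases hA' with
  | failure h => exact absurd h h0
  | success _ sol hsol g hg hmin => exact ⟨sol, g, hg, hsol, hmin, rfl⟩

/-- For the largest weight in the instance no label is forbidden, and all labels together form a
cut; so this guess does not fail and a candidate exists. -/
theorem exists_forall_guessOutput_isSome (I : Instance) :
    ∃ l₀, ∀ o, I.GuessOutput 1 (I.w l₀) o → o.isSome := by
  have : Nonempty (Fin I.q) := ⟨⟨0, I.q_pos⟩⟩
  obtain ⟨l₀, -, hl₀⟩ := (Finset.univ : Finset (Fin I.q)).exists_max_image I.w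
    Finset.univ_nonempty
  refine ⟨l₀, fun o ho => ?_⟩
  obtain ⟨sol, g, -, -, -, rfl⟩ := ho.exists_eq_some
    ((I.isLabelCut_univ.cuts hl₀).dist_ne_zero (biUnion_group_subset hl₀))
  rfl

theorem exists_output (I : Instance) : ∃ L', I.Output L' := by
  classical
  have hex : ∀ (k : ℕ) (W : ℝ), ∃ o, I.GuessOutput k W o := fun k W =>
    ⟨_, _, ((I.reduce k W).exists_output).choose_spec, rfl⟩
  choose out hout using hex
  obtain ⟨l₀, hl₀⟩ := I.exists_forall_guessOutput_isSome
  obtain ⟨⟨k, l⟩, hkl, hmin⟩ := ((Finset.Icc 1 I.q ×ˢ (Finset.univ : Finset (Fin I.q))).filter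
    fun c => (out c.1 (I.w c.2)).isSome).exists_min_image
    (fun c => I.weight ((out c.1 (I.w c.2)).getD ∅))
    ⟨(1, l₀), by simpa [hl₀ _ (hout 1 (I.w l₀))] using Nat.succ_le_of_lt I.q_pos⟩
  simp only [Finset.mem_filter, Finset.mem_product, Finset.mem_univ, and_true] at hkl hmin
  obtain ⟨L', hL'⟩ := Option.isSome_iff_exists.1 hkl.2
  refine ⟨L', out, fun k _ W _ => hout k W, ⟨k, hkl.1, _, ⟨l, rfl⟩, hL'⟩, ?_⟩
  rintro k' hk' _ ⟨l', rfl⟩ S hS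
  have := hmin (k', l') ⟨hk', by simp [hS]⟩
  simpa [hL', hS] using this

/-! ### Feasibility and weight of an output. -/

theorem Output.isLabelCut {L' : Finset (Fin I.q)} (h : I.Output L') : I.IsLabelCut L' := by
  obtain ⟨out, hout, ⟨k, hk, W, hW, hL'⟩, -⟩ := h
  obtain ⟨A', hA', he⟩ := hout k hk W hW
  rw [hL'] at he
  cases hA' with
  | failure h => simp at he
  | success _ sol hsol g hg hmin =>
    simp only [Option.map_some, Option.some.injEq] at he
    rw [he]
    exact isLabelCut_convert (hsol g hg).subset (hsol g hg).cuts

theorem Output.weight_le {L' S : Finset (Fin I.q)} (h : I.Output L') (hS : I.IsLabelCut S) :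
    I.weight L' ≤ 4 * (I.n : ℝ) ^ (2 / 3 : ℝ) * I.weight S := by
  obtain ⟨out, hout, -, hmin⟩ := h
  have hSpos : 0 ≤ I.weight S := Finset.sum_nonneg fun l _ => I.w_nonneg l
  -- A cut of weight zero has no copies for any `W`, so `k = 1` and the weight of an arbitrary label
  -- will do; in particular `S` may be empty.
  by_cases h0 : ∀ l ∈ S, I.w l = 0
  · have hk : 1 ∈ Finset.Icc 1 I.q := Finset.mem_Icc.2 ⟨le_rfl, I.q_pos⟩
    have hW : I.w ⟨0, I.q_pos⟩ ∈ Set.range I.w := ⟨_, rfl⟩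
    have hSW : ∀ l ∈ S, I.w l ≤ I.w ⟨0, I.q_pos⟩ := fun l hl => by
      rw [h0 l hl]
      exact I.w_nonneg _
    have hcut := hS.cuts (k := 1) hSW
    obtain ⟨sol, g, hg, hsol, -, hsome⟩ := (hout 1 hk _ hW).exists_eq_some
      (hcut.dist_ne_zero (biUnion_group_subset hSW))
    have hempty : (S.biUnion fun l => I.group 1 (I.w ⟨0, I.q_pos⟩) l) = ∅ := by
      rw [← Finset.card_eq_zero, card_biUnion_group]
      exact Finset.sum_eq_zero fun l hl => by rw [wbar, if_pos (h0 l hl)]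
    rw [hempty] at hcut
    rw [(hsol g hg).eq_empty hcut] at hsome
    have h1 := weight_convert_mul_le (I := I) (k := 1) (∅ : Finset (Fin I.q × ℕ))
      (I.w_nonneg ⟨0, I.q_pos⟩)
    simp only [Nat.cast_one, mul_one, Finset.card_empty, Nat.cast_zero, zero_mul] at h1
    refine ((hmin 1 hk _ hW _ hsome).trans h1).trans ?_
    positivity
  · push Not at h0
    obtain ⟨l₁, hl₁, hne⟩ := h0
    obtain ⟨l₀, hl₀, hSW⟩ := S.exists_max_image I.w ⟨l₁, hl₁⟩
    set W := I.w l₀ with hWdef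
    have hWpos : 0 < W :=
      (lt_of_le_of_ne (I.w_nonneg l₁) (Ne.symm hne)).trans_le (hSW l₁ hl₁)
    set k := S.card with hkdef
    have hk1 : 1 ≤ k := Finset.card_pos.2 ⟨l₁, hl₁⟩
    have hk : k ∈ Finset.Icc 1 I.q := Finset.mem_Icc.2 ⟨hk1, by
      simpa using Finset.card_le_univ S⟩
    have hW : W ∈ Set.range I.w := ⟨_, rfl⟩
    have hcut := hS.cuts (k := k) hSW
    have hsub := biUnion_group_subset (k := k) hSW
    obtain ⟨sol, g, hg, hsol, hgmin, hsome⟩ := (hout k hk _ hW).exists_eq_some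
      (hcut.dist_ne_zero hsub)
    -- The relevant guess is the size of this particular cut. It need not be the optimum of the
    -- multigraph, since `TwoStage.card_le` holds for every cut whose size is the guess.
    set g' := (S.biUnion fun l => I.group k W l).card with hg'
    have hgsum : g' = ∑ l ∈ S, I.wbar k W l := card_biUnion_group S
    have hkg : k ≤ g' := by
      rw [hgsum]
      refine le_trans (wbar_self (k := k) hWdef.symm hWpos).ge ?_
      exact Finset.single_le_sum (f := fun l => I.wbar k W l) (fun _ _ => Nat.zero_le _) hl₀
    have hgmem : g' ∈ (I.reduce k W).guesses := by
      rw [MultiInstance.guesses, Finset.mem_Icc]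
      exact ⟨hk1.trans hkg, (Finset.card_le_card hsub).trans (le_max_right _ _)⟩
    have hcard := (hsol g' hgmem).card_le hcut hsub rfl ((mu_reduce_le hk1).trans hkg)
    rw [Fintype.card_fin] at hcard
    have hcard' : ((sol g).card : ℝ) ≤ 2 * ((I.n : ℝ) ^ (2 / 3 : ℝ) * g') :=
      le_trans (by exact_mod_cast hgmin g' hgmem) hcard
    -- Rounding up costs at most `W` for each of the `k` labels, and `W` is itself one of the
    -- weights in `S`. This is the second factor 2 of the constant 4.
    have hgW : (g' : ℝ) * W ≤ 2 * (k * I.weight S) := by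
      have h1 : (g' : ℝ) * W ≤ I.weight S * k + k * W := by
        rw [hgsum, Nat.cast_sum, Finset.sum_mul, weight, Finset.sum_mul]
        refine (Finset.sum_le_sum fun l _ => wbar_mul_le hWpos).trans (le_of_eq ?_)
        rw [Finset.sum_add_distrib, Finset.sum_const, nsmul_eq_mul]
      have h2 : W ≤ I.weight S := Finset.single_le_sum (fun l _ => I.w_nonneg l) hl₀
      nlinarith [mul_le_mul_of_nonneg_left h2 (Nat.cast_nonneg k : (0 : ℝ) ≤ k)]
    have hkpos : (0 : ℝ) < k := by exact_mod_cast hk1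
    have hn : 0 ≤ (I.n : ℝ) ^ (2 / 3 : ℝ) := Real.rpow_nonneg (Nat.cast_nonneg _) _
    refine (hmin k hk W hW _ hsome).trans (le_of_mul_le_mul_right ?_ hkpos)
    calc I.weight (I.convert k W (sol g)) * k ≤ (sol g).card * W :=
          weight_convert_mul_le _ hWpos.le
      _ ≤ 2 * ((I.n : ℝ) ^ (2 / 3 : ℝ) * g') * W :=
          mul_le_mul_of_nonneg_right hcard' hWpos.le
      _ = 2 * (I.n : ℝ) ^ (2 / 3 : ℝ) * (g' * W) := by ring
      _ ≤ 2 * (I.n : ℝ) ^ (2 / 3 : ℝ) * (2 * (k * I.weight S)) :=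
          mul_le_mul_of_nonneg_left hgW (by positivity)
      _ = _ := by ring

end Instance

/-! ## Correctness of the algorithm on lists -/

/-- The list `l` enumerates the codes of the members of `s`. -/
def Represents {α β : Type} (c : α → β) (l : List β) (s : Finset α) : Prop :=
  l.Nodup ∧ ∀ b, b ∈ l ↔ ∃ a ∈ s, c a = b

namespace Represents

variable {α β : Type} {c : α → β} {l : List β} {s : Finset α}

theorem length_eq (h : Represents c l s) (hc : Function.Injective c) : l.length = s.card := by
  classical
  rw [← List.toFinset_card_of_nodup h.1, ← Finset.card_image_of_injective s hc]
  congr 1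
  ext b
  simp [h.2]

theorem filter (h : Represents c l s) {P : β → Prop} [DecidablePred P] {Q : α → Prop}
    [DecidablePred Q] (hPQ : ∀ a ∈ s, P (c a) ↔ Q a) :
    Represents c (l.filter fun b => P b) (s.filter Q) := by
  refine ⟨h.1.filter _, fun b => ?_⟩
  simp only [List.mem_filter, h.2, decide_eq_true_eq, Finset.mem_filter]
  constructor
  · rintro ⟨⟨a, ha, rfl⟩, hP⟩
    exact ⟨a, ⟨ha, (hPQ a ha).1 hP⟩, rfl⟩
  · rintro ⟨a, ⟨ha, hQ⟩, rfl⟩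
    exact ⟨⟨a, ha, rfl⟩, (hPQ a ha).2 hQ⟩

end Represents

/-! ### Maxima, keys of tables, and optimality of a Bellman-Ford round. -/

theorem maxL_spec (l : List ℕ) : (∀ a ∈ l, a ≤ maxL l) ∧ (maxL l = 0 ∨ maxL l ∈ l) := by
  induction l using List.reverseRecOn with
  | nil => simp [maxL]
  | append_singleton l a ih =>
    have e : maxL (l ++ [a]) = if maxL l ≤ a then a else maxL l := by
      rw [maxL, List.foldl_append]
      rfl
    rw [e]
    split_ifs with h
    · refine ⟨fun b hb => ?_, by simp⟩
      rcases List.mem_append.1 hb with hb | hb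
      · exact (ih.1 b hb).trans h
      · exact (List.mem_singleton.1 hb).le
    · refine ⟨fun b hb => ?_, ih.2.imp_right fun h => by simp [h]⟩
      rcases List.mem_append.1 hb with hb | hb
      · exact ih.1 b hb
      · rw [List.mem_singleton.1 hb]
        omega

theorem lookup_eq_singleton {α : Type} {T : List (ℕ × α)} (hT : (T.map fun e => e.1).Nodup)
    {v : ℕ} {p : α} (h : (v, p) ∈ T) : lookup v T = [p] := by
  rw [lookup_eq]
  induction T with
  | nil => simp at h
  | cons a T ih =>
    rw [List.map_cons, List.nodup_cons] at hT
    rcases List.mem_cons.1 h with rfl | h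
    · have : T.filter (fun e => decide (e.1 = v)) = [] := by
        rw [List.filter_eq_nil_iff]
        intro e he
        rw [decide_eq_true_eq]
        rintro rfl
        exact hT.1 (List.mem_map.2 ⟨e, he, rfl⟩)
      simp [this]
    · have hne : a.1 ≠ v := by
        rintro rfl
        exact hT.1 (List.mem_map.2 ⟨_, h, rfl⟩)
      rw [List.filter_cons, if_neg (by simpa using hne)]
      exact ih hT.2 h

/-- Distinct keys are what makes a lookup return at most one entry. -/
theorem keys_relax_sublist (verts : List ℕ) (E : List MEdge) (T : Table) :
    ((relax verts E T).map fun e => e.1).Sublist verts := by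
  have key : ∀ f : ℕ → List (ℕ × List Lab), (∀ v, (f v).length ≤ 1) →
      ((verts.flatMap fun v => (f v).map fun m => (v, m.2)).map fun e => e.1).Sublist verts := by
    intro f hf
    induction verts with
    | nil => exact .slnil
    | cons v verts ih =>
      rw [List.flatMap_cons, List.map_append]
      rcases h : f v with _ | ⟨m, _ | ⟨m', l⟩⟩
      · exact ih.cons v
      · exact ih.cons_cons v
      · have := hf v
        rw [h] at this
        simp at this
  exact key _ fun v => length_best_le _

/-- Every candidate for an entry is at least as long as the chosen one. -/
theorem exists_mem_relax {verts : List ℕ} {E : List MEdge} {T : Table} {v : ℕ} {p : List Lab}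
    (hv : v ∈ verts) (h : (v, p) ∈ T ∨ ∃ e ∈ E, e.2.1 = v ∧ ∃ p' : List Lab, (e.1, p') ∈ T ∧
      p = if 1 ≤ e.2.2.2 then e.2.2.1 :: p' else p') :
    ∃ p', (v, p') ∈ relax verts E T ∧ p'.length ≤ p.length := by
  set l := (lookup v T ++ E.flatMap fun e => ifEq e.2.1 v
    ((lookup e.1 T).map fun p => ifLe 1 e.2.2.2 (e.2.2.1 :: p) p) []).map
      fun p => (p.length, p) with hl
  have hp : (p.length, p) ∈ l := by
    rw [hl, List.mem_map]
    refine ⟨p, ?_, rfl⟩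
    rw [List.mem_append, mem_lookup]
    refine h.imp_right ?_
    rintro ⟨e, he, rfl, p', hp', rfl⟩
    rw [List.mem_flatMap]
    refine ⟨e, he, ?_⟩
    rw [ifEq_eq, if_pos rfl, List.mem_map]
    exact ⟨p', mem_lookup.2 hp', rfl⟩
  rcases best_spec l with ⟨h0, -⟩ | ⟨m, hm, hb, hmin⟩
  · rw [h0] at hp
    simp at hp
  · refine ⟨m.2, ?_, ?_⟩
    · rw [relax, List.mem_flatMap]
      refine ⟨v, hv, ?_⟩
      rw [← hl, hb]
      simp
    · have h1 := hmin _ hp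
      obtain ⟨p', -, rfl⟩ := List.mem_map.1 hm
      exact h1

/-! ### The list algorithm simulates the two-stage algorithm. -/

namespace MultiInstance

/-- Both sides are nonnegative, so they may be cubed; this makes the test of stage one a comparison
of natural numbers. -/
theorem le_threshold_iff {V E Λ : Type} [Fintype V] [DecidableEq V] {M : MultiInstance V E Λ} {d g : ℕ} (hg : 1 ≤ g) :
    (d : ℝ) ≤ M.threshold g ↔ d * d * d * g ≤ Fintype.card V * Fintype.card V * M.mu := by
  have hg' : (0 : ℝ) < (g : ℝ) ^ (1 / 3 : ℝ) :=
    Real.rpow_pos_of_pos (by exact_mod_cast hg) _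
  rw [threshold, le_div_iff₀ hg', rpow_two_thirds]
  have h0 : (0 : ℝ) ≤ ((Fintype.card V : ℝ) ^ (1 / 3 : ℝ)) ^ 2 * (M.mu : ℝ) ^ (1 / 3 : ℝ) := by
    positivity
  rw [← pow_le_pow_iff_left₀ (by positivity) h0 three_ne_zero, mul_pow, mul_pow, rpow_third_pow,
    rpow_third_pow, ← pow_mul, mul_comm 2 3, pow_mul, rpow_third_pow, ← Nat.cast_le (α := ℝ)]
  push_cast
  ring_nf

variable {V E Λ : Type} [DecidableEq Λ] [Fintype V]

/-- The numbers that represent vertices, labels and edges. -/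
structure Coding (M : MultiInstance V E Λ) (verts : List ℕ) (cv : V → ℕ) (cl : Λ → Lab)
    (ce : E → MEdge) : Prop where
  cv_inj : Function.Injective cv
  cl_inj : Function.Injective cl
  ce_inj : Function.Injective ce
  verts_repr : Represents cv verts Finset.univ
  ce_eq : ∀ e, ce e = (cv (M.src e), cv (M.tgt e), cl (M.lab e), if M.lab e ∈ M.A then 1 else 0)

variable {M : MultiInstance V E Λ} {verts : List ℕ} {cv : V → ℕ} {cl : Λ → Lab} {ce : E → MEdge}
  {R : Finset E} {Rl : List MEdge}

/-- The list `p` of codes of labels belongs to the walk `w` to the vertex with number `x`. -/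
def Witness (M : MultiInstance V E Λ) (cv : V → ℕ) (cl : Λ → Lab) (R : Finset E) (x : ℕ)
    (p : List Lab) (w : List E) : Prop :=
  ∃ v, cv v = x ∧ M.IsWalk R M.s w v ∧ p.length = M.len w ∧
    ∀ a, a ∈ p ↔ ∃ l ∈ M.admLabels w, cl l = a

/-- The Bellman-Ford invariant: every entry comes from a walk of the same length, and every walk
with at most as many edges as there were rounds is at least as long as some entry. Rounds are
matched with numbers of edges rather than with lengths, as edges may have length zero. -/
theorem Coding.relax_foldl (h : M.Coding verts cv cl ce) (hR : Represents ce Rl R)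
    (l : List ℕ) :
    ((l.foldl (fun T _ => relax verts Rl T) [(cv M.s, [])]).map fun e => e.1).Nodup ∧
    (∀ x p, (x, p) ∈ l.foldl (fun T _ => relax verts Rl T) [(cv M.s, [])] →
      ∃ w, M.Witness cv cl R x p w) ∧
    ∀ v w, M.IsWalk R M.s w v → w.length ≤ l.length →
      ∃ p, (cv v, p) ∈ l.foldl (fun T _ => relax verts Rl T) [(cv M.s, [])] ∧
        p.length ≤ M.len w := by
  induction l using List.reverseRecOn with
  | nil =>
    refine ⟨by simp, fun x p hxp => ?_, fun v w hw hlen => ?_⟩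
    · simp only [List.foldl_nil, List.mem_singleton, Prod.mk.injEq] at hxp
      obtain ⟨rfl, rfl⟩ := hxp
      exact ⟨[], M.s, rfl, rfl, rfl, by simp [admLabels]⟩
    · obtain rfl : w = [] := List.length_eq_zero_iff.1 (Nat.le_zero.1 hlen)
      obtain rfl : M.s = v := hw
      exact ⟨[], by simp, Nat.zero_le _⟩
  | append_singleton l a ih =>
    rw [List.foldl_append, List.foldl_cons, List.foldl_nil]
    obtain ⟨-, ih1, ih2⟩ := ih
    generalize l.foldl (fun T _ => relax verts Rl T) [(cv M.s, [])] = T at ih1 ih2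
    have hverts : ∀ v, cv v ∈ verts := fun v => (h.verts_repr.2 _).2 ⟨v, Finset.mem_univ v, rfl⟩
    refine ⟨(keys_relax_sublist _ _ _).nodup h.verts_repr.1, fun x p hxp => ?_,
      fun v w hw hlen => ?_⟩
    · rcases (mem_relax hxp).2 with hT | ⟨e, he, rfl, p', hp', rfl⟩
      · exact ih1 x p hT
      · obtain ⟨f, hf, rfl⟩ := (hR.2 e).1 he
        rw [h.ce_eq] at hp' ⊢
        obtain ⟨w, v, hv, hw, hlen, hlab⟩ := ih1 _ _ hp'
        obtain rfl := h.cv_inj hv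
        refine ⟨w ++ [f], M.tgt f, rfl, hw.concat hf, ?_, fun a => ?_⟩
        · rw [len_append, len_cons, ← hlen]
          by_cases hA : M.lab f ∈ M.A <;> simp [hA, len]
        · have hadm : ∀ l, l ∈ M.admLabels (w ++ [f]) ↔
              l ∈ M.admLabels w ∨ (M.lab f = l ∧ l ∈ M.A) := fun l => by
            simp only [mem_admLabels, List.mem_append, List.mem_singleton, or_and_right,
              exists_or, exists_eq_left]
          by_cases hA : M.lab f ∈ M.A
          · simp only [hA, if_true, le_refl, List.mem_cons, hlab, hadm]
            constructor
            · rintro (rfl | ⟨l, hl, rfl⟩)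
              · exact ⟨_, Or.inr ⟨rfl, hA⟩, rfl⟩
              · exact ⟨l, Or.inl hl, rfl⟩
            · rintro ⟨l, hl | ⟨rfl, -⟩, rfl⟩
              · exact Or.inr ⟨l, hl, rfl⟩
              · exact Or.inl rfl
          · simp only [hA, if_false, hadm]
            rw [if_neg (by decide), hlab]
            constructor
            · rintro ⟨l, hl, rfl⟩
              exact ⟨l, Or.inl hl, rfl⟩
            · rintro ⟨l, hl | ⟨rfl, hl⟩, rfl⟩
              · exact ⟨l, hl, rfl⟩
              · exact absurd hl hA
    -- The last edge is split off: the table before this round handles the rest, and the extension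
    -- by the edge is a candidate in this round. For the empty walk the old entry is itself a
    -- candidate.
    · rcases List.eq_nil_or_concat w with rfl | ⟨w', e, rfl⟩
      · obtain ⟨p, hp, hpl⟩ := ih2 v [] hw (Nat.zero_le _)
        obtain ⟨p', hp', hle⟩ := exists_mem_relax (E := Rl) (hverts v) (Or.inl hp)
        exact ⟨p', hp', hle.trans hpl⟩
      · rw [List.concat_eq_append] at hw hlen ⊢
        obtain ⟨x, hw', he, rfl, rfl⟩ := isWalk_append.1 hw
        obtain ⟨p, hp, hpl⟩ := ih2 _ w' hw' (by simpa using hlen)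
        obtain ⟨p', hp', hle⟩ := exists_mem_relax (E := Rl) (T := T) (hverts (M.tgt e))
          (p := if 1 ≤ (ce e).2.2.2 then (ce e).2.2.1 :: p else p)
          (Or.inr ⟨ce e, (hR.2 _).2 ⟨e, he, rfl⟩, by rw [h.ce_eq], p, by rw [h.ce_eq]; exact hp,
            rfl⟩)
        refine ⟨p', hp', hle.trans ?_⟩
        rw [len_append, len_cons, h.ce_eq]
        by_cases hA : M.lab e ∈ M.A <;> simp [hA, len] <;> exact hpl

/-- The table holds the shortest walks. -/
theorem Coding.lookup_table (h : M.Coding verts cv cl ce) (hR : Represents ce Rl R) (v : V) :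
    (lookup (cv v) (table verts Rl (cv M.s)) = [] ∧ M.dist R M.s v = ⊤) ∨
    ∃ p w, lookup (cv v) (table verts Rl (cv M.s)) = [p] ∧ M.dist R M.s v = p.length ∧
      M.IsWalk R M.s w v ∧ M.len w = p.length ∧ ∀ a, a ∈ p ↔ ∃ l ∈ M.admLabels w, cl l = a := by
  obtain ⟨h1, h2, h3⟩ := h.relax_foldl hR verts
  change (List.map _ (table verts Rl (cv M.s))).Nodup at h1
  by_cases hd : M.dist R M.s v = ⊤
  · refine Or.inl ⟨List.eq_nil_iff_forall_not_mem.2 fun p hp => ?_, hd⟩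
    obtain ⟨w, v', hv', hw, -⟩ := h2 _ _ (mem_lookup.1 hp)
    obtain rfl := h.cv_inj hv'
    exact dist_eq_top_iff.1 hd w hw
  · obtain ⟨w₀, hw₀, hl₀⟩ := exists_walk hd
    obtain ⟨w₁, hsub, hw₁, hnd⟩ := hw₀.exists_nodup
    -- A walk that leaves no vertex twice has at most `n` edges, so as many rounds as vertices
    -- suffice.
    have hlen : w₁.length ≤ verts.length := by
      rw [h.verts_repr.length_eq h.cv_inj]
      simpa using hnd.length_le_card
    obtain ⟨p, hp, hpl⟩ := h3 v w₁ hw₁ hlen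
    obtain ⟨w, v', hv', hw, hwl, hlab⟩ := h2 _ _ hp
    obtain rfl := h.cv_inj hv'
    refine Or.inr ⟨p, w, lookup_eq_singleton h1 hp, ?_, hw, hwl.symm, hlab⟩
    refine le_antisymm ((dist_le hw).trans (by rw [hwl])) ?_
    rw [← hl₀]
    exact_mod_cast hpl.trans (len_le_of_sublist hsub)

theorem Coding.repr_removeLabs (h : M.Coding verts cv cl ce) (hR : Represents ce Rl R)
    {p : List Lab} {B : Finset Λ} (hp : ∀ a, a ∈ p ↔ ∃ l ∈ B, cl l = a) :
    Represents ce (removeLabs Rl p) (R.filter fun e => M.lab e ∉ B) := by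
  rw [removeLabs_eq]
  refine hR.filter (P := fun e => e.2.2.1 ∉ p) fun e _ => ?_
  rw [h.ce_eq, hp, not_iff_not]
  exact ⟨fun ⟨l, hl, he⟩ => h.cl_inj he ▸ hl, fun hl => ⟨_, hl, rfl⟩⟩

theorem Coding.repr_layerL (h : M.Coding verts cv cl ce) (hR : Represents ce Rl R) (i : ℕ) :
    Represents ce (layerL (table verts Rl (cv M.s)) Rl i) (M.layerCut R i) := by
  classical
  have e : layerL (table verts Rl (cv M.s)) Rl i =
      Rl.filter fun x => ∃ f ∈ M.layerCut R i, ce f = x := by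
    rw [← flatMap_ite_eq_filter]
    refine List.flatMap_congr fun x hx => ?_
    obtain ⟨f, hf, rfl⟩ := (hR.2 x).1 hx
    have e1 : (∃ f' ∈ M.layerCut R i, ce f' = ce f) ↔ M.dist R M.s (M.src f) = (i : ℕ∞) ∧
        M.dist R M.s (M.tgt f) = ((i + 1 : ℕ) : ℕ∞) := by
      simp only [layerCut, Finset.mem_filter]
      exact ⟨fun ⟨f', hf', he⟩ => h.ce_inj he ▸ hf'.2, fun hf' => ⟨f, ⟨hf, hf'⟩, rfl⟩⟩
    simp only [e1]
    have e2 : (ce f).1 = cv (M.src f) := by rw [h.ce_eq]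
    have e3 : (ce f).2.1 = cv (M.tgt f) := by rw [h.ce_eq]
    rw [e2, e3]
    rcases h.lookup_table hR (M.src f) with ⟨h1, h2⟩ | ⟨p, w, h1, h2, -⟩
    · simp [h1, h2]
    · rcases h.lookup_table hR (M.tgt f) with ⟨h3, h4⟩ | ⟨p', w', h3, h4, -⟩
      · rw [h4, if_neg (fun hc => ENat.natCast_ne_top _ hc.2.symm)]
        simp [h1, h3]
      · rw [h1, h3, h2, h4]
        simp only [List.flatMap_cons, List.flatMap_nil, List.append_nil, ifEq_eq, Nat.cast_inj]
        split_ifs <;> simp_all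
  rw [e]
  have := hR.filter (P := fun x => ∃ f ∈ M.layerCut R i, ce f = x)
    (Q := fun f => f ∈ M.layerCut R i) fun f _ =>
      ⟨fun ⟨f', hf', he⟩ => h.ce_inj he ▸ hf', fun hf => ⟨f, hf, rfl⟩⟩
  convert this using 1
  ext f
  simp [layerCut]

theorem Coding.stageTwo_spec (h : M.Coding verts cv cl ce) (hR : Represents ce Rl R)
    (h0 : M.dist R M.s M.t ≠ 0) :
    ∃ A₂, M.StageTwo R A₂ ∧ Represents ce (stageTwoL verts (cv M.s) (cv M.t) Rl)
      (R.filter fun e => M.lab e ∉ A₂) := by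
  unfold stageTwoL
  rcases h.lookup_table hR M.t with ⟨h1, h2⟩ | ⟨p, w, h1, h2, -⟩
  · refine ⟨∅, Or.inl ⟨h2, rfl⟩, ?_⟩
    rw [h1]
    simpa [caseL] using hR
  · rw [h1]
    simp only [caseL]
    have hpos : 0 < p.length := by
      rw [Nat.pos_iff_ne_zero]
      intro hc
      rw [h2, hc] at h0
      exact h0 rfl
    -- The list `p` has length `τ`, the distance of the sink, so its positions are exactly the
    -- admissible layers.
    rcases best_spec ((indices p).map fun i =>
      ((layerL (table verts Rl (cv M.s)) Rl i).length,
      (layerL (table verts Rl (cv M.s)) Rl i).map fun e => e.2.2.1)) with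
        ⟨hnil, -⟩ | ⟨m, hm, hb, hmin⟩
    · rw [List.map_eq_nil_iff, indices, List.range_eq_nil] at hnil
      omega
    · rw [hb]
      obtain ⟨i, hi, rfl⟩ := List.mem_map.1 hm
      rw [indices, List.mem_range] at hi
      have hrep := h.repr_layerL hR
      refine ⟨(M.layerCut R i).image M.lab, Or.inr ⟨p.length, i, h2, hi, fun j hj => ?_, rfl⟩,
        h.repr_removeLabs hR fun a => ?_⟩
      · have := hmin _ (List.mem_map_of_mem (List.mem_range.2 hj))
        rwa [(hrep i).length_eq h.ce_inj, (hrep j).length_eq h.ce_inj] at this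
      · simp only [List.mem_map, (hrep i).2, Finset.mem_image]
        constructor
        · rintro ⟨_, ⟨f, hf, rfl⟩, rfl⟩
          exact ⟨_, ⟨f, hf, rfl⟩, by rw [h.ce_eq]⟩
        · rintro ⟨_, ⟨f, hf, rfl⟩, rfl⟩
          exact ⟨_, ⟨f, hf, rfl⟩, by rw [h.ce_eq]⟩

variable [DecidableEq V]

theorem Coding.stageOneStep_spec (h : M.Coding verts cv cl ce) (hR : Represents ce Rl R) {g : ℕ}
    (hg : 1 ≤ g) :
    ((∃ d : ℕ, M.dist R M.s M.t = (d : ℕ∞) ∧ (d : ℝ) ≤ M.threshold g) ∧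
      ∃ p, M.IsShortest R p ∧
        Represents ce (stageOneStep verts (cv M.s) (cv M.t)
          (Fintype.card V * Fintype.card V * M.mu) g Rl)
          (R.filter fun e => M.lab e ∉ M.admLabels p)) ∨
    ((¬ ∃ d : ℕ, M.dist R M.s M.t = (d : ℕ∞) ∧ (d : ℝ) ≤ M.threshold g) ∧
      stageOneStep verts (cv M.s) (cv M.t) (Fintype.card V * Fintype.card V * M.mu) g Rl = Rl) := by
  unfold stageOneStep
  rcases h.lookup_table hR M.t with ⟨h1, h2⟩ | ⟨p, w, h1, h2, hw, hl, hlab⟩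
  · right
    rw [h1]
    refine ⟨?_, rfl⟩
    rintro ⟨d, hd, -⟩
    rw [h2] at hd
    exact ENat.natCast_ne_top _ hd.symm
  · rw [h1]
    simp only [caseL, ifLe]
    by_cases hc : p.length * p.length * p.length * g ≤ Fintype.card V * Fintype.card V * M.mu
    · left
      rw [if_pos hc]
      exact ⟨⟨p.length, h2, (le_threshold_iff hg).2 hc⟩, w, ⟨hw, by rw [hl, h2]⟩,
        h.repr_removeLabs hR hlab⟩
    · right
      rw [if_neg hc]
      refine ⟨?_, rfl⟩
      rintro ⟨d, hd, hdθ⟩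
      rw [h2] at hd
      obtain rfl : p.length = d := by exact_mod_cast hd
      exact hc ((le_threshold_iff hg).1 hdθ)

/-- The while-loop becomes a fold with one round per edge: a genuine round deletes an edge, and once
the loop condition fails the state no longer changes. -/
theorem Coding.stageOne_foldl (h : M.Coding verts cv cl ce) {g : ℕ} (hg : 1 ≤ g)
    (l : List MEdge) (hR : Represents ce Rl R) (h0 : M.dist R M.s M.t ≠ 0)
    (hl : R.card ≤ l.length) (A₁ : Finset Λ) :
    ∃ R' A₁', M.StageOne (M.threshold g) R A₁ R' A₁' ∧
      Represents ce (l.foldl (fun R _ => stageOneStep verts (cv M.s) (cv M.t)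
        (Fintype.card V * Fintype.card V * M.mu) g R) Rl) R' := by
  induction l generalizing R Rl A₁ with
  | nil =>
    -- Without edges only the empty walk remains, which would give distance zero; so the sink is
    -- unreachable and the loop has ended.
    obtain rfl : R = ∅ := Finset.card_eq_zero.1 (Nat.le_zero.1 hl)
    refine ⟨∅, A₁, .done _ _ ?_, hR⟩
    rintro ⟨d, hd, -⟩
    obtain ⟨p, hp, hlen⟩ := exists_walk (hd ▸ ENat.natCast_ne_top d)
    cases p with
    | nil => exact h0 (by rw [← hlen]; rfl)
    | cons e p => exact absurd hp.1 (by simp)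
  | cons a l ih =>
    rw [List.foldl_cons]
    rcases h.stageOneStep_spec hR hg with ⟨hc, p, hp, hrep⟩ | ⟨hc, hstep⟩
    · obtain ⟨R', A₁', h1, h2⟩ := ih hrep
        (fun h1 => h0 (le_antisymm ((dist_anti (Finset.filter_subset _ _)).trans h1.le) zero_le))
        (by
          have := hp.card_filter_lt h0
          rw [List.length_cons] at hl
          omega) (A₁ ∪ M.admLabels p)
      exact ⟨R', A₁', .step _ _ p _ _ hc hp h1, h2⟩
    · refine ⟨R, A₁, .done _ _ hc, ?_⟩
      rw [hstep]
      convert hR using 1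
      -- The loop condition has failed, so all remaining rounds are idle.
      clear ih hl
      induction l with
      | nil => rfl
      | cons b l ih => rw [List.foldl_cons, hstep, ih]

theorem Coding.muL_eq (h : M.Coding verts cv cl ce) {El : List MEdge}
    (hE : Represents ce El M.edges) : muL El = M.mu := by
  have key : ∀ e ∈ M.edges, (El.flatMap fun f =>
      ifEq f.1 (ce e).1 (ifEq f.2.1 (ce e).2.1 [f] []) []).length =
      (M.edges.filter fun f => M.src f = M.src e ∧ M.tgt f = M.tgt e).card := by
    intro e _
    have e1 : (El.flatMap fun f => ifEq f.1 (ce e).1 (ifEq f.2.1 (ce e).2.1 [f] []) []) =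
        El.filter fun f => f.1 = (ce e).1 ∧ f.2.1 = (ce e).2.1 := by
      rw [← flatMap_ite_eq_filter]
      refine List.flatMap_congr fun x _ => ?_
      simp only [ifEq_eq]
      split_ifs <;> simp_all
    rw [e1]
    refine (hE.filter (P := fun f => f.1 = (ce e).1 ∧ f.2.1 = (ce e).2.1) fun f _ => ?_).length_eq
      h.ce_inj
    simp only [h.ce_eq, h.cv_inj.eq_iff]
  obtain ⟨h1, h2⟩ := maxL_spec (El.map fun e => (El.flatMap fun f =>
    ifEq f.1 e.1 (ifEq f.2.1 e.2.1 [f] []) []).length)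
  refine le_antisymm ?_ (Finset.sup_le fun e he => ?_)
  · rcases h2 with h2 | h2
    · exact h2.le.trans (Nat.zero_le _)
    · obtain ⟨x, hx, he⟩ := List.mem_map.1 h2
      obtain ⟨e, hee, rfl⟩ := (hE.2 x).1 hx
      rw [key e hee] at he
      rw [muL, ← he]
      exact Finset.le_sup
        (f := fun e => (M.edges.filter fun f => M.src f = M.src e ∧ M.tgt f = M.tgt e).card) hee
  · rw [← key e he]
    exact h1 _ (List.mem_map_of_mem ((hE.2 _).2 ⟨e, he, rfl⟩))

variable {Al : List Lab} {El : List MEdge}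

theorem Coding.twoStage_spec (h : M.Coding verts cv cl ce) (hE : Represents ce El M.edges)
    (hA : Represents cl Al M.A) (h0 : M.dist M.edges M.s M.t ≠ 0) {g : ℕ} (hg : 1 ≤ g) :
    ∃ A', M.TwoStage g A' ∧
      Represents cl (twoStageL verts (cv M.s) (cv M.t) Al El g) A' := by
  unfold twoStageL stageOneL
  rw [h.muL_eq hE, h.verts_repr.length_eq h.cv_inj, Finset.card_univ]
  obtain ⟨R, A₁, h1, hrep1⟩ := h.stageOne_foldl hg El hE h0 (hE.length_eq h.ce_inj).ge ∅
  obtain ⟨hRE, himg⟩ := h1.subset_image le_rfl (Finset.empty_subset _)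
  have hspec := h1.spec (by simp) (Finset.empty_subset _)
  obtain ⟨A₂, h2, hrep2⟩ := h.stageTwo_spec hrep1 fun hc => h0
    (le_antisymm ((dist_anti hRE).trans hc.le) zero_le)
  have hTS : M.TwoStage g (A₁ ∪ A₂) := ⟨R, A₁, A₂, h1, h2, rfl⟩
  refine ⟨_, hTS, ?_⟩
  generalize stageTwoL verts (cv M.s) (cv M.t) _ = R2 at hrep2
  have himg2 : A₂ ⊆ M.edges.image M.lab := by
    rcases h2 with ⟨-, rfl⟩ | ⟨τ, i, -, -, -, rfl⟩
    · exact Finset.empty_subset _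
    · exact Finset.image_subset_image ((Finset.filter_subset _ _).trans hRE)
  -- The simulation carries only the remaining edges. Since all chosen labels occur on edges, a
  -- label is chosen exactly if it occurs on an edge of the multigraph but on no remaining one.
  have e1 : removedL Al El R2 = Al.filter fun a =>
      a ∈ El.map (fun e => e.2.2.1) ∧ a ∉ R2.map fun e => e.2.2.1 := by
    rw [removedL, ← flatMap_ite_eq_filter]
    refine List.flatMap_congr fun x _ => ?_
    simp only [ifLe_hasLab]
    split_ifs <;> simp_all
  have e2 : A₁ ∪ A₂ = M.A.filter fun l => l ∈ A₁ ∪ A₂ := by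
    ext l
    simp only [Finset.mem_filter, iff_and_self]
    exact fun hl => hTS.subset hl
  have hmem : ∀ {Rl : List MEdge} {R : Finset E}, Represents ce Rl R → ∀ l,
      cl l ∈ (Rl.map fun e => e.2.2.1) ↔ ∃ e ∈ R, M.lab e = l := by
    intro Rl R hR l
    simp only [List.mem_map, hR.2]
    constructor
    · rintro ⟨_, ⟨e, he, rfl⟩, hl⟩
      rw [h.ce_eq] at hl
      exact ⟨e, he, h.cl_inj hl⟩
    · rintro ⟨e, he, rfl⟩
      exact ⟨_, ⟨e, he, rfl⟩, by rw [h.ce_eq]⟩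
  rw [e1, e2]
  refine hA.filter (Q := fun l => l ∈ A₁ ∪ A₂)
    (P := fun a => a ∈ El.map (fun e => e.2.2.1) ∧ a ∉ R2.map fun e => e.2.2.1)
    fun l _ => ?_
  rw [hmem hE, hmem hrep2]
  constructor
  · rintro ⟨⟨e, he, rfl⟩, hne⟩
    by_contra hc
    rw [Finset.mem_union, not_or] at hc
    refine hne ⟨e, ?_, rfl⟩
    rw [hspec.1, Finset.mem_filter, Finset.mem_filter]
    exact ⟨⟨he, hc.1⟩, hc.2⟩
  · intro hl
    refine ⟨by simpa using Finset.union_subset himg himg2 hl, ?_⟩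
    rintro ⟨e, he, rfl⟩
    rw [hspec.1, Finset.mem_filter, Finset.mem_filter] at he
    exact (Finset.mem_union.1 hl).elim he.1.2 he.2

theorem Coding.multi_spec (h : M.Coding verts cv cl ce) (hE : Represents ce El M.edges)
    (hA : Represents cl Al M.A) :
    (M.Output none ∧ multiL verts (cv M.s) (cv M.t) Al El = []) ∨
    ∃ A' L, M.Output (some A') ∧ multiL verts (cv M.s) (cv M.t) Al El = [L] ∧
      Represents cl L A' := by
  have hsucc : M.dist M.edges M.s M.t ≠ 0 → ∃ A' L, M.Output (some A') ∧
      bestGuessL verts (cv M.s) (cv M.t) Al El = [L] ∧ Represents cl L A' := by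
    intro h0
    choose! sol hsol hrep using fun g (hg : 1 ≤ g) => h.twoStage_spec hE hA h0 hg
    -- The list of guesses contains 1 twice unless there are no admissible labels; the extra 1
    -- accounts for the maximum in `guesses`.
    have hguess : ∀ g, g ∈ M.guesses ↔ g ∈ 1 :: (indices Al).map fun i => i + 1 := by
      intro g
      rw [guesses, Finset.mem_Icc, ← hA.length_eq h.cl_inj, List.mem_cons, List.mem_map]
      simp only [indices, List.mem_range]
      constructor
      · rintro ⟨h1, h2⟩
        by_cases hg : g = 1
        · exact Or.inl hg
        · refine Or.inr ⟨g - 1, ?_, by omega⟩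
          rcases le_max_iff.1 h2 with h2 | h2 <;> omega
      · rintro (rfl | ⟨i, hi, rfl⟩)
        · exact ⟨le_rfl, le_max_left _ _⟩
        · exact ⟨by omega, le_max_of_le_right hi⟩
    have hpos : ∀ g ∈ M.guesses, 1 ≤ g := fun g hg => (Finset.mem_Icc.1 hg).1
    unfold bestGuessL
    rcases best_spec ((1 :: (indices Al).map fun i => i + 1).map fun g =>
      ((twoStageL verts (cv M.s) (cv M.t) Al El g).length,
        twoStageL verts (cv M.s) (cv M.t) Al El g)) with ⟨hnil, -⟩ | ⟨m, hm, hb, hmin⟩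
    · simp at hnil
    · rw [hb]
      obtain ⟨g, hg, rfl⟩ := List.mem_map.1 hm
      rw [← hguess] at hg
      refine ⟨sol g, _, .success h0 sol (fun g hg => hsol g (hpos g hg)) g hg fun g' hg' => ?_,
        rfl, hrep g (hpos g hg)⟩
      have := hmin _ (List.mem_map_of_mem ((hguess g').1 hg'))
      rwa [(hrep g (hpos g hg)).length_eq h.cl_inj, (hrep g' (hpos g' hg')).length_eq h.cl_inj]
        at this
  unfold multiL
  rcases h.lookup_table hE M.t with ⟨h1, h2⟩ | ⟨p, w, h1, h2, -⟩
  · rw [h1]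
    exact Or.inr (hsucc (by simp [h2]))
  · rw [h1]
    simp only [caseL, ifEq_eq]
    split_ifs with hp
    · exact Or.inl ⟨.failure (by rw [h2, hp]; rfl), rfl⟩
    · exact Or.inr (hsucc (by rw [h2]; exact_mod_cast hp))

end MultiInstance

/-! ## Correctness of the program -/

theorem nodup_flatMap_of_key {α β κ : Type} {l : List α} {f : α → List β} (key' : α → κ)
    (key : β → κ) (hl : (l.map key').Nodup) (hf : ∀ a ∈ l, (f a).Nodup)
    (hkey : ∀ a ∈ l, ∀ b ∈ f a, key b = key' a) : (l.flatMap f).Nodup := by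
  induction l with
  | nil => exact .nil
  | cons a l ih =>
    rw [List.map_cons, List.nodup_cons] at hl
    rw [List.flatMap_cons, List.nodup_append]
    refine ⟨hf a (by simp), ih hl.2 (fun b hb => hf b (by simp [hb]))
      (fun b hb => hkey b (by simp [hb])), ?_⟩
    rintro b hb _ hb' rfl
    obtain ⟨a', ha', hb'⟩ := List.mem_flatMap.1 hb'
    refine hl.1 (List.mem_map.2 ⟨a', ha', ?_⟩)
    rw [← hkey a' (by simp [ha']) b hb', hkey a (by simp) b hb]

theorem Represents.sum_map {α β : Type} {c : α → β} {l : List β} {s : Finset α}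
    (h : Represents c l s) (hc : Function.Injective c) (f : β → ℕ) :
    (l.map f).sum = ∑ a ∈ s, f (c a) := by
  classical
  rw [← List.sum_toFinset f h.1]
  have : l.toFinset = s.image c := by
    ext b
    simp [h.2]
  rw [this, Finset.sum_image fun a _ b _ hab => hc hab]

/-! ### Integral weights -/

theorem prod_enumL_of_le {ws : List (ℕ × ℕ)} {l : ℕ} (hl : ws.length ≤ l) :
    ((enumL ws).map fun c => ifEq c.1 l c.2.1 c.2.2).prod = (ws.map fun c => c.2).prod := by
  induction ws using List.reverseRecOn with
  | nil => rfl
  | append_singleton ws c ih =>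
    rw [List.length_append, List.length_singleton] at hl
    have hne : (enumL ws).length ≠ l := by
      rw [length_enumL]
      omega
    rw [enumL_append, List.map_append, List.prod_append, ih (by omega)]
    simp [ifEq_eq, hne]

/-- Replacing the denominator at position `l` by the numerator turns the product `D` of all
denominators into `(a / b) D`, without any division. -/
theorem prod_enumL_mul {ws : List (ℕ × ℕ)} {l a b : ℕ} (hl : ws[l]? = some (a, b)) :
    ((enumL ws).map fun c => ifEq c.1 l c.2.1 c.2.2).prod * b =
      a * (ws.map fun c => c.2).prod := by
  induction ws using List.reverseRecOn with
  | nil => simp at hl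
  | append_singleton ws c ih =>
    rw [enumL_append, List.map_append, List.prod_append, List.map_append, List.prod_append]
    simp only [List.map_cons, List.map_nil, List.prod_singleton, ifEq_eq, length_enumL]
    rcases lt_trichotomy l ws.length with h | rfl | h
    · rw [List.getElem?_append_left h] at hl
      rw [if_neg h.ne']
      have := ih hl
      simp only [ifEq_eq] at this
      linear_combination c.2 * this
    · rw [List.getElem?_concat_length, Option.some.injEq] at hl
      subst hl
      have := prod_enumL_of_le (ws := ws) le_rfl
      simp only [ifEq_eq] at this
      rw [this, if_pos rfl]
      ring
    · rw [List.getElem?_eq_none (by simp; omega)] at hl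
      simp at hl

namespace Instance

variable {I : Instance}

/-- The list `lw` holds the labels with the integral weights `wn`, which are proportional to the
weights of `I`. -/
structure Weights (I : Instance) (lw : List (ℕ × ℕ)) (wn : Fin I.q → ℕ) (D : ℕ) : Prop where
  pos : 0 < D
  eq : ∀ l, (wn l : ℝ) = I.w l * D
  repr : Represents (fun l : Fin I.q => ((l : ℕ), wn l)) lw Finset.univ
  nodup : (lw.map fun c => c.1).Nodup

theorem _root_.LabelCut.Input.Describes.weights {x : Input} (h : x.Describes I) :
    ∃ wn D, I.Weights (intWeights x.weights) wn D := by
  refine ⟨fun l => ((enumL x.weights).map fun c => ifEq c.1 l c.2.1 c.2.2).prod,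
    (x.weights.map fun c => c.2).prod, ?_, fun l => ?_, ⟨?_, fun c => ?_⟩, ?_⟩
  · refine Nat.pos_of_ne_zero fun h0 => ?_
    obtain ⟨c, hc, hc0⟩ := List.mem_map.1 (List.prod_eq_zero_iff.1 h0)
    obtain ⟨i, hi, rfl⟩ := List.mem_iff_getElem.1 hc
    obtain ⟨a, b, hab, hb, -⟩ := h.weights_eq ⟨i, by rw [← h.weights_length]; exact hi⟩
    rw [List.getElem?_eq_getElem hi, Option.some.injEq] at hab
    rw [hab] at hc0
    simp only at hc0
    omega
  · obtain ⟨a, b, hab, hb, hw⟩ := h.weights_eq l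
    have hb' : (b : ℝ) ≠ 0 := by
      have : b ≠ 0 := by omega
      exact_mod_cast this
    have := congrArg (Nat.cast (R := ℝ)) (prod_enumL_mul hab)
    rw [Nat.cast_mul, Nat.cast_mul] at this
    rw [hw, div_mul_eq_mul_div, eq_div_iff hb', this]
  · exact (List.nodup_range).map fun a b hab => (Prod.mk.inj hab).1
  · simp only [intWeights, indices, List.mem_map, List.mem_range, h.weights_length,
      Finset.mem_univ, true_and]
    constructor
    · rintro ⟨l, hl, rfl⟩
      exact ⟨⟨l, hl⟩, rfl⟩
    · rintro ⟨l, rfl⟩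
      exact ⟨l, l.2, rfl⟩
  · simp only [intWeights, List.map_map, indices]
    exact (List.nodup_range).map fun a b hab => hab

variable {lw : List (ℕ × ℕ)} {wn : Fin I.q → ℕ} {D k : ℕ} {l l₀ : Fin I.q}

namespace Weights

theorem le_iff (h : I.Weights lw wn D) : wn l ≤ wn l₀ ↔ I.w l ≤ I.w l₀ := by
  have hD : (0 : ℝ) < D := by exact_mod_cast h.pos
  rw [← Nat.cast_le (α := ℝ), h.eq, h.eq, mul_le_mul_iff_left₀ hD]

/-- An integer is below a ceiling exactly if it is below the number itself, so the copies are found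
by comparing products; the common factor `D` cancels. For weight zero both sides are false. -/
theorem lt_wbar_iff (h : I.Weights lw wn D) (hle : I.w l ≤ I.w l₀) {j : ℕ} :
    j < I.wbar k (I.w l₀) l ↔ j * wn l₀ < wn l * k := by
  have hD : (0 : ℝ) < D := by exact_mod_cast h.pos
  unfold wbar
  split_ifs with h0
  · have : wn l = 0 := by
      have := h.eq l
      rw [h0, zero_mul] at this
      exact_mod_cast this
    simp [this]
  · have hw : 0 < I.w l := lt_of_le_of_ne (I.w_nonneg l) (Ne.symm h0)
    have hW : 0 < I.w l₀ := hw.trans_le hle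
    rw [Nat.lt_ceil, lt_div_iff₀ hW, ← Nat.cast_lt (α := ℝ), Nat.cast_mul, Nat.cast_mul, h.eq,
      h.eq, ← mul_lt_mul_iff_left₀ hD]
    ring_nf

theorem length_eq (h : I.Weights lw wn D) : lw.length = I.q := by
  rw [h.repr.length_eq fun a b hab => Fin.ext (Prod.mk.inj hab).1]
  simp

theorem copiesL_eq (idx : List ℕ) (k W w : ℕ) :
    copiesL idx k W w = idx.filter fun j => j * W < w * k := by
  rw [← flatMap_ite_eq_filter, copiesL]
  refine List.flatMap_congr fun j _ => ?_
  unfold ifLe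
  split_ifs <;> first | rfl | omega

/-- The list algorithm looks for copies among `q` positions only, which loses nothing because `wbar
≤ k ≤ q`. This keeps the multigraph polynomial however large the weights are. -/
theorem mem_copiesL (h : I.Weights lw wn D) (hk : k ≤ I.q) (hle : I.w l ≤ I.w l₀) {j : ℕ} :
    j ∈ copiesL (indices lw) k (wn l₀) (wn l) ↔ j < I.wbar k (I.w l₀) l := by
  rw [copiesL_eq, List.mem_filter, indices, List.mem_range, h.length_eq, decide_eq_true_eq,
    ← h.lt_wbar_iff hle, and_iff_right_iff_imp]
  exact fun hj => hj.trans_le ((wbar_le hle).trans hk)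

theorem nodup_copiesL (lw : List (ℕ × ℕ)) (k W w : ℕ) : (copiesL (indices lw) k W w).Nodup := by
  rw [copiesL_eq]
  exact List.nodup_range.filter _

theorem mem (h : I.Weights lw wn D) (l : Fin I.q) : ((l : ℕ), wn l) ∈ lw :=
  (h.repr.2 _).2 ⟨l, Finset.mem_univ l, rfl⟩

end Weights

/-- The number of a copy of a label. -/
def labCode (I : Instance) (c : Fin I.q × ℕ) : Lab := (c.1, c.2)

open Classical in
/-- The numbers of an edge of the multigraph. -/
noncomputable def edgeCode (I : Instance) (k : ℕ) (W : ℝ)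
    (e : Fin I.n × Fin I.n × Fin I.q × ℕ) : MEdge :=
  (e.1, e.2.1, I.labCode e.2.2, if e.2.2 ∈ (I.reduce k W).A then 1 else 0)

/-! ### The lists that represent the multigraph and the candidates. -/

theorem labCode_injective (I : Instance) : Function.Injective I.labCode := by
  rintro ⟨a, i⟩ ⟨b, j⟩ h
  obtain ⟨h1, h2⟩ := Prod.mk.inj h
  exact Prod.ext (Fin.ext h1) h2

theorem coding {verts : List ℕ} (hv : Represents (fun v : Fin I.n => (v : ℕ)) verts Finset.univ)
    (k : ℕ) (W : ℝ) :
    (I.reduce k W).Coding verts (fun v => (v : ℕ)) I.labCode (I.edgeCode k W) where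
  cv_inj := Fin.val_injective
  cl_inj := I.labCode_injective
  ce_inj := by
    rintro ⟨a, b, c⟩ ⟨a', b', c'⟩ h
    obtain ⟨h1, h2⟩ := Prod.mk.inj h
    obtain ⟨h2, h3⟩ := Prod.mk.inj h2
    exact Prod.ext (Fin.ext h1) (Prod.ext (Fin.ext h2)
      (I.labCode_injective (Prod.mk.inj h3).1))
  verts_repr := hv
  ce_eq e := by
    unfold edgeCode
    congr

namespace Weights

theorem repr_admL (h : I.Weights lw wn D) (hk : k ≤ I.q) (l₀ : Fin I.q) :
    Represents I.labCode (admL lw k (wn l₀)) (I.reduce k (I.w l₀)).A := by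
  refine ⟨nodup_flatMap_of_key (fun c => c.1) (fun b => b.1) h.nodup (fun c _ => ?_)
    (fun c _ b hb => ?_), fun b => ?_⟩
  · unfold ifLe
    split_ifs
    · exact (nodup_copiesL ..).map fun i j hij => (Prod.mk.inj hij).2
    · exact .nil
  · unfold ifLe at hb
    split_ifs at hb
    · obtain ⟨i, -, rfl⟩ := List.mem_map.1 hb
      rfl
    · simp at hb
  · simp only [admL, List.mem_flatMap, h.repr.2, Finset.mem_univ, true_and, ifLe]
    constructor
    · rintro ⟨_, ⟨l, rfl⟩, hb⟩
      split_ifs at hb with hle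
      · obtain ⟨i, hi, rfl⟩ := List.mem_map.1 hb
        rw [h.le_iff] at hle
        exact ⟨(l, i), mem_reduce_A.2 ⟨hle, (h.mem_copiesL hk hle).1 hi⟩, rfl⟩
      · simp at hb
    · rintro ⟨⟨l, i⟩, hli, rfl⟩
      obtain ⟨h1, h2⟩ := mem_reduce_A.1 hli
      refine ⟨_, ⟨l, rfl⟩, ?_⟩
      rw [if_pos (h.le_iff.2 h1)]
      exact List.mem_map.2 ⟨i, (h.mem_copiesL hk h1).2 h2, rfl⟩

theorem repr_medgesL (h : I.Weights lw wn D) {x : Input} (hx : x.Describes I) (hk : k ≤ I.q)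
    (l₀ : Fin I.q) :
    Represents (I.edgeCode k (I.w l₀)) (medgesL x.edges lw k (wn l₀))
      (I.reduce k (I.w l₀)).edges := by
  refine ⟨nodup_flatMap_of_key id (fun b => (b.1, b.2.1, b.2.2.1.1)) (by simpa using hx.edges_nodup)
    (fun e _ => nodup_flatMap_of_key (fun c => c.1) (fun b => b.2.2.1.1) h.nodup (fun c _ => ?_)
      fun c _ b hb => ?_) (fun e _ b hb => ?_), fun b => ?_⟩
  · simp only [ifEq_eq, ifLe]
    split_ifs
    · exact (nodup_copiesL ..).map fun i j hij => by simpa using hij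
    · exact List.nodup_singleton _
    · exact .nil
  · simp only [ifEq_eq, ifLe] at hb
    split_ifs at hb with h1
    · obtain ⟨i, -, rfl⟩ := List.mem_map.1 hb
      exact h1.symm
    · rw [List.mem_singleton.1 hb]
      exact h1.symm
    · simp at hb
  · obtain ⟨c, -, hb⟩ := List.mem_flatMap.1 hb
    simp only [ifEq_eq, ifLe] at hb
    split_ifs at hb with h1
    · obtain ⟨i, -, rfl⟩ := List.mem_map.1 hb
      rfl
    · rw [List.mem_singleton.1 hb]
      rfl
    · simp at hb
  · simp only [medgesL, List.mem_flatMap, h.repr.2, Finset.mem_univ, true_and, ifLe, ifEq_eq,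
      hx.mem_edges]
    constructor
    · rintro ⟨_, ⟨u, v, l, hadj, rfl⟩, _, ⟨l', rfl⟩, hb⟩
      split_ifs at hb with h1 hle
      · obtain rfl := Fin.ext h1
        rw [h.le_iff] at hle
        obtain ⟨i, hi, rfl⟩ := List.mem_map.1 hb
        rw [h.mem_copiesL hk hle] at hi
        refine ⟨(u, v, l', i), mem_reduce_edges.2 ⟨hadj, by rwa [if_pos hle]⟩, ?_⟩
        rw [edgeCode, if_pos (mem_reduce_A.2 ⟨hle, hi⟩)]
        rfl
      · obtain rfl := Fin.ext h1
        rw [h.le_iff] at hle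
        rw [List.mem_singleton.1 hb]
        refine ⟨(u, v, l', 0), mem_reduce_edges.2 ⟨hadj, by rw [if_neg hle]; exact one_pos⟩, ?_⟩
        rw [edgeCode, if_neg fun hA => hle (mem_reduce_A.1 hA).1]
        rfl
      · simp at hb
    · rintro ⟨⟨u, v, l, i⟩, hi, rfl⟩
      obtain ⟨hadj, hi⟩ := mem_reduce_edges.1 hi
      refine ⟨_, ⟨u, v, l, hadj, rfl⟩, _, ⟨l, rfl⟩, ?_⟩
      rw [if_pos rfl]
      split_ifs at hi with hle
      · rw [if_pos (h.le_iff.2 hle), edgeCode, if_pos (mem_reduce_A.2 ⟨hle, hi⟩)]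
        exact List.mem_map.2 ⟨i, (h.mem_copiesL hk hle).2 hi, rfl⟩
      · rw [if_neg fun hc => hle (h.le_iff.1 hc), edgeCode,
          if_neg fun hA => hle (mem_reduce_A.1 hA).1]
        obtain rfl : i = 0 := by omega
        exact List.mem_singleton.2 rfl

theorem repr_convertL (h : I.Weights lw wn D) (hk : k ≤ I.q) (l₀ : Fin I.q) {L : List Lab}
    {A' : Finset (Fin I.q × ℕ)} (hL : Represents I.labCode L A') :
    Represents (fun l : Fin I.q => ((l : ℕ), wn l)) (convertL lw k (wn l₀) L)
      (I.convert k (I.w l₀) A') := by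
  have e : convertL lw k (wn l₀) L = lw.filter fun c =>
      c.2 ≤ wn l₀ ∧ ∀ i ∈ copiesL (indices lw) k (wn l₀) c.2, (c.1, i) ∈ L := by
    rw [convertL, ← flatMap_ite_eq_filter lw fun c =>
      c.2 ≤ wn l₀ ∧ ∀ i ∈ copiesL (indices lw) k (wn l₀) c.2, (c.1, i) ∈ L]
    refine List.flatMap_congr fun c _ => ?_
    -- The list in question consists of the missing copies, so it is nonempty exactly if the label
    -- is not returned.
    have e1 : (1 ≤ ((copiesL (indices lw) k (wn l₀) c.2).flatMap fun i =>
        ifLe 1 (hasLab (c.1, i) L) [] [i]).length) ↔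
        ¬ ∀ i ∈ copiesL (indices lw) k (wn l₀) c.2, (c.1, i) ∈ L := by
      rw [Nat.one_le_iff_ne_zero, ne_eq, List.length_eq_zero_iff, List.flatMap_eq_nil_iff,
        not_iff_not]
      refine forall₂_congr fun i _ => ?_
      rw [ifLe_hasLab]
      split_ifs with hi <;> simp [hi]
    unfold ifLe at e1 ⊢
    simp only [e1]
    split_ifs <;> simp_all
  rw [e]
  have := h.repr.filter (P := fun c => c.2 ≤ wn l₀ ∧
      ∀ i ∈ copiesL (indices lw) k (wn l₀) c.2, (c.1, i) ∈ L)
    (Q := fun l => I.w l ≤ I.w l₀ ∧ I.group k (I.w l₀) l ⊆ A') fun l _ => by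
      rw [h.le_iff]
      refine and_congr_right fun hle => ?_
      constructor
      · rintro hi ⟨l', i⟩ hg
        obtain ⟨rfl, hlt⟩ := mem_group.1 hg
        obtain ⟨c, hc, he⟩ := (hL.2 _).1 (hi i ((h.mem_copiesL hk hle).2 hlt))
        obtain rfl : c = (l', i) := I.labCode_injective he
        exact hc
      · exact fun hg i hi => (hL.2 _).2 ⟨(l, i),
          hg (mem_group.2 ⟨rfl, (h.mem_copiesL hk hle).1 hi⟩), rfl⟩
  convert this using 1
  unfold Instance.convert
  congr

theorem guessL_spec (h : I.Weights lw wn D) {x : Input} (hx : x.Describes I) {verts : List ℕ}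
    (hv : Represents (fun v : Fin I.n => (v : ℕ)) verts Finset.univ) (hk : k ≤ I.q)
    (l₀ : Fin I.q) :
    (I.GuessOutput k (I.w l₀) none ∧ guessL verts x.s x.t x.edges lw k (wn l₀) = []) ∨
    ∃ S m, I.GuessOutput k (I.w l₀) (some S) ∧
      guessL verts x.s x.t x.edges lw k (wn l₀) = [m] ∧ (m.1 : ℝ) = I.weight S * D ∧
      ∀ i, i ∈ m.2 ↔ ∃ l ∈ S, (l : ℕ) = i := by
  unfold guessL
  rw [hx.s_eq, hx.t_eq]
  rcases (coding hv k (I.w l₀)).multi_spec (h.repr_medgesL hx hk l₀) (h.repr_admL hk l₀) with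
    ⟨hout, he⟩ | ⟨A', L, hout, he, hrep⟩
  · refine Or.inl ⟨⟨none, by convert hout, rfl⟩, ?_⟩
    exact (congrArg _ he).trans rfl
  · refine Or.inr ⟨I.convert k (I.w l₀) A', _, ⟨some A', by convert hout, rfl⟩,
      (congrArg _ he).trans rfl, ?_, fun i => ?_⟩
    · have hrep' := h.repr_convertL hk l₀ hrep
      simp only
      rw [hrep'.sum_map fun a b hab => Fin.ext (Prod.mk.inj hab).1, weight, Finset.sum_mul,
        Nat.cast_sum]
      exact Finset.sum_congr rfl fun l _ => h.eq l
    · simp only [List.mem_map, (h.repr_convertL hk l₀ hrep).2]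
      constructor
      · rintro ⟨_, ⟨l, hl, rfl⟩, rfl⟩
        exact ⟨l, hl, rfl⟩
      · rintro ⟨l, hl, rfl⟩
        exact ⟨_, ⟨l, hl, rfl⟩, rfl⟩

end Weights

/-- Integral and real weights of candidates differ by the positive factor `D`, so a minimum for one
is a minimum for the other. -/
theorem mainL_spec {x : Input} (hx : x.Describes I) {verts : List ℕ}
    (hv : Represents (fun v : Fin I.n => (v : ℕ)) verts Finset.univ) :
    ∃ L', I.Output L' ∧ ∀ i, i ∈ mainL (verts, x.s, x.t, x.edges, x.weights) ↔
      ∃ l ∈ L', (l : ℕ) = i := by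
  obtain ⟨wn, D, h⟩ := hx.weights
  unfold mainL algoL
  simp only
  generalize intWeights x.weights = lw at h
  have hD : (0 : ℝ) < D := by exact_mod_cast h.pos
  have hex : ∀ k ∈ Finset.Icc 1 I.q, ∀ W ∈ Set.range I.w, ∃ o, I.GuessOutput k W o ∧
      ∃ Wn : ℕ, (Wn : ℝ) = W * D ∧
      ((o = none ∧ guessL verts x.s x.t x.edges lw k Wn = []) ∨
        ∃ S m, o = some S ∧ guessL verts x.s x.t x.edges lw k Wn = [m] ∧
          (m.1 : ℝ) = I.weight S * D ∧ ∀ i, i ∈ m.2 ↔ ∃ l ∈ S, (l : ℕ) = i) := by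
    rintro k hk _ ⟨l₀, rfl⟩
    rcases h.guessL_spec hx hv (Finset.mem_Icc.1 hk).2 l₀ with ⟨h1, h2⟩ | ⟨S, m, h1, h2⟩
    · exact ⟨none, h1, wn l₀, h.eq l₀, Or.inl ⟨rfl, h2⟩⟩
    · exact ⟨some S, h1, wn l₀, h.eq l₀, Or.inr ⟨S, m, rfl, h2⟩⟩
  choose! out hout Wn hWn hcase using hex
  -- `out` has to be a function of the weight, whereas the program runs through labels. Labels of
  -- equal weight have the same integral weight, so the two agree.
  have hWn' : ∀ k ∈ Finset.Icc 1 I.q, ∀ l, Wn k (I.w l) = wn l := fun k hk l => by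
    have := (hWn k hk _ ⟨l, rfl⟩).trans (h.eq l).symm
    exact_mod_cast this
  have hmem : ∀ k ∈ Finset.Icc 1 I.q, ∀ l, ∀ m ∈ guessL verts x.s x.t x.edges lw k (wn l),
      m ∈ (indices lw).flatMap fun k => lw.flatMap fun c =>
        guessL verts x.s x.t x.edges lw (k + 1) c.2 := by
    intro k hk l m hm
    rw [Finset.mem_Icc] at hk
    refine List.mem_flatMap.2 ⟨k - 1, ?_, List.mem_flatMap.2 ⟨_, h.mem l, ?_⟩⟩
    · rw [indices, List.mem_range, h.length_eq]
      omega
    · rwa [Nat.sub_add_cancel hk.1]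
  rcases best_spec ((indices lw).flatMap fun k => lw.flatMap fun c =>
    guessL verts x.s x.t x.edges lw (k + 1) c.2) with ⟨hnil, -⟩ | ⟨m, hm, hb, hmin⟩
  · exfalso
    obtain ⟨l₀, hl₀⟩ := I.exists_forall_guessOutput_isSome
    have hk : 1 ∈ Finset.Icc 1 I.q := Finset.mem_Icc.2 ⟨le_rfl, I.q_pos⟩
    have hsome := hl₀ _ (hout 1 hk _ ⟨l₀, rfl⟩)
    have hc := hcase 1 hk _ ⟨l₀, rfl⟩
    rw [hWn' 1 hk] at hc
    rcases hc with ⟨h1, -⟩ | ⟨S, m, -, h2, -⟩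
    · rw [h1] at hsome
      simp at hsome
    · have := hmem 1 hk l₀ m (by rw [h2]; simp)
      rw [hnil] at this
      simp at this
  · rw [hb]
    obtain ⟨k, hk, hm⟩ := List.mem_flatMap.1 hm
    obtain ⟨c, hc, hm⟩ := List.mem_flatMap.1 hm
    obtain ⟨l, -, rfl⟩ := (h.repr.2 c).1 hc
    rw [indices, List.mem_range, h.length_eq] at hk
    have hk' : k + 1 ∈ Finset.Icc 1 I.q := Finset.mem_Icc.2 ⟨by omega, by omega⟩
    have hcs := hcase (k + 1) hk' _ ⟨l, rfl⟩
    rw [hWn' _ hk'] at hcs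
    rcases hcs with ⟨-, h2⟩ | ⟨S, m', h1, h2, h3, h4⟩
    · rw [h2] at hm
      simp at hm
    · rw [h2] at hm
      obtain rfl := List.mem_singleton.1 hm
      refine ⟨S, ⟨out, hout, ⟨k + 1, hk', _, ⟨l, rfl⟩, h1⟩, ?_⟩, fun i => by simpa using h4 i⟩
      rintro k₂ hk₂ _ ⟨l₂, rfl⟩ S₂ hS₂
      have hcs := hcase k₂ hk₂ _ ⟨l₂, rfl⟩
      rw [hWn' _ hk₂] at hcs
      rcases hcs with ⟨h5, -⟩ | ⟨S', m₂, h5, h6, h7, -⟩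
      · rw [hS₂] at h5
        simp at h5
      · rw [hS₂, Option.some.injEq] at h5
        subst h5
        have hle := hmin m₂ (hmem k₂ hk₂ l₂ m₂ (by rw [h6]; simp))
        rw [← Nat.cast_le (α := ℝ), h3, h7] at hle
        exact le_of_mul_le_mul_right hle hD

end Instance

/-! ### The program -/

/-- The numbers below `e`, in descending order. -/
def rangeProg {Γ : List Ty} (e : Prog Γ .nat) : Prog Γ (.list .nat) :=
  .loop e .nil (.cons (.var .zero) (.var (.succ .zero)))

theorem val_rangeProg {Γ : List Ty} (e : Prog Γ .nat) (ρ : Env Γ) :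
    (rangeProg e).val ρ = (List.range (e.val ρ)).reverse := by
  simp only [rangeProg, Prog.val, Var.get]
  exact (List.foldl_flip_cons_eq_append' ..).trans (List.append_nil _)

theorem cost_rangeProg {Γ : List Ty} (e : Prog Γ .nat) (ρ : Env Γ) (n : ℕ) (hn : e.val ρ = n) :
    (rangeProg e).cost ρ = 2 + e.cost ρ + 4 * n := by
  have key : (List.foldl (fun (st : List ℕ × ℕ) i => (i :: st.1, st.2 + 1 + 3)) ([], 0)
      (List.range n)).2 = 4 * n := by
    clear hn
    induction n with
    | zero => rfl
    | succ n ih =>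
      rw [List.range_succ, List.foldl_append]
      simp only [List.foldl_cons, List.foldl_nil, ih]
      ring
  simp only [rangeProg, Prog.cost, Prog.val, Var.get, hn]
  exact (congrArg (1 + e.cost ρ + 1 + ·) key).trans (by ring)

/-- The input of the algorithm on lists. -/
abbrev ListInput := List ℕ × ℕ × ℕ × List (ℕ × ℕ × ℕ) × List (ℕ × ℕ)

/-- The input of the algorithm on lists that belongs to an input of programs. -/
def Input.toList (x : Input) : ListInput :=
  ((List.range x.n).reverse, x.s, x.t, x.edges, x.weights)

/-- Encodings of these types change nothing, but on lists they are maps of the identity, which do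
not reduce definitionally. -/
theorem enc_toList (x : Input) : enc x.toList = (show (ty ListInput).Val from x.toList) := by
  change ((List.range x.n).reverse.map fun n => n, x.s, x.t, x.edges.map fun e => e,
    x.weights.map fun c => c) = _
  simp only [List.map_id']
  rfl

theorem sz_pairs (ws : List (ℕ × ℕ)) :
    sz ws = (ws.map fun c => Nat.size c.1 + Nat.size c.2).sum + 2 * ws.length := by
  induction ws with
  | nil => rfl
  | cons c ws ih =>
    rw [sz_cons, ih, List.map_cons, List.sum_cons, List.length_cons]
    change Nat.size c.1 + Nat.size c.2 + 1 + 1 + _ = _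
    ring

/-- The input size counts `n` itself and not its bit length, so the list of all vertices is of
quadratic size. Sources, targets and labels are below `n` or `q`, which bounds their bit lengths. -/
theorem sz_toList_le {x : Input} {I : Instance} (hx : x.Describes I) :
    sz x.toList ≤ 3 * x.size ^ 2 + 9 * x.size + 4 := by
  have hself : ∀ m : ℕ, sz m ≤ m := fun m => Nat.size_le.2 Nat.lt_two_pow_self
  have hv : sz (List.range x.n).reverse ≤ x.n * (x.n + 1) := by
    have := sz_list_le (l := (List.range x.n).reverse) (B := x.n) fun i hi => by
      rw [List.mem_reverse, List.mem_range] at hi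
      exact (hself i).trans hi.le
    simpa using this
  have hs : sz x.s ≤ x.n := (hself _).trans (by rw [hx.s_eq, hx.n_eq]; exact I.s.2.le)
  have ht : sz x.t ≤ x.n := (hself _).trans (by rw [hx.t_eq, hx.n_eq]; exact I.t.2.le)
  have he : sz x.edges ≤ x.edges.length * (x.n + (x.n + x.weights.length + 1) + 1 + 1) := by
    refine sz_list_le fun e he => ?_
    obtain ⟨u, v, l, -, rfl⟩ := (hx.mem_edges e).1 he
    have h1 := (hself u).trans u.2.le
    have h2 := (hself v).trans v.2.le
    have h3 := (hself l).trans l.2.le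
    rw [hx.n_eq, hx.weights_length, sz_prod, sz_prod]
    omega
  have hw := sz_pairs x.weights
  have hN : x.size = x.n + x.edges.length + x.weights.length +
    (x.weights.map fun c => Nat.size c.1 + Nat.size c.2).sum := rfl
  have h1 : x.n * (x.n + 1) ≤ x.size * (x.size + 1) := Nat.mul_le_mul (by omega) (by omega)
  have h2 : x.edges.length * (x.n + (x.n + x.weights.length + 1) + 1 + 1) ≤
      x.size * (2 * x.size + 3) := Nat.mul_le_mul (by omega) (by omega)
  rw [Input.toList, sz_prod, sz_prod, sz_prod, sz_prod]
  generalize sz (List.range x.n).reverse = A at *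
  generalize sz x.s = B at *
  generalize sz x.t = C at *
  generalize sz x.edges = D at *
  generalize sz x.weights = F at *
  have h3 : A + (B + (C + (D + F + 1) + 1) + 1) + 1 ≤
      x.size * (x.size + 1) + x.size * (2 * x.size + 3) + 5 * x.size + 4 := by omega
  exact h3.trans (le_of_eq (by ring))

theorem repr_range (n : ℕ) :
    Represents (fun v : Fin n => (v : ℕ)) (List.range n).reverse Finset.univ := by
  refine ⟨List.nodup_reverse.2 List.nodup_range, fun b => ?_⟩
  simp only [List.mem_reverse, List.mem_range, Finset.mem_univ, true_and]
  exact ⟨fun h => ⟨⟨b, h⟩, rfl⟩, fun ⟨v, hv⟩ => hv ▸ v.2⟩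

/-- The program that replaces the first component of its input by the list of the numbers below
it and goes on with `P`. -/
def withRange {a b : Ty} (P : ∀ Γ : List Ty, Prog (.prod (.list .nat) a :: Γ) b) :
    Prog [.prod .nat a] b :=
  .letIn (.pair (rangeProg (.fst (.var .zero))) (.snd (.var .zero))) (P _)

theorem val_withRange {a b : Ty} (P : ∀ Γ : List Ty, Prog (.prod (.list .nat) a :: Γ) b)
    (n : ℕ) (y : a.Val) : (withRange P).val ((n, y), ()) =
      (P [.prod .nat a]).val (((List.range n).reverse, y), (n, y), ()) := by
  have h := val_rangeProg (Γ := [.prod .nat a]) (.fst (.var .zero)) ((n, y), ())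
  exact congrArg (fun l => (P [.prod .nat a]).val ((l, y), (n, y), ())) h

theorem cost_withRange {a b : Ty} (P : ∀ Γ : List Ty, Prog (.prod (.list .nat) a :: Γ) b)
    (n : ℕ) (y : a.Val) : (withRange P).cost ((n, y), ()) =
      8 + 4 * n + (P [.prod .nat a]).cost (((List.range n).reverse, y), (n, y), ()) := by
  have h := val_rangeProg (Γ := [.prod .nat a]) (.fst (.var .zero)) ((n, y), ())
  have h' := cost_rangeProg (Γ := [.prod .nat a]) (.fst (.var .zero)) ((n, y), ()) n rfl
  refine (congrArg₂ (fun c l => 1 + (1 + c + 2) + (P [.prod .nat a]).cost ((l, y), (n, y), ()))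
    h' h).trans ?_
  simp only [Prog.cost]
  exact congrArg (· + _) (by ring)

theorem exists_program : ∃ (P : Prog [inputTy] (.list .nat)) (p : Polynomial ℕ),
    ∀ (I : Instance) (x : Input), x.Describes I →
      P.stepsOn x ≤ p.eval x.size ∧
      ∃ L' : Finset (Fin I.q), I.Output L' ∧ ∀ m : ℕ, m ∈ P.resultOn x ↔ ∃ l ∈ L', (l : ℕ) = m := by
  obtain ⟨-, P, c, ⟨p, hp⟩, hP⟩ := PT.mainL
  -- The linear part pays for building the list of vertices, the composition for running `P` on an
  -- input of quadratic size.
  refine ⟨withRange P, 8 + 4 * Polynomial.X +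
    p.comp (3 * Polynomial.X ^ 2 + 9 * Polynomial.X + 4), fun I x hx => ⟨?_, ?_⟩⟩
  · have h1 := (hP x.toList [inputTy] (x.toVal, ())).2.trans (hp _)
    have h2 := h1.trans (eval_mono p (sz_toList_le hx))
    rw [enc_toList] at h2
    have h4 : x.n ≤ x.size := by
      unfold Input.size
      omega
    refine (cost_withRange P x.n (x.s, x.t, x.edges, x.weights)).le.trans
      ((Nat.add_le_add_left h2 _).trans ?_)
    simp only [Polynomial.eval_add, Polynomial.eval_mul, Polynomial.eval_X, Polynomial.eval_comp,
      Polynomial.eval_pow, Polynomial.eval_ofNat]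
    omega
  · have hv := repr_range x.n
    rw [hx.n_eq] at hv
    obtain ⟨L', hL', hmem⟩ := I.mainL_spec hx hv
    refine ⟨L', hL', fun m => ?_⟩
    have h1 := (hP x.toList [inputTy] (x.toVal, ())).1
    rw [enc_toList] at h1
    have h2 : (withRange P).resultOn x = mainL x.toList :=
      (val_withRange P x.n (x.s, x.t, x.edges, x.weights)).trans (h1.trans (List.map_id' _))
    rw [h2, ← hmem, Input.toList, hx.n_eq]

end LabelCut

theorem mainTheorem1 :
    (∃ C : ℝ, ∀ I : LabelCut.Instance,
      (∃ L' : Finset (Fin I.q), I.Output L') ∧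
      ∀ L' : Finset (Fin I.q), I.Output L' →
        I.IsLabelCut L' ∧
        ∀ S : Finset (Fin I.q), I.IsLabelCut S →
          I.weight L' ≤ C * (I.n : ℝ) ^ (2 / 3 : ℝ) * I.weight S) ∧
    (∃ (P : LabelCut.Prog [LabelCut.inputTy] (LabelCut.Ty.list LabelCut.Ty.nat))
      (p : Polynomial ℕ),
      ∀ (I : LabelCut.Instance) (x : LabelCut.Input), x.Describes I →
        P.stepsOn x ≤ p.eval x.size ∧
        ∃ L' : Finset (Fin I.q), I.Output L' ∧
          ∀ m : ℕ, m ∈ P.resultOn x ↔ ∃ l ∈ L', (l : ℕ) = m) :=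
  ⟨⟨4, fun I => ⟨I.exists_output, fun _ h => ⟨h.isLabelCut, fun _ hS => h.weight_le hS⟩⟩⟩,
    LabelCut.exists_program⟩
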